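/- Let $\mathbb T=\mathbb R/\mathbb Z$, and for an irrational number $a$ let $q_n(a)$ be the denominator of the $n$-th convergent of its continued fraction ($q_0=1$, $q_1=a_1$). Let $Y\subset[0,1]^4$ be the set of vectors $\alpha=(\alpha_1,\dots,\alpha_4)$ with irrational coordinates such that, writing $q_n^{(j)}=q_n(\alpha_j)$, for all $n\ge 1$ $$q_n^{(2)}\ge e^{nq_n^{(1)}},\quad q_n^{(3)}\ge e^{nq_n^{(2)}},\quad q_n^{(4)}\ge e^{nq_n^{(3)}},\quad q_{n+1}^{(1)}\ge e^{nq_n^{(4)}} .$$ For $\alpha\in Y$ and $n_0\in\mathbb N$ put $$\varphi(x)=1+\sum_{j=1}^4\sum_{n\ge n_0}\frac{\cos(2\pi q_n^{(j)}x_j)}{e^{q_n^{(j)}}},\qquad x\in\mathbb T^4,$$ where $n_0$ is such that $\varphi>0$ on $\mathbb T^4$. Let $M=\{(x,s)\in\mathbb T^4\times\mathbb R: 0\le s<\varphi(x)\}$, let $\mu$ be the restriction to $M$ of Haar measure times Lebesgue measure, and let $T^t=T^t_{\alpha,\varphi}$ ($t\in\mathbb R$) be the special flow on $M$ over $x\mapsto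 x+\alpha$ and under $\varphi$, i.e. the flow $(x,s)\mapsto(x,s+t)$ on $\mathbb T^4\times\mathbb R/\!\sim$, $(x,s+\varphi(x))\sim(x+\alpha,s)$, with fundamental domain $M$. Explicitly, $T^t(x,s)=(x+N\alpha,\;t+s-S_N\varphi(x))$, where $S_N\varphi$ ($N\in\mathbb Z$) are the Birkhoff sums of $\varphi$ over the translation and $N=N(x,s,t)$ is the unique integer with $0\le t+s-S_N\varphi(x)<\varphi(x+N\alpha)$. For $\zeta>0$ let $M_\zeta=\{(x,s)\in M: 0\le s\le\varphi(x)-\zeta\}$. A pair $(f,\psi)$ of functions that are $C^\infty$ on the quotient manifold $\mathbb T^4\times\mathbb R/\!\sim$ is called a smooth coboundary $f$ with transfer function $\psi$ if $\int_a^b f(T^tz)\,dt=\psi(T^bz)-\psi(T^az)$ for all $z\in M$ and $a<b$. Write $\|u\|_0=\sup_M|u|$, $\|u\|_{1,j}=\|u\|_0+\|\partial_{x_j}u\|_0$, and $$\mathcal N_1(f,g)=\max_{1\le j\le 4}\Big[(\|f\|_0+\|\psi\|_0)\|g\|_{1,j}+(\|f\|_{1,j}+\|\psi\|_{1,j})\|g\|_0\Big].$$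 **Theorem.** There is an absolute constant $\epsilon>0$ such that, for every $\alpha\in Y$ and every $\varphi$ as above: (a) For every $\zeta>0$ there is a constant $C=C(\alpha,\varphi,\zeta)>0$ such that for every smooth coboundary $f$ with transfer function $\psi$, every $C^1$ function $g$ on $M$ (as a subset of $\mathbb T^4\times\mathbb R$) supported in $M_\zeta$, and every real $t\ne0$, the function $(f\circ T^t)\,g$ is $\mu$-integrable and $$\Big|\int_M f(T^tz)\,g(z)\,d\mu(z)\Big|\le C\,\mathcal N_1(f,g)\,|t|^{-1/2-\epsilon}.$$ The function $|t|^{-1/2-\epsilon}$ is square integrable on $\{|t|\ge1\}$. (b) The maximal spectral type of $\{T^t\}$ on the space $L^2_0(M,\mu)$ of square integrable complex functions of zero average is absolutely continuous with respect to Lebesgue measure on $\mathbb R$. That is, every $h\in L^2_0(M,\mu)$ has a spectral measure $\sigma_h$ (a finite positive Borel measure on $\mathbb R$ with $\int_M h(T^tz)\overline{h(z)}\,d\mu(z)=\int_{\mathbb R} e^{2\pi i t\theta}\,d\sigma_h(\theta)$ for all $t$), and there is a finite measure $\rho\ll\mathrm{Leb}$ that dominates all the $\sigma_h$ and is absolutely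 continuous with respect to every other finite measure that does so. -/

import Mathlib

open MeasureTheory Set
open scoped ContDiff ComplexConjugate

noncomputable section

namespace SpecialFlow

/-- The torus `𝕋⁴ = (ℝ/ℤ)⁴`; its `volume` is the normalized Haar measure. -/
abbrev Torus4 : Type := Fin 4 → UnitAddCircle

/-- The projection `ℝ⁴ → 𝕋⁴`. -/
def proj (x : Fin 4 → ℝ) : Torus4 := fun j => (x j : UnitAddCircle)

/-- The denominator `q_n` of the `n`-th convergent of the continued fraction of `a`
(so `q_0 = 1`, `q_1 = a_1`). -/
def cfDenom (a : ℝ) (n : ℕ) : ℕ := (a.convergent n).den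

/-- The set `Y` of frequency vectors; the coordinates are numbered `0, 1, 2, 3`
instead of `1, 2, 3, 4`. -/
def freqSet : Set (Fin 4 → ℝ) :=
  {α | (∀ j, α j ∈ Icc (0 : ℝ) 1) ∧ (∀ j, Irrational (α j)) ∧
    ∀ n : ℕ, 1 ≤ n →
      Real.exp (n * cfDenom (α 0) n) ≤ cfDenom (α 1) n ∧
      Real.exp (n * cfDenom (α 1) n) ≤ cfDenom (α 2) n ∧
      Real.exp (n * cfDenom (α 2) n) ≤ cfDenom (α 3) n ∧
      Real.exp (n * cfDenom (α 3) n) ≤ cfDenom (α 0) (n + 1)}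

/-- The ceiling function
`φ(x) = 1 + ∑_j ∑_{n ≥ n₀} cos (2π q_n^{(j)} x_j) / exp (q_n^{(j)})`.
Here `fourier q y = exp (2π i q y)`, so its real part is the cosine. -/
def ceiling (α : Fin 4 → ℝ) (n₀ : ℕ) (x : Torus4) : ℝ :=
  1 + ∑ j : Fin 4, ∑' k : ℕ,
    (fourier (cfDenom (α j) (n₀ + k) : ℤ) (x j) : ℂ).re / Real.exp (cfDenom (α j) (n₀ + k))

/-- The Birkhoff sums `S_n φ`, `n ∈ ℤ`, over the translation by `α`. -/
def birkhoff (α : Fin 4 → ℝ) (φ : Torus4 → ℝ) : ℤ → Torus4 → ℝ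
  | Int.ofNat n, x => ∑ k ∈ Finset.range n, φ (x + k • proj α)
  | Int.negSucc n, x => -∑ k ∈ Finset.range (n + 1), φ (x - (k + 1) • proj α)

/-- The integer `n` counts the returns to the base of the orbit of `(x, s)` up to time `t`:
`0 ≤ t + s - S_n φ(x) < φ(x + n α)`. -/
def IsReturnCount (α : Fin 4 → ℝ) (φ : Torus4 → ℝ) (x : Torus4) (s t : ℝ) (n : ℤ) : Prop :=
  0 ≤ t + s - birkhoff α φ n x ∧ t + s - birkhoff α φ n x < φ (x + n • proj α)

theorem birkhoff_succ (α : Fin 4 → ℝ) (φ : Torus4 → ℝ) (n : ℤ) (x : Torus4) :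
    birkhoff α φ (n + 1) x = birkhoff α φ n x + φ (x + n • proj α) := by
  rcases n with n | n
  · change birkhoff α φ (Int.ofNat (n+1)) x = _
    simp [birkhoff, Finset.sum_range_succ]
  · rcases n with _ | n
    · change birkhoff α φ (Int.ofNat 0) x = _
      simp [birkhoff, sub_eq_add_neg]
    · have : (Int.negSucc (n+1)) + 1 = Int.negSucc n := by omega
      rw [this]
      simp only [birkhoff]
      rw [Finset.sum_range_succ _ (n+1)]
      have : x + Int.negSucc (n+1) • proj α = x - (n + 1 + 1) • proj α := by
        rw [negSucc_zsmul, sub_eq_add_neg]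
      rw [this]; ring

/-- The return count is well defined as soon as the ceiling is bounded away from `0`. -/
theorem existsUnique_isReturnCount (α : Fin 4 → ℝ) (φ : Torus4 → ℝ) {c : ℝ} (hc : 0 < c)
    (hφ : ∀ x, c ≤ φ x) (x : Torus4) (s t : ℝ) : ∃! n : ℤ, IsReturnCount α φ x s t n := by
  have step (n : ℤ) : birkhoff α φ n x + c ≤ birkhoff α φ (n+1) x := by
    rw [birkhoff_succ]; linarith [hφ (x + n • proj α)]
  have grow (n : ℤ) (k : ℕ) : birkhoff α φ n x + k * c ≤ birkhoff α φ (n + k) x := by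
    induction k with
    | zero => simp
    | succ k ih =>
      have := step (n + k)
      push_cast; rw [← add_assoc]; linarith
  have mono : StrictMono (fun n : ℤ => birkhoff α φ n x) :=
    strictMono_int_of_lt_succ fun n => by linarith [step n]
  obtain ⟨K, hK⟩ := exists_nat_gt (|t + s - birkhoff α φ 0 x| / c)
  rw [div_lt_iff₀ hc] at hK
  have h1 := grow 0 K
  have h2 := grow (-K) K
  rw [neg_add_cancel] at h2
  rw [zero_add] at h1
  have habs := abs_le.1 hK.le
  obtain ⟨n, hn, hmax⟩ := Int.exists_greatest_of_bdd
    (P := fun n : ℤ => birkhoff α φ n x ≤ t + s)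
    ⟨K, fun z hz => mono.le_iff_le.1 (by linarith [habs.2])⟩
    ⟨-K, by linarith [habs.1]⟩
  refine ⟨n, ⟨by linarith, ?_⟩, ?_⟩
  · by_contra hcon
    have := hmax (n + 1) (by rw [birkhoff_succ]; linarith)
    omega
  · rintro m ⟨hm0, hm1⟩
    have hle := hmax m (by linarith)
    refine le_antisymm hle ?_
    by_contra hlt
    have h3 : birkhoff α φ (m+1) x ≤ birkhoff α φ n x := mono.monotone (by omega)
    rw [birkhoff_succ] at h3
    linarith

/-- `N(x, s, t)`, the unique integer satisfying `IsReturnCount`. -/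
def returnCount (α : Fin 4 → ℝ) (φ : Torus4 → ℝ) (x : Torus4) (s t : ℝ) : ℤ :=
  Classical.epsilon (IsReturnCount α φ x s t)

/-- The special flow `T^t` over the translation by `α` and under `φ`. -/
def flow (α : Fin 4 → ℝ) (φ : Torus4 → ℝ) (t : ℝ) (z : Torus4 × ℝ) : Torus4 × ℝ :=
  (z.1 + returnCount α φ z.1 z.2 t • proj α,
    t + z.2 - birkhoff α φ (returnCount α φ z.1 z.2 t) z.1)

/-- The configuration space `M = {(x, s) : 0 ≤ s < φ(x)}`. -/
def phase (φ : Torus4 → ℝ) : Set (Torus4 × ℝ) := {z | 0 ≤ z.2 ∧ z.2 < φ z.1}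

/-- `M_ζ = {(x, s) ∈ M : 0 ≤ s ≤ φ(x) - ζ}`. -/
def phaseZeta (φ : Torus4 → ℝ) (ζ : ℝ) : Set (Torus4 × ℝ) :=
  {z | z ∈ phase φ ∧ 0 ≤ z.2 ∧ z.2 ≤ φ z.1 - ζ}

/-- The invariant measure `μ`: Haar times Lebesgue, restricted to `M`. -/
def phaseMeasure (φ : Torus4 → ℝ) : Measure (Torus4 × ℝ) :=
  (volume : Measure (Torus4 × ℝ)).restrict (phase φ)

/-- `f` is smooth on the phase space `𝕋⁴ × ℝ / ((x, s + φ(x)) ∼ (x + α, s))`, i.e. its pull-back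
by the covering `(x, s) ↦ T^s(x, 0)` from `ℝ⁴ × ℝ` to the phase space is `C^∞`. Only the values
of `f` on the fundamental domain `M` matter. -/
def SmoothOnPhase (α : Fin 4 → ℝ) (φ : Torus4 → ℝ) (f : Torus4 × ℝ → ℝ) : Prop :=
  ContDiff ℝ ∞ (fun p : (Fin 4 → ℝ) × ℝ => f (flow α φ p.2 (proj p.1, 0)))

/-- `f` is a smooth coboundary over the special flow, with transfer function `ψ`. -/
def IsSmoothCoboundary (α : Fin 4 → ℝ) (φ : Torus4 → ℝ) (f ψ : Torus4 × ℝ → ℝ) : Prop :=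
  SmoothOnPhase α φ f ∧ SmoothOnPhase α φ ψ ∧
    ∀ z ∈ phase φ, ∀ a b : ℝ, a < b →
      ∫ t in a..b, f (flow α φ t z) = ψ (flow α φ b z) - ψ (flow α φ a z)

/-- `g` is `C^1` on `M`, regarded as a subset of `𝕋⁴ × ℝ` (one-sided at `s = 0`). A function
that is `C^1` on the quotient phase space is in particular of this kind. -/
def IsC1OnPhase (φ : Torus4 → ℝ) (g : Torus4 × ℝ → ℝ) : Prop :=
  ContDiffOn ℝ 1 (fun p : (Fin 4 → ℝ) × ℝ => g (proj p.1, p.2))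
    {p | (proj p.1, p.2) ∈ phase φ}

/-- `g` is supported in `M_ζ` (which is closed). -/
def SupportedInZeta (φ : Torus4 → ℝ) (ζ : ℝ) (g : Torus4 × ℝ → ℝ) : Prop :=
  ∀ z ∈ phase φ, g z ≠ 0 → z ∈ phaseZeta φ ζ

/-- The partial derivative `∂_{x_j} u` in the base direction `j`. -/
def partialBase (j : Fin 4) (u : Torus4 × ℝ → ℝ) (z : Torus4 × ℝ) : ℝ :=
  deriv (fun h : ℝ => u (z.1 + Pi.single j (h : UnitAddCircle), z.2)) 0

/-- `‖u‖_0 = sup_M |u|`. -/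
def norm0 (φ : Torus4 → ℝ) (u : Torus4 × ℝ → ℝ) : ℝ := ⨆ z : phase φ, |u z|

/-- `‖u‖_{1,j} = ‖u‖_0 + ‖∂_{x_j} u‖_0`. -/
def norm1 (φ : Torus4 → ℝ) (j : Fin 4) (u : Torus4 × ℝ → ℝ) : ℝ :=
  norm0 φ u + norm0 φ (partialBase j u)

/-- `𝒩_1(f, g)`, where `ψ` is the transfer function of `f`:
the maximum over `j` of
`(‖f‖_0 + ‖ψ‖_0) ‖g‖_{1,j} + (‖f‖_{1,j} + ‖ψ‖_{1,j}) ‖g‖_0`. -/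
def normN1 (φ : Torus4 → ℝ) (f ψ g : Torus4 × ℝ → ℝ) : ℝ :=
  ⨆ j : Fin 4, ((norm0 φ f + norm0 φ ψ) * norm1 φ j g
    + (norm1 φ j f + norm1 φ j ψ) * norm0 φ g)

/-- `h` is square integrable with zero average. -/
def IsL2Zero {X : Type*} [MeasurableSpace X] (μ : Measure X) (h : X → ℂ) : Prop :=
  MemLp h 2 μ ∧ ∫ z, h z ∂μ = 0

/-- `σ` is the spectral measure of `h`: the finite positive Borel measure on `ℝ` with
`⟨h ∘ T^t, h⟩ = ∫ e^{2π i t θ} dσ(θ)` for all `t`. -/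
def IsSpectralMeasure {X : Type*} [MeasurableSpace X] (T : ℝ → X → X) (μ : Measure X)
    (h : X → ℂ) (σ : Measure ℝ) : Prop :=
  IsFiniteMeasure σ ∧ ∀ t : ℝ,
    ∫ z, h (T t z) * conj (h z) ∂μ
      = ∫ θ : ℝ, Complex.exp (2 * Real.pi * Complex.I * t * θ) ∂σ

/-- `ρ` dominates the spectral measures of all zero-average square integrable functions. -/
def DominatesSpectrum {X : Type*} [MeasurableSpace X] (T : ℝ → X → X) (μ : Measure X)
    (ρ : Measure ℝ) : Prop :=
  ∀ (h : X → ℂ) (σ : Measure ℝ), IsL2Zero μ h → IsSpectralMeasure T μ h σ → σ ≪ ρ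

/-- `ρ` represents the maximal spectral type of `T` on `L²_0`: it is, up to equivalence of
measures, the smallest finite measure that dominates all the spectral measures. -/
def IsMaximalSpectralType {X : Type*} [MeasurableSpace X] (T : ℝ → X → X) (μ : Measure X)
    (ρ : Measure ℝ) : Prop :=
  IsFiniteMeasure ρ ∧ DominatesSpectrum T μ ρ ∧
    ∀ ρ' : Measure ℝ, IsFiniteMeasure ρ' → DominatesSpectrum T μ ρ' → ρ ≪ ρ'

/-- Every zero-average square integrable function has a spectral measure, and the maximal
spectral type is absolutely continuous with respect to Lebesgue measure. -/
def HasACMaximalSpectralType {X : Type*} [MeasurableSpace X] (T : ℝ → X → X)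
    (μ : Measure X) : Prop :=
  (∀ h : X → ℂ, IsL2Zero μ h → ∃ σ : Measure ℝ, IsSpectralMeasure T μ h σ) ∧
    ∃ ρ : Measure ℝ, IsMaximalSpectralType T μ ρ ∧ ρ ≪ volume

end SpecialFlow

end

/-!
Decay of correlations. The functions `f` and `ψ` pull back, along `(x, u) ↦ T^u (x, 0)`, to
functions `F` and `Ψ` on `𝕋⁴ × ℝ` which are invariant under the deck transformations `(x, u) ↦ (x +
N α, u - S_N φ x)` and satisfy `∂_u Ψ = F`. Choosing `N` so that the image of `(x, u)` lies in the
phase space and differentiating the invariance of `Ψ` in the direction `j` gives `∂_j Ψ (x, u) =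
∂_j Ψ (deck N (x, u)) - (∂_j S_N φ) x * F (x, u)` (`partialBase_deck_rel`), with a bounded first
term. If `u ≤ C √q_{n+1}`, then `∂_j S_N φ` is `-2π q_n e^{-q_n} N sin (2π q_n x_j)` up to `O(q_n)`
(`exists_sum_modeSumDeriv_bound`). As `N` is comparable to `u`, the function `F * sin (2π q_n x_j)`
is `∂_j Ψ`, divided by a quantity of order `q_n u e^{-q_n}`, up to an error of order `e^{q_n} / u`,
and integration by parts on the slice of height `u` gains the factor `u e^{-q_n}`
(`abs_integral_mul_le_of_resonance`). Since `N` jumps as a function of `x`, it is replaced by a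
smooth count `smoothCount`.

The growth conditions on `α` put the denominators of all four coordinates into one sequence growing
like an iterated exponential, so that for every large `u` two different directions `a ≠ b` are
resonant in this sense, with `e^{q} ≤ u^{1/24}` (`exists_two_directions`,
`exists_isResonant_pair`). With `σ_a`, `σ_b` the sines of the two modes, `w = σ / (σ² + η²)` and `p
= η² / (σ² + η²)`, write `1 = σ_a w_a + p_a σ_b w_b + p_a p_b`. The first two terms contribute
`u^{1/24} / (u η)`; the last one has integral `O(η²)`, because the two modes depend on different
coordinates. For `η = u^{-1/3}` the total is `O(u^{-5/8})` (`exists_abs_integral_le_rpow`), so `ε =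
1/8` will do. With one direction only, the remainder would have mass `η` and the rate would miss
`u^{-1/2}`. Integration over the slices gives the bound for positive times; negative times reduce
to positive ones because `φ` is even (`isCoverPair_reverse`, `exists_correlation_bound`).

Absolute continuity. The correlations of smooth coboundaries with smooth functions vanishing near
the top and the bottom of `M` are square integrable in time. A vector whose correlations with a
total set of vectors are square integrable has an absolutely continuous spectral measure, so it
suffices that smooth coboundaries are total in `L²_0` and that the flow translates of the functions
character `×` bump are total in `L²` (`hasACMaximalSpectralType_of_memLp`). The second holds
because the translates of the slab `0 < s < min φ` cover `M`
(`ae_eq_zero_of_integral_flow_trig_bump`). For the first, a nontrivial character times a bump is a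
coboundary, the cohomological equation for a single character over the irrational translation being
solved by a multiple of it, and so is a bump in `s` alone with integral zero; the coboundaries of
these two kinds leave only the constants orthogonal to them (`exists_ae_eq_const_of_orthogonal`).
The existence of the spectral measures and of a maximal one is proved for general one-parameter
groups of isometries.
-/

noncomputable section

namespace SpecialFlow

open Filter Topology FourierTransform

/-! ### One-parameter groups of isometries -/

/-- A strongly continuous one-parameter group of linear isometries of a Hilbert space. -/
structure IsometryFlow (H : Type*) [NormedAddCommGroup H] [InnerProductSpace ℂ H] where
  /-- The isometry at time `t`. -/
  U : ℝ → H →ₗᵢ[ℂ] H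
  zero_apply : ∀ f, U 0 f = f
  add_apply : ∀ s t f, U (s + t) f = U s (U t f)
  continuous_apply : ∀ f, Continuous fun t => U t f

namespace IsometryFlow

variable {H : Type*} [NormedAddCommGroup H] [InnerProductSpace ℂ H]
  (V : IsometryFlow H)

/-- The correlation function `t ↦ ⟨U_t f, g⟩`, linear in `f`. -/
def corr (f g : H) (t : ℝ) : ℂ := inner ℂ g (V.U t f)

theorem continuous_corr (f g : H) : Continuous (V.corr f g) :=
  continuous_const.inner (V.continuous_apply f)

theorem norm_corr_le (f g : H) (t : ℝ) : ‖V.corr f g t‖ ≤ ‖f‖ * ‖g‖ := by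
  unfold corr
  refine (norm_inner_le_norm _ _).trans ?_
  rw [LinearIsometry.norm_map, mul_comm]

theorem corr_zero (f : H) : V.corr f f 0 = (‖f‖ : ℂ) ^ 2 := by
  unfold corr
  rw [V.zero_apply, inner_self_eq_norm_sq_to_K]; rfl

theorem inner_U_U (f g : H) (s t : ℝ) :
    inner ℂ (V.U t g) (V.U s f) = V.corr f g (s - t) := by
  unfold corr
  conv_lhs => rw [show s = t + (s - t) by ring, V.add_apply]
  rw [LinearIsometry.inner_map_map]

/-- The averaged operator `A_k f = ∫ k(t) U_t f dt`. -/
def avg (k : ℝ → ℂ) (f : H) : H := ∫ t, k t • V.U t f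

theorem integrable_smul_U {k : ℝ → ℂ} (hk : Integrable k) (f : H) :
    Integrable fun t => k t • V.U t f := by
  refine hk.smul_bdd (C := ‖f‖) (V.continuous_apply f).aestronglyMeasurable (ae_of_all _ fun t => ?_)
  simp

theorem avg_sub {k : ℝ → ℂ} (hk : Integrable k) (f g : H) :
    V.avg k (f - g) = V.avg k f - V.avg k g := by
  unfold avg
  rw [← integral_sub (V.integrable_smul_U hk f) (V.integrable_smul_U hk g)]
  simp [smul_sub]

variable [CompleteSpace H]

theorem inner_avg {k : ℝ → ℂ} (hk : Integrable k) (f g : H) :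
    inner ℂ g (V.avg k f) = ∫ t, k t * V.corr f g t := by
  unfold avg
  rw [← integral_inner (V.integrable_smul_U hk f)]
  simp [corr, inner_smul_right]

/-- Positive definiteness of the correlation function, in integrated form: the right-hand side is
a squared norm. -/
theorem inner_avg_self {k : ℝ → ℂ} (hk : Integrable k) (f : H) :
    inner ℂ (V.avg k f) (V.avg k f) = ∫ s, k s * ∫ t, conj (k t) * V.corr f f (s - t) := by
  rw [V.inner_avg hk]
  congr 1 with s
  congr 1
  unfold corr
  rw [← inner_conj_symm, V.inner_avg hk, ← integral_conj]
  congr 1 with t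
  rw [map_mul]
  congr 1
  unfold corr
  rw [inner_conj_symm, V.inner_U_U]; rfl

end IsometryFlow

/-- A continuous integrable function whose Fourier transform is nonnegative has an integrable
Fourier transform. -/
theorem integrable_fourier_of_nonneg {f : ℝ → ℂ} (hf : Integrable f) (hc : Continuous f)
    (hp : ∀ w, 0 ≤ (𝓕 f w).re ∧ (𝓕 f w).im = 0) : Integrable (𝓕 f) := by
  have hcont : Continuous (𝓕 f) :=
    VectorFourier.fourierIntegral_continuous Real.continuous_fourierChar continuous_inner hf
  have hre : ∀ w, 𝓕 f w = ((𝓕 f w).re : ℂ) := fun w => by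
    apply Complex.ext <;> simp [(hp w).2]
  -- Gaussian regularizations of `∫ 𝓕 f` converge to `f 0`
  have key : ∀ c : ℝ, 0 < c → ∫ w : ℝ, Complex.exp (-(c : ℂ)⁻¹ * (‖w‖ : ℂ) ^ 2) * 𝓕 f w =
      ∫ w : ℝ, ((Real.pi * c : ℂ) ^ (1 / 2 : ℂ)
        * Complex.exp (-Real.pi ^ 2 * c * ‖(0 : ℝ) - w‖ ^ 2)) • f w := by
    intro c hc0
    have hb : 0 < ((c : ℂ)⁻¹).re := by rw [← Complex.ofReal_inv]; simpa using hc0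
    have J : Integrable (fun w : ℝ => Complex.exp (-(c : ℂ)⁻¹ * (‖w‖ : ℂ) ^ 2)) := by
      have := GaussianFourier.integrable_cexp_neg_mul_sq_norm_add (V := ℝ) hb 0 0
      simpa using this
    have := (VectorFourier.integral_fourierIntegral_smul_eq_flip (L := innerₗ ℝ)
      Real.continuous_fourierChar continuous_inner J hf).symm
    simp only [smul_eq_mul, flip_innerₗ] at this
    refine this.trans ?_
    congr 1 with w
    rw [smul_eq_mul]
    congr 1
    have h2 := fourier_gaussian_innerProductSpace (V := ℝ) hb w
    refine h2.trans ?_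
    simp
    left
    ring_nf
  have lim := (Real.tendsto_integral_gaussian_smul' hf (v := 0) hc.continuousAt)
  have lim2 : Tendsto (fun c : ℝ => ∫ w : ℝ, Real.exp (-c⁻¹ * ‖w‖ ^ 2) * (𝓕 f w).re) atTop
      (𝓝 (f 0).re) := by
    have := (Complex.continuous_re.tendsto _).comp lim
    refine this.congr' ?_
    filter_upwards [Ioi_mem_atTop 0] with c (hc0 : 0 < c)
    have h1 := key c hc0
    simp only [Function.comp]
    have h3 : (∫ w : ℝ, Real.exp (-c⁻¹ * ‖w‖ ^ 2) * (𝓕 f w).re : ℝ) =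
      (∫ w : ℝ, Complex.exp (-(c : ℂ)⁻¹ * (‖w‖ : ℂ) ^ 2) * 𝓕 f w).re := by
      rw [← Complex.ofReal_re (∫ w : ℝ, Real.exp (-c⁻¹ * ‖w‖ ^ 2) * (𝓕 f w).re),
        ← integral_complex_ofReal]
      congr 2 with w
      push_cast
      rw [← hre]
    rw [h3, h1]
    simp
  refine ⟨hcont.aestronglyMeasurable, ?_⟩
  rw [hasFiniteIntegral_iff_norm]
  -- Fatou's lemma; nonnegativity turns the convergent regularized integrals into `L¹` norms
  have hfin : ∫⁻ w, ENNReal.ofReal ‖𝓕 f w‖ ≤ liminf (fun n : ℕ =>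
      ∫⁻ w, ENNReal.ofReal (Real.exp (-((n : ℝ) + 1)⁻¹ * ‖w‖ ^ 2) * (𝓕 f w).re)) atTop := by
    refine le_trans (le_of_eq ?_) (lintegral_liminf_le fun n => ?_)
    · congr 1 with w
      have : Tendsto (fun n : ℕ => ENNReal.ofReal (Real.exp (-((n : ℝ) + 1)⁻¹ * ‖w‖ ^ 2)
          * (𝓕 f w).re)) atTop (𝓝 (ENNReal.ofReal (Real.exp (-0 * ‖w‖ ^ 2) * (𝓕 f w).re))) := by
        refine ENNReal.tendsto_ofReal (Tendsto.mul_const _ ?_)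
        refine (Real.continuous_exp.tendsto _).comp (Tendsto.mul_const _ (Tendsto.neg ?_))
        simpa [one_div] using tendsto_one_div_add_atTop_nhds_zero_nat (𝕜 := ℝ)
      rw [this.liminf_eq, hre w, Complex.norm_real]
      simp [abs_of_nonneg (hp w).1]
    · refine (Continuous.measurable ?_).ennreal_ofReal
      exact Continuous.mul (by fun_prop) (Complex.continuous_re.comp hcont)
  refine hfin.trans_lt ?_
  have hint : ∀ c : ℝ, 0 < c → Integrable fun w : ℝ =>
      Real.exp (-c⁻¹ * ‖w‖ ^ 2) * (𝓕 f w).re := by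
    intro c hc0
    have hb : 0 < c⁻¹ := inv_pos.2 hc0
    refine Integrable.mul_bdd (c := ∫ w, ‖f w‖) ?_
      (Complex.continuous_re.comp hcont).aestronglyMeasurable (ae_of_all _ fun w => ?_)
    · simpa using integrable_exp_neg_mul_sq hb
    · refine (Complex.abs_re_le_norm _).trans ?_
      exact VectorFourier.norm_fourierIntegral_le_integral_norm _ _ _ _ _
  have : Tendsto (fun n : ℕ =>
      ∫⁻ w, ENNReal.ofReal (Real.exp (-((n : ℝ) + 1)⁻¹ * ‖w‖ ^ 2) * (𝓕 f w).re)) atTop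
      (𝓝 (ENNReal.ofReal (f 0).re)) := by
    have h4 := ENNReal.tendsto_ofReal (lim2.comp
      (tendsto_atTop_add_const_right _ (1 : ℝ) tendsto_natCast_atTop_atTop))
    refine h4.congr fun n => ?_
    simp only [Function.comp]
    rw [ofReal_integral_eq_lintegral_ofReal (hint _ (by positivity))]
    exact ae_of_all _ fun w => mul_nonneg (Real.exp_pos _).le (hp w).1
  rw [this.liminf_eq]
  exact ENNReal.ofReal_lt_top

/-! ### Bochner's theorem for correlation functions -/

namespace IsometryFlow

variable {H : Type*} [NormedAddCommGroup H] [InnerProductSpace ℂ H]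
  (V : IsometryFlow H)

/-- The correlation function damped by a Gaussian. -/
def dampedCorr (f : H) (ε : ℝ) (r : ℝ) : ℂ := Real.exp (-ε * r ^ 2) * V.corr f f r

theorem continuous_dampedCorr (f : H) (ε : ℝ) : Continuous (V.dampedCorr f ε) := by
  unfold dampedCorr
  have := V.continuous_corr f f
  fun_prop

theorem integrable_dampedCorr (f : H) {ε : ℝ} (hε : 0 < ε) : Integrable (V.dampedCorr f ε) := by
  unfold dampedCorr
  refine Integrable.mul_bdd (c := ‖f‖ * ‖f‖) ?_ (V.continuous_corr f f).aestronglyMeasurable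
    (ae_of_all _ (V.norm_corr_le f f))
  exact (integrable_exp_neg_mul_sq hε).ofReal

variable [CompleteSpace H]

/-- Up to a positive factor, the Fourier transform of the damped correlation function at `θ` is
the squared norm of `∫ exp (-2 ε t²) exp (-2 π i t θ) U_t f dt`. -/
theorem fourier_dampedCorr_nonneg (f : H) {ε : ℝ} (hε : 0 < ε) (θ : ℝ) :
    0 ≤ (𝓕 (V.dampedCorr f ε) θ).re ∧ (𝓕 (V.dampedCorr f ε) θ).im = 0 := by
  set g : ℝ → ℝ := fun t => Real.exp (-(2 * ε) * t ^ 2) with hg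
  set e : ℝ → ℂ := fun t => Complex.exp (-(2 * Real.pi * Complex.I * t * θ)) with he
  have he1 : ∀ t, ‖e t‖ = 1 := fun t => by
    rw [he]; simp only
    rw [show -(2 * (Real.pi : ℂ) * Complex.I * t * θ) = ((-(2 * Real.pi * t * θ) : ℝ) : ℂ)
      * Complex.I by push_cast; ring, Complex.norm_exp_ofReal_mul_I]
  have hecont : Continuous e := by fun_prop
  have hgint : Integrable (fun t => (g t : ℂ)) :=
    (integrable_exp_neg_mul_sq (by positivity : 0 < 2 * ε)).ofReal
  set k : ℝ → ℂ := fun t => g t * e t with hk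
  have hkint : Integrable k :=
    Integrable.mul_bdd (c := 1) hgint hecont.aestronglyMeasurable (ae_of_all _ fun t => (he1 t).le)
  have hee : ∀ s r, e s * conj (e (s - r)) = e r := fun s r => by
    simp only [he]
    rw [← Complex.exp_conj, ← Complex.exp_add]
    congr 1
    simp only [map_neg, map_mul, Complex.conj_ofReal, Complex.conj_I, map_ofNat]
    push_cast
    ring
  have h1 := V.inner_avg_self hkint f
  -- the mass of the Gaussian `exp (-4 ε s²)`, which appears after completing the square
  set G : ℝ := √(Real.pi / (4 * ε)) with hG
  have hGpos : 0 < G := by positivity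
  have h2 : ∫ s, k s * ∫ t, conj (k t) * V.corr f f (s - t) = G * 𝓕 (V.dampedCorr f ε) θ := by
    calc _ = ∫ s, ∫ r, ((g s : ℂ) * g (r - s)) * (e r * V.corr f f r) := by
          congr 1 with s
          rw [← integral_const_mul, ← integral_sub_left_eq_self _ volume s]
          congr 1 with r
          rw [← hee s r]
          simp only [hk, sub_sub_cancel, map_mul, Complex.conj_ofReal]
          rw [show g (s - r) = g (r - s) by simp only [hg]; congr 2; ring]
          ring
      _ = ∫ r, ∫ s, ((g s : ℂ) * g (r - s)) * (e r * V.corr f f r) := by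
          refine (integral_integral_swap ?_).symm
          have := Integrable.convolution_integrand (L := ContinuousLinearMap.mul ℝ ℂ) hgint hgint
          refine Integrable.mul_bdd (c := ‖f‖ * ‖f‖) this ?_ ?_
          · have := V.continuous_corr f f
            exact (Continuous.aestronglyMeasurable (by fun_prop))
          · refine ae_of_all _ fun p => ?_
            rw [norm_mul, he1, one_mul]
            exact V.norm_corr_le f f _
      _ = ∫ r, (G : ℂ) * (e r * V.dampedCorr f ε r) := by
          congr 1 with r
          rw [integral_mul_const]
          have : ∀ s, (g s : ℂ) * g (r - s) =
              ((Real.exp (-ε * r ^ 2) * Real.exp (-(4 * ε) * (s - r / 2) ^ 2) : ℝ) : ℂ) := by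
            intro s
            rw [← Complex.ofReal_mul]
            congr 1
            simp only [hg]
            rw [← Real.exp_add, ← Real.exp_add]
            congr 1
            ring_nf
          simp_rw [this]
          rw [integral_complex_ofReal, integral_const_mul,
            integral_sub_right_eq_self (fun s => Real.exp (-(4 * ε) * s ^ 2)) (r / 2),
            integral_gaussian]
          unfold dampedCorr
          push_cast
          ring
      _ = _ := by
          rw [integral_const_mul, Real.fourier_eq']
          congr 2 with r
          rw [smul_eq_mul]
          congr 2
          simp [he]
          ring_nf
  rw [h2, inner_self_eq_norm_sq_to_K] at h1
  have h3 : 𝓕 (V.dampedCorr f ε) θ = ((‖V.avg k f‖ ^ 2 / G : ℝ) : ℂ) := by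
    have : (G : ℂ) ≠ 0 := by exact_mod_cast hGpos.ne'
    push_cast
    field_simp
    rw [mul_comm]
    exact h1.symm
  rw [h3]
  exact ⟨by simp only [Complex.ofReal_re]; positivity, Complex.ofReal_im _⟩

/-- A normalized vector has a spectral measure (Bochner's theorem): it is a weak limit of the
measures whose densities are the Fourier transforms of the damped correlation functions. -/
theorem exists_spectralMeasure_of_norm_one {f : H} (hf : ‖f‖ = 1) :
    ∃ σ : Measure ℝ, IsFiniteMeasure σ ∧ ∀ t : ℝ,
      V.corr f f t = ∫ θ : ℝ, Complex.exp (2 * Real.pi * Complex.I * t * θ) ∂σ := by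
  set ε : ℕ → ℝ := fun n => 1 / ((n : ℝ) + 1) with hε
  have hε0 : ∀ n, 0 < ε n := fun n => by positivity
  set p : ℕ → ℝ → ℂ := fun n => 𝓕 (V.dampedCorr f (ε n)) with hp
  have hpn : ∀ n w, 0 ≤ (p n w).re ∧ (p n w).im = 0 :=
    fun n w => V.fourier_dampedCorr_nonneg f (hε0 n) w
  have hpi : ∀ n, Integrable (p n) := fun n =>
    integrable_fourier_of_nonneg (V.integrable_dampedCorr f (hε0 n))
      (V.continuous_dampedCorr f _) (hpn n)
  have hpre : ∀ n w, p n w = ((p n w).re : ℂ) := fun n w => by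
    apply Complex.ext <;> simp [(hpn n w).2]
  have hinv : ∀ (n : ℕ) (t : ℝ), ∫ θ : ℝ, Complex.exp (2 * Real.pi * Complex.I * t * θ) * p n θ =
      V.dampedCorr f (ε n) t := by
    intro n t
    have := congrFun ((V.continuous_dampedCorr f (ε n)).fourierInv_fourier_eq
      (V.integrable_dampedCorr f (hε0 n)) (hpi n)) t
    rw [← this, Real.fourierInv_eq']
    congr 1 with θ
    rw [smul_eq_mul]
    congr 2
    simp
    ring
  set m : ℕ → Measure ℝ := fun n => volume.withDensity fun w => ENNReal.ofReal (p n w).re with hm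
  have hchar : ∀ (n : ℕ) (t : ℝ), ∫ θ : ℝ, Complex.exp (2 * Real.pi * Complex.I * t * θ) ∂(m n) =
      V.dampedCorr f (ε n) t := by
    intro n t
    rw [← hinv, hm, integral_withDensity_eq_integral_toReal_smul₀
      (f := fun w => ENNReal.ofReal (p n w).re) (hpi n).re.aestronglyMeasurable.aemeasurable.ennreal_ofReal
        (by simp)]
    congr 1 with θ
    rw [ENNReal.toReal_ofReal (hpn n θ).1, Complex.real_smul, ← hpre, mul_comm]
  have hcorr0 : V.corr f f 0 = 1 := by rw [V.corr_zero, hf]; simp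
  have hprob : ∀ n, IsProbabilityMeasure (m n) := by
    intro n
    have hfin : IsFiniteMeasure (m n) := isFiniteMeasure_withDensity_ofReal (hpi n).re.2
    have := hchar n 0
    simp only [dampedCorr, hcorr0] at this
    simp at this
    exact ⟨by rw [← ENNReal.toReal_eq_one_iff]; exact_mod_cast this⟩
  have hchar' : ∀ n t, charFun (m n) t = V.dampedCorr f (ε n) (t / (2 * Real.pi)) := by
    intro n t
    rw [charFun_apply_real, ← hchar]
    congr 1 with θ
    congr 1
    push_cast
    field_simp
  have hlim : ∀ t, Tendsto (fun n => charFun (m n) t) atTop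
      (𝓝 (V.corr f f (t / (2 * Real.pi)))) := by
    intro t
    simp_rw [hchar']
    unfold dampedCorr
    have : Tendsto (fun n => ((Real.exp (-ε n * (t / (2 * Real.pi)) ^ 2) : ℝ) : ℂ)
        * V.corr f f (t / (2 * Real.pi))) atTop (𝓝 (((Real.exp (-0 * (t / (2 * Real.pi)) ^ 2) : ℝ)
          : ℂ) * V.corr f f (t / (2 * Real.pi)))) := by
      refine Tendsto.mul_const _ ((Complex.continuous_ofReal.tendsto _).comp
        ((Real.continuous_exp.tendsto _).comp (Tendsto.mul_const _ (Tendsto.neg ?_))))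
      exact tendsto_one_div_add_atTop_nhds_zero_nat
    simpa using this
  -- tightness comes from continuity of the limit of the characteristic functions at `0`
  have htight := isTightMeasureSet_of_tendsto_charFun (μ := m)
    (f := fun t => V.corr f f (t / (2 * Real.pi)))
    (Continuous.continuousAt ((V.continuous_corr f f).comp (by fun_prop))) hlim
  let μ : ℕ → ProbabilityMeasure ℝ := fun n => ⟨m n, hprob n⟩
  have hcompact : IsCompact (closure {μ n | n}) := by
    apply isCompact_closure_of_isTightMeasureSet
    convert htight using 1
    ext x
    constructor
    · rintro ⟨_, ⟨n, rfl⟩, rfl⟩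
      exact ⟨n, rfl⟩
    · rintro ⟨n, rfl⟩
      exact ⟨_, ⟨n, rfl⟩, rfl⟩
  -- by compactness the measures converge along a free ultrafilter
  obtain ⟨μ', -, hμ' : Tendsto _ _ _⟩ := hcompact.ultrafilter_le_nhds
    ((Filter.hyperfilter ℕ).map μ) (by
      refine .trans ?_ (monotone_principal subset_closure)
      simp)
  refine ⟨μ', inferInstance, fun t => ?_⟩
  rw [ProbabilityMeasure.tendsto_iff_forall_integral_rclike_tendsto ℂ] at hμ'
  have h1 := hμ' (BoundedContinuousFunction.innerProbChar (t * (2 * Real.pi)))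
  have h2 := (hlim (t * (2 * Real.pi))).mono_left Nat.hyperfilter_le_atTop
  simp_rw [charFun_eq_integral_innerProbChar] at h2
  have h3 := tendsto_nhds_unique h2 h1
  rw [mul_div_cancel_right₀ _ (by positivity)] at h3
  rw [h3]
  congr 1 with θ
  simp only [BoundedContinuousFunction.innerProbChar_apply]
  congr 1
  simp
  ring

theorem exists_spectralMeasure (f : H) :
    ∃ σ : Measure ℝ, IsFiniteMeasure σ ∧ ∀ t : ℝ,
      V.corr f f t = ∫ θ : ℝ, Complex.exp (2 * Real.pi * Complex.I * t * θ) ∂σ := by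
  by_cases hf : f = 0
  · exact ⟨0, inferInstance, fun t => by simp [corr, hf]⟩
  have hf' : ‖f‖ ≠ 0 := norm_ne_zero_iff.2 hf
  obtain ⟨σ, hσ, h⟩ := V.exists_spectralMeasure_of_norm_one (f := ((‖f‖ : ℂ)⁻¹ • f))
    (by rw [norm_smul]; simp [hf'])
  refine ⟨(‖f‖₊ ^ 2) • σ, inferInstance, fun t => ?_⟩
  rw [integral_smul_nnreal_measure, ← h t]
  unfold corr
  rw [map_smul, inner_smul_left, inner_smul_right]
  have : (‖f‖ : ℂ) ≠ 0 := by exact_mod_cast hf'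
  rw [NNReal.smul_def, Complex.real_smul]
  simp
  field_simp

end IsometryFlow

/-! ### Absolutely continuous spectral measures -/

open scoped Manifold in
/-- A smooth Urysohn function on the line, as a Schwartz function. -/
theorem exists_schwartz_bump {K U : Set ℝ} (hK : IsCompact K) (hU : IsOpen U) (hKU : K ⊆ U) :
    ∃ m : SchwartzMap ℝ ℂ, ∃ g : ℝ → ℝ, (∀ x, m x = g x) ∧ (∀ x, 0 ≤ g x ∧ g x ≤ 1) ∧
      (∀ x ∈ K, g x = 1) ∧ ∀ x ∉ U, g x = 0 := by
  obtain ⟨g, hg1, hg2, hg3, hg4⟩ := exists_contMDiff_support_eq_eq_one_iff 𝓘(ℝ, ℝ)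
    (hU.inter (Metric.isOpen_thickening (δ := 1) (E := K))) hK.isClosed
    (subset_inter hKU (Metric.self_subset_thickening one_pos K))
  have hc : HasCompactSupport g := by
    refine HasCompactSupport.of_support_subset_isCompact (hK.cthickening (r := 1)) ?_
    rw [hg3]
    exact inter_subset_right.trans (Metric.thickening_subset_cthickening _ _)
  have hc' : HasCompactSupport (fun x => (g x : ℂ)) :=
    hc.comp_left (g := fun y : ℝ => (y : ℂ)) Complex.ofReal_zero
  have hs : ContDiff ℝ ∞ (fun x => (g x : ℂ)) :=
    Complex.ofRealCLM.contDiff.comp (contMDiff_iff_contDiff.1 hg1)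
  refine ⟨hc'.toSchwartzMap hs, g, fun x => rfl, fun x => hg2 (mem_range_self x),
    fun x hx => (hg4 x).1 hx, fun x hx => ?_⟩
  rw [← Function.notMem_support, hg3]
  exact fun h => hx h.1

namespace IsometryFlow

variable {H : Type*} [NormedAddCommGroup H] [InnerProductSpace ℂ H]
  (V : IsometryFlow H)

/-- `σ` is the spectral measure of the vector `f`. -/
def IsSpec (f : H) (σ : Measure ℝ) : Prop :=
  IsFiniteMeasure σ ∧ ∀ t : ℝ,
    V.corr f f t = ∫ θ : ℝ, Complex.exp (2 * Real.pi * Complex.I * t * θ) ∂σ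

/-- Two finite measures with the same Fourier transform agree. -/
theorem eq_of_forall_integral_exp_eq {σ τ : Measure ℝ} [IsFiniteMeasure σ] [IsFiniteMeasure τ]
    (h : ∀ t : ℝ, ∫ θ : ℝ, Complex.exp (2 * Real.pi * Complex.I * t * θ) ∂σ =
      ∫ θ : ℝ, Complex.exp (2 * Real.pi * Complex.I * t * θ) ∂τ) : σ = τ := by
  refine Measure.ext_of_charFun (funext fun t => ?_)
  have := h (t / (2 * Real.pi))
  rw [charFun_apply_real, charFun_apply_real]
  convert this using 3 with x x <;>
  · congr 1
    push_cast
    field_simp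

theorem norm_exp_mul (t θ : ℝ) : ‖Complex.exp (2 * Real.pi * Complex.I * t * θ)‖ = 1 := by
  rw [show 2 * (Real.pi : ℂ) * Complex.I * t * θ = ((2 * Real.pi * t * θ : ℝ) : ℂ)
      * Complex.I by push_cast; ring, Complex.norm_exp_ofReal_mul_I]

theorem integrable_exp_mul (σ : Measure ℝ) [IsFiniteMeasure σ] (t : ℝ) :
    Integrable (fun θ : ℝ => Complex.exp (2 * Real.pi * Complex.I * t * θ)) σ :=
  Integrable.of_bound (C := 1) (Continuous.aestronglyMeasurable (by fun_prop))
    (ae_of_all _ fun θ => (norm_exp_mul t θ).le)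

theorem IsSpec.real_univ {f : H} {σ : Measure ℝ} (h : V.IsSpec f σ) : σ.real univ = ‖f‖ ^ 2 := by
  have := h.2 0
  rw [V.corr_zero] at this
  simp at this
  exact_mod_cast this.symm

/-- The spectral measures of `a + b` and `a - b` add up to twice those of `a` and `b`, by the
parallelogram law. -/
theorem IsSpec.le [CompleteSpace H] {a b : H} {σ τ ρ : Measure ℝ} (ha : V.IsSpec a σ)
    (hb : V.IsSpec b τ) (hab : V.IsSpec (a + b) ρ) (s : Set ℝ) : ρ s ≤ 2 * σ s + 2 * τ s := by
  obtain ⟨ρ', hρ'⟩ := V.exists_spectralMeasure (a - b)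
  have := ha.1; have := hb.1; have := hab.1; have := hρ'.1
  have key : ρ + ρ' = (σ + σ) + (τ + τ) := by
    refine eq_of_forall_integral_exp_eq fun t => ?_
    rw [integral_add_measure (integrable_exp_mul _ t) (integrable_exp_mul _ t),
      integral_add_measure (integrable_exp_mul _ t) (integrable_exp_mul _ t),
      integral_add_measure (integrable_exp_mul _ t) (integrable_exp_mul _ t),
      integral_add_measure (integrable_exp_mul _ t) (integrable_exp_mul _ t),
      ← ha.2, ← hb.2, ← hab.2, ← hρ'.2]
    unfold corr
    simp only [map_add, map_sub, inner_add_left, inner_add_right, inner_sub_left, inner_sub_right]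
    ring
  calc ρ s ≤ (ρ + ρ') s := by simp
    _ = 2 * σ s + 2 * τ s := by rw [key]; simp [two_mul]

/-- Fubini for the Fourier transform of a finite measure. -/
theorem integral_mul_integral_exp {k b : ℝ → ℂ} (hk : Integrable k) (hb : Continuous b) {C : ℝ}
    (hbC : ∀ θ, ‖b θ‖ ≤ C) (σ : Measure ℝ) [IsFiniteMeasure σ] :
    ∫ t, k t * ∫ θ, Complex.exp (2 * Real.pi * Complex.I * t * θ) * b θ ∂σ =
      ∫ θ, 𝓕⁻ k θ * b θ ∂σ := by
  simp_rw [← integral_const_mul]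
  rw [integral_integral_swap]
  · congr 1 with θ
    rw [Real.fourierInv_eq', ← integral_mul_const]
    congr 1 with t
    rw [smul_eq_mul, ← mul_assoc, mul_comm (k t)]
    congr 3
    simp
    ring
  · have h1 : Integrable (fun p : ℝ × ℝ => k p.1 * (1 : ℂ)) (volume.prod σ) :=
      hk.mul_prod (integrable_const (1 : ℂ))
    simp only [mul_one] at h1
    refine Integrable.mul_bdd (c := C) h1 ?_ (ae_of_all _ fun p => ?_)
    · exact Continuous.aestronglyMeasurable (by fun_prop)
    · rw [norm_mul, norm_exp_mul, one_mul]
      exact hbC _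

variable [CompleteSpace H]

theorem IsSpec.inner_avg {f : H} {σ : Measure ℝ} (h : V.IsSpec f σ) {k : ℝ → ℂ}
    (hk : Integrable k) : inner ℂ f (V.avg k f) = ∫ θ, 𝓕⁻ k θ ∂σ := by
  have := h.1
  rw [V.inner_avg hk]
  have h1 := integral_mul_integral_exp hk (b := fun _ => 1) continuous_const (C := 1)
    (by simp) σ
  simp only [mul_one] at h1
  simp_rw [h.2]
  exact h1

/-- The averaged operator `A_k` is a contraction when the inverse Fourier transform of `k` is
bounded by `1`: it is the multiplication by `𝓕⁻ k` in the spectral representation of `f`. -/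
theorem norm_avg_le {k : ℝ → ℂ} (hk : Integrable k) (hk1 : ∀ θ, ‖𝓕⁻ k θ‖ ≤ 1) (f : H) :
    ‖V.avg k f‖ ≤ ‖f‖ := by
  obtain ⟨σ, hσ, h⟩ := V.exists_spectralMeasure f
  have hcont : Continuous (𝓕⁻ k) := by
    have : Continuous (𝓕 k) :=
      VectorFourier.fourierIntegral_continuous Real.continuous_fourierChar continuous_inner hk
    have h2 : 𝓕⁻ k = fun θ => 𝓕 k (-θ) := funext fun θ => Real.fourierInv_eq_fourier_neg k θ
    rw [h2]
    exact this.comp continuous_neg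
  have h1 := V.inner_avg_self hk f
  have h2 : ∀ s, ∫ t, conj (k t) * V.corr f f (s - t) =
      ∫ θ, Complex.exp (2 * Real.pi * Complex.I * s * θ) * conj (𝓕⁻ k θ) ∂σ := by
    intro s
    have h3 := congrArg conj (integral_mul_integral_exp hk
      (b := fun θ => Complex.exp (2 * Real.pi * Complex.I * (-s : ℝ) * θ)) (by fun_prop) (C := 1)
      (fun θ => (norm_exp_mul _ _).le) σ)
    rw [← integral_conj, ← integral_conj] at h3
    have hexp : ∀ t θ : ℝ, conj (Complex.exp (2 * Real.pi * Complex.I * t * θ)) =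
        Complex.exp (2 * Real.pi * Complex.I * (-t : ℝ) * θ) := by
      intro t θ
      rw [← Complex.exp_conj]
      congr 1
      simp only [map_mul, Complex.conj_ofReal, Complex.conj_I, map_ofNat]
      push_cast
      ring
    refine Eq.trans ?_ (h3.trans ?_)
    · congr 1 with t
      rw [map_mul]
      congr 1
      rw [← integral_conj, h]
      congr 1 with θ
      rw [map_mul, hexp, hexp, ← Complex.exp_add]
      congr 1
      push_cast
      ring
    · congr 1 with θ
      rw [map_mul, hexp, neg_neg, mul_comm]
  simp_rw [h2] at h1
  rw [integral_mul_integral_exp hk (b := fun θ => conj (𝓕⁻ k θ))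
    (Complex.continuous_conj.comp hcont) (C := 1) (by intro θ; simpa using hk1 θ) σ,
    inner_self_eq_norm_sq_to_K] at h1
  have h4 : ‖V.avg k f‖ ^ 2 ≤ ‖f‖ ^ 2 := by
    have h5 : ‖∫ θ, 𝓕⁻ k θ * conj (𝓕⁻ k θ) ∂σ‖ ≤ 1 * σ.real univ := by
      refine norm_integral_le_of_norm_le_const (ae_of_all _ fun θ => ?_)
      rw [norm_mul, RCLike.norm_conj]
      nlinarith [hk1 θ, norm_nonneg (𝓕⁻ k θ)]
    rw [← h1, one_mul, IsSpec.real_univ V ⟨hσ, h⟩, norm_pow] at h5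
    simpa using h5
  exact (pow_le_pow_iff_left₀ (norm_nonneg _) (norm_nonneg _) two_ne_zero).1 h4

/-- If all correlations of `f` with a total set `D` are square integrable, then `⟨A_k f, g⟩ → 0`
for every `g`, whenever `k → 0` in `L²` along contractions `A_k`. Here `k = 𝓕 m`, so that the
`L²` norm of `k` is that of `m`, by Plancherel. -/
theorem tendsto_inner_avg {D : Set H} (hD : Dense (Submodule.span ℂ D : Set H)) {f : H}
    (hf : ∀ g ∈ D, MemLp (V.corr f g) 2) (m : ℕ → SchwartzMap ℝ ℂ)
    (hm1 : ∀ n θ, ‖m n θ‖ ≤ 1) (hm2 : Tendsto (fun n => ‖(m n).toLp 2‖) atTop (𝓝 0)) (g : H) :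
    Tendsto (fun n => inner ℂ g (V.avg (𝓕 (m n) : SchwartzMap ℝ ℂ) f)) atTop (𝓝 0) := by
  have hint : ∀ n, Integrable (𝓕 (m n) : SchwartzMap ℝ ℂ) := fun n => (𝓕 (m n)).integrable
  have hcontr : ∀ n, ‖V.avg (𝓕 (m n) : SchwartzMap ℝ ℂ) f‖ ≤ ‖f‖ := fun n => by
    refine V.norm_avg_le (hint n) (fun θ => ?_) f
    rw [← SchwartzMap.fourierInv_coe, FourierPair.fourierInv_fourier_eq]
    exact hm1 n θ
  have hspan : ∀ g ∈ Submodule.span ℂ D,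
      Tendsto (fun n => inner ℂ g (V.avg (𝓕 (m n) : SchwartzMap ℝ ℂ) f)) atTop (𝓝 0) := by
    intro g hg
    induction hg using Submodule.span_induction with
    | mem g hg =>
      have hc := hf g hg
      have hc' : MemLp (fun t => conj (V.corr f g t)) 2 := hc.star
      have hbound : ∀ n, ‖inner ℂ g (V.avg (𝓕 (m n) : SchwartzMap ℝ ℂ) f)‖ ≤
          ‖hc'.toLp‖ * ‖(m n).toLp 2‖ := by
        intro n
        have : inner ℂ g (V.avg (𝓕 (m n) : SchwartzMap ℝ ℂ) f) =
            inner ℂ (hc'.toLp) ((𝓕 (m n)).toLp 2) := by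
          rw [V.inner_avg (hint n), L2.inner_def]
          refine integral_congr_ae ?_
          filter_upwards [hc'.coeFn_toLp, (𝓕 (m n)).coeFn_toLp 2] with t h1 h2
          rw [h1, h2, RCLike.inner_apply, Complex.conj_conj]
        rw [this, ← SchwartzMap.norm_fourier_toL2_eq (m n)]
        exact norm_inner_le_norm _ _
      refine squeeze_zero_norm hbound ?_
      simpa using hm2.const_mul ‖hc'.toLp‖
    | zero => simp
    | add x y _ _ hx hy => simpa [inner_add_left] using hx.add hy
    | smul a x _ hx => simpa [inner_smul_left, mul_comm] using hx.const_mul (conj a)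
  rw [Metric.tendsto_atTop]
  intro ε hε
  obtain ⟨g', hg', hgg⟩ := Metric.mem_closure_iff.1 (hD g) (ε / (2 * (‖f‖ + 1))) (by positivity)
  obtain ⟨N, hN⟩ := Metric.tendsto_atTop.1 (hspan g' hg') (ε / 2) (half_pos hε)
  refine ⟨N, fun n hn => ?_⟩
  have h1 := hN n hn
  rw [dist_zero_right] at h1 ⊢
  have h2 : inner ℂ g (V.avg (𝓕 (m n) : SchwartzMap ℝ ℂ) f) =
      inner ℂ (g - g') (V.avg (𝓕 (m n) : SchwartzMap ℝ ℂ) f) +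
          inner ℂ g' (V.avg (𝓕 (m n) : SchwartzMap ℝ ℂ) f) := by
    rw [inner_sub_left]; ring
  have h3 : ‖inner ℂ (g - g') (V.avg (𝓕 (m n) : SchwartzMap ℝ ℂ) f)‖ ≤ ε / 2 := by
    refine (norm_inner_le_norm _ _).trans ?_
    rw [dist_eq_norm] at hgg
    calc ‖g - g'‖ * ‖V.avg (𝓕 (m n) : SchwartzMap ℝ ℂ) f‖ ≤ ε / (2 * (‖f‖ + 1)) * (‖f‖ + 1) := by
          gcongr
          linarith [hcontr n]
      _ = ε / 2 := by field_simp
  rw [h2]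
  linarith [norm_add_le (inner ℂ (g - g') (V.avg (𝓕 (m n) : SchwartzMap ℝ ℂ) f))
    (inner ℂ g' (V.avg (𝓕 (m n) : SchwartzMap ℝ ℂ) f))]

/-- Square integrable correlations with a total set force absolutely continuous spectrum. A compact
null set `K` is approximated by bump functions `m n`, equal to `1` on `K`, which tend to `0` in `L²`;
the spectral measure of `K` is at most `⟨A_n h, h⟩`, where `A_n` averages against `𝓕 (m n)`, and this
tends to `0`. No bound on the density is obtained, hence none is needed for the vectors in the
closure of the span of `W`. -/
theorem IsSpec.absolutelyContinuous {W D : Set H} (hD : Dense (Submodule.span ℂ D : Set H))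
    (hW : ∀ f ∈ W, ∀ g ∈ D, MemLp (V.corr f g) 2) {h : H}
    (hh : h ∈ closure (Submodule.span ℂ W : Set H)) {σ : Measure ℝ} (hσ : V.IsSpec h σ) :
    σ ≪ volume := by
  have := hσ.1
  have hspan : ∀ f ∈ Submodule.span ℂ W, ∀ g ∈ D, MemLp (V.corr f g) 2 := by
    intro f hf g hg
    induction hf using Submodule.span_induction with
    | mem f hf => exact hW f hf g hg
    | zero =>
      have h0 : V.corr 0 g = fun _ => 0 := by
        funext t
        simp [corr]
      rw [h0]
      exact MemLp.zero
    | add x y _ _ hx hy =>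
      convert hx.add hy using 1
      funext t
      simp [corr]
    | smul a x _ hx =>
      convert hx.const_mul a using 1
      funext t
      simp [corr]
  have hcomp : ∀ K : Set ℝ, IsCompact K → volume K = 0 → σ K = 0 := by
    intro K hK hK0
    have hU : ∀ n : ℕ, ∃ U, K ⊆ U ∧ IsOpen U ∧ volume U ≤ ENNReal.ofReal (1 / ((n : ℝ) + 1)) := by
      intro n
      obtain ⟨U, h1, h2, h3⟩ := K.exists_isOpen_lt_of_lt (μ := volume)
        (ENNReal.ofReal (1 / ((n : ℝ) + 1))) (by rw [hK0, ENNReal.ofReal_pos]; positivity)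
      exact ⟨U, h1, h2, h3.le⟩
    choose U hKU hUo hUv using hU
    choose m b hmb hb01 hbK hbU using fun n => exists_schwartz_bump hK (hUo n) (hKU n)
    have hm1 : ∀ n θ, ‖m n θ‖ ≤ 1 := fun n θ => by
      rw [hmb, Complex.norm_real, Real.norm_of_nonneg (hb01 n θ).1]; exact (hb01 n θ).2
    have hlim0 : Tendsto (fun n : ℕ => √(1 / ((n : ℝ) + 1))) atTop (𝓝 0) := by
      have := (Real.continuous_sqrt.tendsto 0).comp
        (tendsto_one_div_add_atTop_nhds_zero_nat (𝕜 := ℝ))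
      rwa [Real.sqrt_zero] at this
    have hm2 : Tendsto (fun n => ‖(m n).toLp 2‖) atTop (𝓝 0) := by
      refine squeeze_zero (fun n => norm_nonneg _) (fun n => ?_) hlim0
      refine Real.le_sqrt_of_sq_le ?_
      have h1 : ‖(m n).toLp 2‖ ^ 2 = ∫ x, ‖m n x‖ ^ 2 := by
        rw [← RCLike.ofReal_inj (K := ℂ), RCLike.ofReal_pow, ← inner_self_eq_norm_sq_to_K (𝕜 := ℂ),
          L2.inner_def]
        rw [← integral_ofReal]
        refine integral_congr_ae ?_
        filter_upwards [(m n).coeFn_toLp 2] with x hx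
        rw [hx, inner_self_eq_norm_sq_to_K]
        simp
      rw [h1]
      have hUfin : volume (U n) ≠ ⊤ := ((hUv n).trans_lt ENNReal.ofReal_lt_top).ne
      calc ∫ x, ‖m n x‖ ^ 2 ≤ ∫ x, (U n).indicator (fun _ => (1 : ℝ)) x := by
            refine integral_mono_of_nonneg (ae_of_all _ fun x => by positivity) ?_
              (ae_of_all _ fun x => ?_)
            · exact (integrable_indicator_iff (hUo n).measurableSet).2
                (integrableOn_const hUfin)
            · by_cases hx : x ∈ U n
              · simp only [indicator_of_mem hx]
                exact pow_le_one₀ (norm_nonneg _) (hm1 n x)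
              · simp [indicator_of_notMem hx, hmb, hbU n x hx]
        _ = (volume (U n)).toReal := by
            rw [integral_indicator (hUo n).measurableSet]
            simp [Measure.real]
        _ ≤ _ := by
            refine ENNReal.toReal_le_of_le_ofReal (by positivity) (hUv n)
    have hint : ∀ n, Integrable (𝓕 (m n) : SchwartzMap ℝ ℂ) := fun n => (𝓕 (m n)).integrable
    have hinv : ∀ n θ, 𝓕⁻ (𝓕 (m n) : SchwartzMap ℝ ℂ) θ = m n θ := fun n θ => by
      rw [FourierPair.fourierInv_fourier_eq]
    have hcontr : ∀ n v, ‖V.avg (𝓕 (m n) : SchwartzMap ℝ ℂ) v‖ ≤ ‖v‖ := fun n v => by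
      refine V.norm_avg_le (hint n) (fun θ => ?_) v
      rw [← SchwartzMap.fourierInv_coe, hinv]
      exact hm1 n θ
    -- `⟨A_n h, h⟩` tends to zero, by approximation of `h` from the span of `W`
    have hlim : Tendsto (fun n => inner ℂ h (V.avg (𝓕 (m n) : SchwartzMap ℝ ℂ) h)) atTop (𝓝 0) := by
      rw [Metric.tendsto_atTop]
      intro ε hε
      obtain ⟨f, hf, hfh⟩ := Metric.mem_closure_iff.1 hh (ε / (2 * (‖h‖ + 1))) (by positivity)
      obtain ⟨N, hN⟩ := Metric.tendsto_atTop.1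
        (V.tendsto_inner_avg hD (hspan f hf) m hm1 hm2 h) (ε / 2) (half_pos hε)
      refine ⟨N, fun n hn => ?_⟩
      have h1 := hN n hn
      rw [dist_zero_right] at h1 ⊢
      have h2 : V.avg (𝓕 (m n) : SchwartzMap ℝ ℂ) h =
          V.avg (𝓕 (m n) : SchwartzMap ℝ ℂ) (h - f) +
          V.avg (𝓕 (m n) : SchwartzMap ℝ ℂ) f := by
        rw [V.avg_sub (hint n)]; abel
      have h3 : ‖inner ℂ h (V.avg (𝓕 (m n) : SchwartzMap ℝ ℂ) (h - f))‖ ≤ ε / 2 := by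
        refine (norm_inner_le_norm _ _).trans ?_
        rw [dist_eq_norm] at hfh
        calc ‖h‖ * ‖V.avg (𝓕 (m n) : SchwartzMap ℝ ℂ) (h - f)‖ ≤ (‖h‖ + 1) * (ε / (2 * (‖h‖ + 1))) := by
              gcongr
              · linarith
              · exact (hcontr n _).trans hfh.le
          _ = ε / 2 := by field_simp
      rw [h2, inner_add_right]
      linarith [norm_add_le (inner ℂ h (V.avg (𝓕 (m n) : SchwartzMap ℝ ℂ) (h - f)))
        (inner ℂ h (V.avg (𝓕 (m n) : SchwartzMap ℝ ℂ) f))]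
    have hle : ∀ n, σ.real K ≤ ‖inner ℂ h (V.avg (𝓕 (m n) : SchwartzMap ℝ ℂ) h)‖ := by
      intro n
      have h0 := IsSpec.inner_avg V hσ (hint n)
      simp_rw [← SchwartzMap.fourierInv_coe, hinv n, hmb] at h0
      rw [h0, integral_complex_ofReal, Complex.norm_real]
      refine le_trans ?_ (le_abs_self _)
      have hbint : Integrable (b n) σ := by
        have h5 : ∀ x, b n x = (m n x).re := fun x => by rw [hmb]; simp
        refine Integrable.of_bound (C := 1) ?_ (ae_of_all _ fun θ => ?_)
        · rw [show b n = fun x => (m n x).re from funext h5]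
          exact (Complex.continuous_re.comp (m n).continuous).aestronglyMeasurable
        · rw [Real.norm_of_nonneg (hb01 n θ).1]; exact (hb01 n θ).2
      calc σ.real K = ∫ θ, K.indicator (fun _ => (1 : ℝ)) θ ∂σ := by
            rw [integral_indicator hK.measurableSet]; simp
        _ ≤ ∫ θ, b n θ ∂σ := by
            refine integral_mono ?_ hbint fun θ => ?_
            · exact (integrable_indicator_iff hK.measurableSet).2
                (integrableOn_const (measure_ne_top _ _))
            · by_cases hx : θ ∈ K
              · simp [indicator_of_mem hx, hbK n θ hx]
              · simp [indicator_of_notMem hx, (hb01 n θ).1]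
    have : σ.real K ≤ 0 := ge_of_tendsto' (by simpa using hlim.norm) hle
    exact (measureReal_eq_zero_iff (measure_ne_top _ _)).1 (le_antisymm this measureReal_nonneg)
  refine Measure.AbsolutelyContinuous.mk fun s hs hs0 => ?_
  rw [hs.measure_eq_iSup_isCompact]
  simp only [ENNReal.iSup_eq_zero]
  exact fun K hKs hK => hcomp K hK (measure_mono_null hKs hs0)

/-- A separable set of vectors has a maximal spectral type: the sum of the spectral measures of
a dense sequence, made finite. -/
theorem exists_maximal [SecondCountableTopology H] (S : Set H) (hS : ∀ a ∈ S, ∀ b ∈ S, a - b ∈ S) :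
    ∃ ρ : Measure ℝ, IsFiniteMeasure ρ ∧ (∀ h ∈ S, ∀ σ, V.IsSpec h σ → σ ≪ ρ) ∧
      ∀ ρ' : Measure ℝ, (∀ h ∈ S, ∀ σ, V.IsSpec h σ → σ ≪ ρ') → ρ ≪ ρ' := by
  rcases S.eq_empty_or_nonempty with rfl | hne
  · exact ⟨0, inferInstance, by simp, fun ρ' _ => Measure.AbsolutelyContinuous.zero ρ'⟩
  have := hne.to_subtype
  choose σ hσ using V.exists_spectralMeasure
  have hσf : ∀ f, IsFiniteMeasure (σ f) := fun f => (hσ f).1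
  set v := TopologicalSpace.denseSeq S with hv
  set τ : Measure ℝ := Measure.sum fun n => σ (v n) with hτ
  refine ⟨τ.toFinite, inferInstance, fun h hh ς hς => ?_, fun ρ' hρ' => ?_⟩
  · refine Measure.AbsolutelyContinuous.trans ?_ (absolutelyContinuous_toFinite τ)
    refine Measure.AbsolutelyContinuous.mk fun s hs hs0 => ?_
    rw [hτ, Measure.sum_apply _ hs, ENNReal.tsum_eq_zero] at hs0
    have hςf := hς.1
    refine le_antisymm (ENNReal.le_of_forall_pos_le_add fun ε hε _ => ?_) bot_le
    obtain ⟨_, ⟨n, rfl⟩, hn⟩ := Metric.mem_closure_iff.1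
      (TopologicalSpace.denseRange_denseSeq S ⟨h, hh⟩) (√(ε / 2)) (by positivity)
    have h1 := IsSpec.le V (a := v n) (b := h - v n) (ρ := ς) (hσ _) (hσ _)
      (by simpa using hς) s
    rw [hs0 n] at h1
    have h2 : σ (h - v n) s ≤ ENNReal.ofReal (‖h - v n‖ ^ 2) := by
      rw [← IsSpec.real_univ V (hσ (h - v n)), Measure.real,
        ENNReal.ofReal_toReal (measure_ne_top _ _)]
      exact measure_mono (subset_univ _)
    rw [Subtype.dist_eq, dist_eq_norm] at hn
    have h3 : ‖h - v n‖ ^ 2 ≤ ε / 2 := by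
      rw [← Real.sq_sqrt (by positivity : (0 : ℝ) ≤ ε / 2)]
      exact pow_le_pow_left₀ (norm_nonneg _) hn.le 2
    calc ς s ≤ 2 * 0 + 2 * σ (h - v n) s := h1
      _ ≤ 2 * 0 + 2 * ENNReal.ofReal (ε / 2) := by
          gcongr
          exact h2.trans (ENNReal.ofReal_le_ofReal h3)
      _ = 0 + ε := by
          rw [mul_zero, ← ENNReal.ofReal_ofNat 2, ← ENNReal.ofReal_mul (by norm_num),
            mul_div_cancel₀ _ (by norm_num), ENNReal.ofReal_coe_nnreal]
  · refine Measure.AbsolutelyContinuous.trans (toFinite_absolutelyContinuous τ) ?_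
    refine Measure.AbsolutelyContinuous.mk fun s hs hs0 => ?_
    rw [hτ, Measure.sum_apply _ hs, ENNReal.tsum_eq_zero]
    exact fun n => hρ' _ (v n).2 _ (hσ _) hs0

end IsometryFlow

/-! ### The Koopman representation -/

section Koopman

variable {X : Type*} [MeasurableSpace X] {μ : Measure X} {T : ℝ → X → X}

/-- The correlation functions of the Koopman representation are the correlation integrals. -/
theorem inner_koopman (hmp : ∀ t, MeasurePreserving (T t) μ μ) {f g : X → ℂ} (hf : MemLp f 2 μ)
    (hg : MemLp g 2 μ) (t : ℝ) :
    inner ℂ hg.toLp (Lp.compMeasurePreservingₗᵢ ℂ (T t) (hmp t) hf.toLp) =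
      ∫ z, f (T t z) * conj (g z) ∂μ := by
  rw [L2.inner_def]
  refine integral_congr_ae ?_
  filter_upwards [hg.coeFn_toLp, Lp.coeFn_compMeasurePreserving hf.toLp (hmp t),
    (hmp t).quasiMeasurePreserving.ae hf.coeFn_toLp] with z h1 h2 h3
  rw [h1]
  change inner ℂ (g z) ((Lp.compMeasurePreserving (T t) (hmp t) hf.toLp : X → ℂ) z) = _
  rw [h2, Function.comp, h3, RCLike.inner_apply]

/-- The Koopman representation of a measure preserving flow. Strong continuity is obtained from a
total set of bounded functions that are continuous along orbits. -/
theorem exists_koopman [IsFiniteMeasure μ] (hmp : ∀ t, MeasurePreserving (T t) μ μ)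
    (h0 : ∀ᵐ z ∂μ, T 0 z = z) (hadd : ∀ s t, ∀ᵐ z ∂μ, T (s + t) z = T t (T s z))
    {D : Set (X → ℂ)} (hDmem : ∀ f ∈ D, MemLp f 2 μ)
    (hDbdd : ∀ f ∈ D, ∃ C : ℝ, ∀ᵐ z ∂μ, ‖f z‖ ≤ C)
    (hDcont : ∀ f ∈ D, ∀ᵐ z ∂μ, Continuous fun t => f (T t z))
    (hDtot : ∀ h : X → ℂ, MemLp h 2 μ → (∀ f ∈ D, ∫ z, h z * conj (f z) ∂μ = 0) → h =ᵐ[μ] 0) :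
    Dense (Submodule.span ℂ {v : Lp ℂ 2 μ | ∃ f ∈ D, v =ᵐ[μ] f} : Set (Lp ℂ 2 μ)) ∧
    ∃ V : IsometryFlow (Lp ℂ 2 μ), ∀ (f g : X → ℂ) (hf : MemLp f 2 μ) (hg : MemLp g 2 μ) (t : ℝ),
      V.corr hf.toLp hg.toLp t = ∫ z, f (T t z) * conj (g z) ∂μ := by
  set K : Submodule ℂ (Lp ℂ 2 μ) := Submodule.span ℂ {v : Lp ℂ 2 μ | ∃ f ∈ D, v =ᵐ[μ] f} with hK
  have hdense : Dense (K : Set (Lp ℂ 2 μ)) := by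
    rw [Submodule.dense_iff_topologicalClosure_eq_top, Submodule.topologicalClosure_eq_top_iff,
      Submodule.eq_bot_iff]
    intro v hv
    rw [Submodule.mem_orthogonal] at hv
    refine Lp.ext ?_
    refine (hDtot v (Lp.memLp v) fun f hf => ?_).trans (Lp.coeFn_zero ℂ 2 μ).symm
    have := hv _ (Submodule.subset_span ⟨f, hf, (hDmem f hf).coeFn_toLp⟩)
    rw [← this, L2.inner_def]
    refine integral_congr_ae ?_
    filter_upwards [(hDmem f hf).coeFn_toLp] with z h1
    rw [h1, RCLike.inner_apply]
  refine ⟨hdense, ?_⟩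
  set U : ℝ → Lp ℂ 2 μ →ₗᵢ[ℂ] Lp ℂ 2 μ := fun t => Lp.compMeasurePreservingₗᵢ ℂ (T t) (hmp t)
    with hU
  have hUcoe : ∀ t v, U t v =ᵐ[μ] v ∘ T t := fun t v =>
    Lp.coeFn_compMeasurePreserving v (hmp t)
  have hU0 : ∀ f, U 0 f = f := fun f => by
    refine Lp.ext ?_
    filter_upwards [hUcoe 0 f, h0] with z h1 h2
    rw [h1, Function.comp, h2]
  have hUadd : ∀ s t f, U (s + t) f = U s (U t f) := fun s t f => by
    refine Lp.ext ?_
    filter_upwards [hUcoe (s + t) f, hUcoe s (U t f),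
      (hmp s).quasiMeasurePreserving.ae (hUcoe t f), hadd s t] with z h1 h2 h3 h4
    rw [h1, h2, Function.comp, Function.comp, h3, h4]; rfl
  have hcont : ∀ f, Continuous fun t => U t f := by
    -- strong continuity follows from weak continuity, since the norm is preserved
    have hbase : ∀ v ∈ {v : Lp ℂ 2 μ | ∃ f ∈ D, v =ᵐ[μ] f}, Continuous fun t => U t v := by
      rintro v ⟨f, hf, hvf⟩
      obtain ⟨C, hC⟩ := hDbdd f hf
      have hv : v = (hDmem f hf).toLp := Lp.ext (hvf.trans (hDmem f hf).coeFn_toLp.symm)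
      have hc : Continuous fun t => inner ℂ v (U t v) := by
        rw [hv]
        simp_rw [hU, inner_koopman hmp (hDmem f hf) (hDmem f hf)]
        refine continuous_iff_continuousAt.2 fun t => ?_
        refine tendsto_integral_filter_of_dominated_convergence (fun _ => C * C) ?_ ?_
          (integrable_const _) ?_
        · exact Eventually.of_forall fun s =>
            (((hDmem f hf).comp_measurePreserving (hmp s)).1).mul (hDmem f hf).1.star
        · refine Eventually.of_forall fun s => ?_
          filter_upwards [hC, (hmp s).quasiMeasurePreserving.ae hC] with z h1 h2
          rw [norm_mul, RCLike.norm_conj]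
          exact mul_le_mul h2 h1 (norm_nonneg _) ((norm_nonneg _).trans h2)
        · filter_upwards [hDcont f hf] with z hz
          exact (hz.tendsto t).mul_const _
      refine continuous_iff_continuousAt.2 fun t => ?_
      rw [ContinuousAt, tendsto_iff_norm_sub_tendsto_zero]
      have hsq : ∀ s, ‖U s v - U t v‖ ^ 2 = 2 * ‖v‖ ^ 2 - 2 * (inner ℂ v (U (s - t) v)).re := by
        intro s
        rw [@norm_sub_sq ℂ, LinearIsometry.norm_map, LinearIsometry.norm_map]
        have : inner ℂ (U s v) (U t v) = conj (inner ℂ v (U (s - t) v)) := by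
          rw [inner_conj_symm]
          conv_lhs => rw [show s = t + (s - t) by ring, hUadd, LinearIsometry.inner_map_map]
        rw [this, RCLike.conj_re]
        simp only [RCLike.re_to_complex]
        ring
      have hlim : Tendsto (fun s => ‖U s v - U t v‖ ^ 2) (𝓝 t) (𝓝 0) := by
        simp_rw [hsq]
        have h1 : Continuous fun s => 2 * ‖v‖ ^ 2 - 2 * (inner ℂ v (U (s - t) v)).re := by
          have := hc.comp (continuous_sub_right t)
          fun_prop
        convert h1.tendsto t using 2
        rw [sub_self, hU0, inner_self_eq_norm_sq_to_K]
        have : (((‖v‖ : ℝ) : ℂ) ^ 2).re = ‖v‖ ^ 2 := by norm_cast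
        erw [this]
        ring
      have := (Real.continuous_sqrt.tendsto _).comp hlim
      simpa [Function.comp_def, Real.sqrt_sq (norm_nonneg _)] using this
    have hspan : ∀ v ∈ K, Continuous fun t => U t v := by
      intro v hv
      induction hv using Submodule.span_induction with
      | mem v hv => exact hbase v hv
      | zero => simpa using continuous_const
      | add x y _ _ hx hy => simp only [map_add]; exact hx.add hy
      | smul a x _ hx => simp only [map_smul]; exact hx.const_smul a
    intro v
    refine continuous_of_uniform_approx_of_continuous fun u hu => ?_
    obtain ⟨ε, hε, hεu⟩ := Metric.mem_uniformity_dist.1 hu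
    obtain ⟨w, hw, hvw⟩ := Metric.mem_closure_iff.1 (hdense v) ε hε
    refine ⟨fun t => U t w, hspan w hw, fun t => hεu ?_⟩
    rw [(U t).dist_map]
    exact hvw
  exact ⟨⟨U, hU0, hUadd, hcont⟩, fun f g hf hg t => inner_koopman hmp hf hg t⟩

/-- A criterion for absolutely continuous spectrum on `L²₀`: square integrable correlations
between a set `W` whose orthogonal complement consists of constants, and a total set `D`. -/
theorem hasACMaximalSpectralType_of_memLp [MeasurableSpace.CountablyGenerated X]
    [IsFiniteMeasure μ] (hmp : ∀ t, MeasurePreserving (T t) μ μ)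
    (h0 : ∀ᵐ z ∂μ, T 0 z = z) (hadd : ∀ s t, ∀ᵐ z ∂μ, T (s + t) z = T t (T s z))
    {W D : Set (X → ℂ)} (hDmem : ∀ f ∈ D, MemLp f 2 μ)
    (hDbdd : ∀ f ∈ D, ∃ C : ℝ, ∀ᵐ z ∂μ, ‖f z‖ ≤ C)
    (hDcont : ∀ f ∈ D, ∀ᵐ z ∂μ, Continuous fun t => f (T t z))
    (hDtot : ∀ h : X → ℂ, MemLp h 2 μ → (∀ f ∈ D, ∫ z, h z * conj (f z) ∂μ = 0) → h =ᵐ[μ] 0)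
    (hWmem : ∀ f ∈ W, MemLp f 2 μ)
    (hWtot : ∀ h : X → ℂ, MemLp h 2 μ → (∀ f ∈ W, ∫ z, h z * conj (f z) ∂μ = 0) →
      ∃ c : ℂ, h =ᵐ[μ] fun _ => c)
    (hWD : ∀ f ∈ W, ∀ g ∈ D, MemLp (fun t => ∫ z, f (T t z) * conj (g z) ∂μ) 2) :
    HasACMaximalSpectralType T μ := by
  obtain ⟨hdense, V, hV⟩ := exists_koopman hmp h0 hadd hDmem hDbdd hDcont hDtot
  set W' : Set (Lp ℂ 2 μ) := {v | ∃ f ∈ W, v =ᵐ[μ] f} with hW'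
  have hspec : ∀ (h : X → ℂ) (hh : MemLp h 2 μ) (σ : Measure ℝ),
      V.IsSpec hh.toLp σ ↔ IsSpectralMeasure T μ h σ := fun h hh σ => by
    unfold IsometryFlow.IsSpec IsSpectralMeasure
    simp_rw [hV h h hh hh]
  -- `L²₀`, the orthogonal complement of the constants
  set S : Set (Lp ℂ 2 μ) := {v | ∫ z, v z ∂μ = 0} with hS
  have hSsub : ∀ a ∈ S, ∀ b ∈ S, a - b ∈ S := by
    intro a ha b hb
    have : ∫ z, (a - b : Lp ℂ 2 μ) z ∂μ = ∫ z, (a z - b z) ∂μ :=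
      integral_congr_ae (Lp.coeFn_sub a b)
    rw [hS, mem_ofPred_eq, this, integral_sub ((Lp.memLp a).integrable one_le_two)
      ((Lp.memLp b).integrable one_le_two), ha, hb, sub_zero]
  have hmemS : ∀ (h : X → ℂ) (hh : IsL2Zero μ h), hh.1.toLp ∈ S := fun h hh => by
    rw [hS, mem_ofPred_eq, integral_congr_ae hh.1.coeFn_toLp, hh.2]
  have hclos : ∀ v ∈ S, v ∈ closure (Submodule.span ℂ W' : Set (Lp ℂ 2 μ)) := by
    intro v hv
    rw [← Submodule.topologicalClosure_coe, SetLike.mem_coe,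
      ← Submodule.orthogonal_orthogonal_eq_closure, Submodule.mem_orthogonal]
    intro w hw
    rw [Submodule.mem_orthogonal] at hw
    obtain ⟨c, hc⟩ := hWtot w (Lp.memLp w) fun f hf => by
      rw [← hw _ (Submodule.subset_span ⟨f, hf, (hWmem f hf).coeFn_toLp⟩), L2.inner_def]
      refine integral_congr_ae ?_
      filter_upwards [(hWmem f hf).coeFn_toLp] with z h1
      rw [h1, RCLike.inner_apply]
    have : inner ℂ w v = ∫ z, v z * conj c ∂μ := by
      rw [L2.inner_def]
      refine integral_congr_ae ?_
      filter_upwards [hc] with z hz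
      rw [hz, RCLike.inner_apply]
    rw [this, integral_mul_const, show ∫ z, v z ∂μ = 0 from hv, zero_mul]
  have hac : ∀ v ∈ S, ∀ σ, V.IsSpec v σ → σ ≪ volume := by
    intro v hv σ hσ
    refine IsometryFlow.IsSpec.absolutelyContinuous V hdense (W := W') ?_ (hclos v hv) hσ
    rintro f' ⟨f, hf, hff⟩ g' ⟨g, hg, hgg⟩
    have h1 : f' = (hWmem f hf).toLp := Lp.ext (hff.trans (hWmem f hf).coeFn_toLp.symm)
    have h2 : g' = (hDmem g hg).toLp := Lp.ext (hgg.trans (hDmem g hg).coeFn_toLp.symm)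
    rw [h1, h2, show V.corr (hWmem f hf).toLp (hDmem g hg).toLp = _ from
      funext (hV f g (hWmem f hf) (hDmem g hg))]
    exact hWD f hf g hg
  refine ⟨fun h hh => ?_, ?_⟩
  · obtain ⟨σ, hσ⟩ := V.exists_spectralMeasure hh.1.toLp
    exact ⟨σ, (hspec h hh.1 σ).1 hσ⟩
  · have : Fact ((2 : ENNReal) ≠ ⊤) := ⟨by simp⟩
    obtain ⟨ρ, hρf, hρ1, hρ2⟩ := V.exists_maximal S hSsub
    refine ⟨ρ, ⟨hρf, fun h σ hh hσ => hρ1 _ (hmemS h hh) σ ((hspec h hh.1 σ).2 hσ),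
      fun ρ' _ hdom => hρ2 ρ' fun v hv σ hσ => ?_⟩, hρ2 _ hac⟩
    refine hdom v σ ⟨Lp.memLp v, hv⟩ ((hspec v (Lp.memLp v) σ).1 ?_)
    rwa [Lp.toLp_coeFn]

end Koopman

/-! ### Convergents of continued fractions -/

/-- The signed error `q_n ξ - p_n` of the `n`-th convergent. -/
def cfErr (ξ : ℝ) (n : ℕ) : ℝ := (ξ.convergent n).den * ξ - (ξ.convergent n).num

theorem irrational_inv_fract {ξ : ℝ} (h : Irrational ξ) :
    Irrational (Int.fract ξ)⁻¹ ∧ 1 < (Int.fract ξ)⁻¹ ∧ 0 < Int.fract ξ := by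
  have h1 : Irrational (Int.fract ξ) := by
    rw [Int.fract]; exact h.sub_intCast _
  have h2 : 0 < Int.fract ξ := lt_of_le_of_ne (Int.fract_nonneg ξ) h1.ne_zero.symm
  exact ⟨h1.inv, (one_lt_inv₀ h2).2 (Int.fract_lt_one ξ), h2⟩

theorem convergent_pos {ξ : ℝ} (h : Irrational ξ) (h1 : 1 < ξ) (n : ℕ) :
    0 < ξ.convergent n := by
  induction n generalizing ξ with
  | zero =>
    rw [Real.convergent_zero]
    exact_mod_cast Int.floor_pos.2 h1.le
  | succ n ih =>
    obtain ⟨h2, h3, -⟩ := irrational_inv_fract h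
    rw [Real.convergent_succ]
    have : (0 : ℚ) < ⌊ξ⌋ := by exact_mod_cast Int.floor_pos.2 h1.le
    have := inv_pos.2 (ih h2 h3)
    positivity

/-- The recursion of the convergents in the direction of the Gauss map: the convergents of `ξ` are
obtained from those of `1 / {ξ}`. -/
theorem convergent_succ_num_den {ξ : ℝ} (h : Irrational ξ) (n : ℕ) :
    ((ξ.convergent (n + 1)).den : ℤ) = ((Int.fract ξ)⁻¹.convergent n).num ∧
    (ξ.convergent (n + 1)).num = ⌊ξ⌋ * ((Int.fract ξ)⁻¹.convergent n).num +
      ((Int.fract ξ)⁻¹.convergent n).den := by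
  obtain ⟨h2, h3, -⟩ := irrational_inv_fract h
  have hpos := convergent_pos h2 h3 n
  rw [Real.convergent_succ]
  set r := (Int.fract ξ)⁻¹.convergent n
  have hn : 0 < r.num := Rat.num_pos.2 hpos
  have hinv : r⁻¹ = (r.den : ℤ) / r.num := by
    conv_lhs => rw [← Rat.num_div_den r, inv_div]
    push_cast; rfl
  have heq : (⌊ξ⌋ : ℚ) + r⁻¹ = ((⌊ξ⌋ * r.num + r.den : ℤ) : ℚ) / (r.num : ℤ) := by
    rw [hinv]
    have : (r.num : ℚ) ≠ 0 := by exact_mod_cast hn.ne'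
    push_cast
    field_simp
  have hcop : Nat.Coprime (⌊ξ⌋ * r.num + r.den : ℤ).natAbs r.num.natAbs := by
    rw [← Int.isCoprime_iff_nat_coprime]
    have : IsCoprime (r.den : ℤ) r.num := by
      have := r.reduced
      rw [Int.isCoprime_iff_nat_coprime]
      simpa using this.symm
    rw [add_comm]
    exact this.add_mul_right_left _
  rw [heq]
  exact ⟨Rat.den_div_eq_of_coprime hn hcop, Rat.num_div_eq_of_coprime hn hcop⟩

theorem cfErr_zero (ξ : ℝ) : cfErr ξ 0 = Int.fract ξ := by
  unfold cfErr
  rw [Real.convergent_zero, Rat.num_intCast, Rat.den_intCast, Nat.cast_one, one_mul,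
    Int.self_sub_floor]

theorem cfErr_succ {ξ : ℝ} (h : Irrational ξ) (n : ℕ) :
    cfErr ξ (n + 1) = -(Int.fract ξ * cfErr (Int.fract ξ)⁻¹ n) := by
  obtain ⟨h1, h2⟩ := convergent_succ_num_den h n
  obtain ⟨-, -, h3⟩ := irrational_inv_fract h
  unfold cfErr
  have h1' : ((ξ.convergent (n + 1)).den : ℝ) = ((Int.fract ξ)⁻¹.convergent n).num := by
    exact_mod_cast h1
  rw [h1', h2]
  push_cast
  have h4 : Int.fract ξ * (Int.fract ξ)⁻¹ = 1 := mul_inv_cancel₀ h3.ne'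
  have := Int.floor_add_fract ξ
  linear_combination (-(((Int.fract ξ)⁻¹.convergent n).num : ℝ)) * this
    + (((Int.fract ξ)⁻¹.convergent n).den : ℝ) * h4

/-- The errors of the convergents alternate in sign. -/
theorem cfErr_sign {ξ : ℝ} (h : Irrational ξ) (n : ℕ) : cfErr ξ n = (-1) ^ n * |cfErr ξ n| := by
  induction n generalizing ξ with
  | zero => rw [cfErr_zero, abs_of_nonneg (Int.fract_nonneg ξ)]; simp
  | succ n ih =>
    obtain ⟨h2, h3, h4⟩ := irrational_inv_fract h
    rw [cfErr_succ h, abs_neg, abs_mul, abs_of_pos h4, pow_succ]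
    linear_combination (-Int.fract ξ) * ih h2

theorem abs_cfErr_succ_le {ξ : ℝ} (h : Irrational ξ) (n : ℕ) :
    |cfErr ξ (n + 1)| ≤ |cfErr ξ n| := by
  induction n generalizing ξ with
  | zero =>
    obtain ⟨h2, h3, h4⟩ := irrational_inv_fract h
    rw [cfErr_succ h, cfErr_zero, cfErr_zero, abs_neg, abs_mul, abs_of_pos h4,
      abs_of_nonneg (Int.fract_nonneg _)]
    exact mul_le_of_le_one_right h4.le (Int.fract_lt_one _).le
  | succ n ih =>
    obtain ⟨h2, h3, h4⟩ := irrational_inv_fract h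
    rw [cfErr_succ h, cfErr_succ h, abs_neg, abs_neg, abs_mul, abs_mul]
    exact mul_le_mul_of_nonneg_left (ih h2) (abs_nonneg _)

/-- The determinant identity `q_{n+1} |q_n ξ - p_n| + q_n |q_{n+1} ξ - p_{n+1}| = 1`. -/
theorem den_mul_abs_cfErr_add {ξ : ℝ} (h : Irrational ξ) (n : ℕ) :
    (ξ.convergent (n + 1)).den * |cfErr ξ n| + (ξ.convergent n).den * |cfErr ξ (n + 1)| = 1 := by
  induction n generalizing ξ with
  | zero =>
    obtain ⟨h2, h3, h4⟩ := irrational_inv_fract h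
    have h1 : ((ξ.convergent (0 + 1)).den : ℝ) = ((Int.fract ξ)⁻¹.convergent 0).num := by
      exact_mod_cast (convergent_succ_num_den h 0).1
    rw [h1, cfErr_succ h, cfErr_zero, cfErr_zero, abs_neg, abs_mul, abs_of_pos h4,
      abs_of_nonneg (Int.fract_nonneg _), Real.convergent_zero, Real.convergent_zero]
    have := Int.floor_add_fract (Int.fract ξ)⁻¹
    simp only [Rat.num_intCast, Rat.den_intCast, Nat.cast_one, one_mul]
    calc _ = Int.fract ξ * (⌊(Int.fract ξ)⁻¹⌋ + Int.fract (Int.fract ξ)⁻¹) := by ring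
      _ = 1 := by rw [this]; field_simp
  | succ n ih =>
    obtain ⟨h2, h3, h4⟩ := irrational_inv_fract h
    have h1 : ∀ m, ((ξ.convergent (m + 1)).den : ℝ) = ((Int.fract ξ)⁻¹.convergent m).num := by
      intro m
      exact_mod_cast (convergent_succ_num_den h m).1
    rw [h1, h1, cfErr_succ h, cfErr_succ h, abs_neg, abs_neg, abs_mul, abs_mul, abs_of_pos h4]
    set η := (Int.fract ξ)⁻¹ with hη
    have hη1 : Int.fract ξ * η = 1 := by rw [hη]; field_simp
    have e : ∀ m, ((η.convergent m).num : ℝ) = (η.convergent m).den * η - cfErr η m := fun m => by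
      unfold cfErr; ring
    have s1 := cfErr_sign h2 n
    have s2 := cfErr_sign h2 (n + 1)
    rw [e, e]
    have hs : cfErr η (n + 1) * |cfErr η n| + cfErr η n * |cfErr η (n + 1)| = 0 := by
      rw [s1, s2, pow_succ]
      simp only [abs_mul, abs_pow, abs_neg, abs_one, one_pow, one_mul, abs_abs]
      ring
    have := ih h2
    linear_combination (Int.fract ξ * η) * this + hη1 - Int.fract ξ * hs

theorem convergent_mono {ξ : ℝ} (h : Irrational ξ) (h0 : 0 ≤ ξ) (n : ℕ) :
    (ξ.convergent n).den ≤ (ξ.convergent (n + 1)).den ∧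
      (ξ.convergent n).num ≤ (ξ.convergent (n + 1)).num := by
  induction n generalizing ξ with
  | zero =>
    obtain ⟨h2, h3, h4⟩ := irrational_inv_fract h
    have hn := (convergent_succ_num_den h 0).2
    refine ⟨by rw [Real.convergent_zero, Rat.den_intCast]; exact Rat.den_pos _, ?_⟩
    rw [hn]
    have h5 : 1 ≤ ((Int.fract ξ)⁻¹.convergent 0).num :=
      Rat.num_pos.2 (convergent_pos h2 h3 0)
    have h6 : 0 ≤ ⌊ξ⌋ := Int.floor_nonneg.2 h0
    simp only [Real.convergent_zero, Rat.num_intCast] at h5 ⊢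
    nlinarith [Int.natCast_nonneg (Rat.den (⌊(Int.fract ξ)⁻¹⌋ : ℚ))]
  | succ n ih =>
    obtain ⟨h2, h3, h4⟩ := irrational_inv_fract h
    obtain ⟨a1, a2⟩ := convergent_succ_num_den h n
    obtain ⟨b1, b2⟩ := convergent_succ_num_den h (n + 1)
    obtain ⟨c1, c2⟩ := ih h2 (by linarith)
    have h6 : 0 ≤ ⌊ξ⌋ := Int.floor_nonneg.2 h0
    refine ⟨by zify; rw [a1, b1]; exact c2, ?_⟩
    rw [a2, b2]
    have : (((Int.fract ξ)⁻¹.convergent n).den : ℤ) ≤ ((Int.fract ξ)⁻¹.convergent (n + 1)).den := by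
      exact_mod_cast c1
    exact add_le_add (mul_le_mul_of_nonneg_left c2 h6) this

theorem cfDenom_pos (a : ℝ) (n : ℕ) : 0 < cfDenom a n := Rat.den_pos _

theorem cfDenom_mono {a : ℝ} (h : Irrational a) (h0 : 0 ≤ a) : Monotone (cfDenom a) :=
  monotone_nat_of_le_succ fun n => (convergent_mono h h0 n).1

/-- The distance from `q_n a` to `p_n` is of the order of `1 / q_{n+1}`. -/
theorem abs_cfErr_bounds {a : ℝ} (h : Irrational a) (h0 : 0 ≤ a) (n : ℕ) :
    1 / (2 * cfDenom a (n + 1)) ≤ |cfErr a n| ∧ |cfErr a n| ≤ 1 / cfDenom a (n + 1) := by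
  have h1 : ((a.convergent (n + 1)).den : ℝ) = cfDenom a (n + 1) := rfl
  have h2 : ((a.convergent n).den : ℝ) = cfDenom a n := rfl
  have key := den_mul_abs_cfErr_add h n
  rw [h1, h2] at key
  have hm : (cfDenom a n : ℝ) ≤ cfDenom a (n + 1) := by exact_mod_cast cfDenom_mono h h0 n.le_succ
  have hp : (0 : ℝ) < cfDenom a (n + 1) := by exact_mod_cast cfDenom_pos a (n + 1)
  have hp' : (0 : ℝ) < cfDenom a n := by exact_mod_cast cfDenom_pos a n
  have hd := abs_cfErr_succ_le h n
  constructor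
  · rw [div_le_iff₀ (by positivity)]
    have := mul_le_mul hm hd (abs_nonneg _) hp.le
    linarith
  · rw [le_div_iff₀ hp]
    have := mul_nonneg hp'.le (abs_nonneg (cfErr a (n + 1)))
    linarith

/-! ### Arithmetic of the frequency set -/

/-- All the denominators `q_n^{(j)}` in one sequence: the term of index `4 n + j` is
`q_n^{(j)}`. -/
def scale (α : Fin 4 → ℝ) (m : ℕ) : ℕ := cfDenom (α ⟨m % 4, Nat.mod_lt _ (by norm_num)⟩) (m / 4)

theorem scale_eq (α : Fin 4 → ℝ) (n : ℕ) (j : Fin 4) : scale α (4 * n + j) = cfDenom (α j) n := by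
  unfold scale
  have h1 : (4 * n + (j : ℕ)) / 4 = n := by omega
  have h2 : (⟨(4 * n + (j : ℕ)) % 4, Nat.mod_lt _ (by norm_num)⟩ : Fin 4) = j := by
    apply Fin.ext
    simp only
    omega
  rw [h1, h2]

theorem exists_scale_eq (α : Fin 4 → ℝ) (m : ℕ) :
    ∃ j : Fin 4, (j : ℕ) = m % 4 ∧ scale α m = cfDenom (α j) (m / 4) ∧
      scale α (m + 4) = cfDenom (α j) (m / 4 + 1) := by
  refine ⟨⟨m % 4, Nat.mod_lt _ (by norm_num)⟩, rfl, rfl, ?_⟩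
  have := scale_eq α (m / 4 + 1) ⟨m % 4, Nat.mod_lt _ (by norm_num)⟩
  rw [← this]
  congr 1
  simp only
  omega

section FreqSet

variable {α : Fin 4 → ℝ}

/-- The conditions defining `freqSet` say that `scale` grows like an iterated exponential. -/
theorem exp_le_scale_succ (hα : α ∈ freqSet) {m : ℕ} (hm : 4 ≤ m) :
    Real.exp ((m / 4 : ℕ) * scale α m) ≤ scale α (m + 1) := by
  obtain ⟨n, j, hn, rfl⟩ : ∃ (n : ℕ) (j : Fin 4), 1 ≤ n ∧ m = 4 * n + j :=
    ⟨m / 4, ⟨m % 4, Nat.mod_lt _ (by norm_num)⟩, by omega, by simp only; omega⟩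
  obtain ⟨h0, h1, h2, h3⟩ := hα.2.2 n hn
  have hd : (4 * n + (j : ℕ)) / 4 = n := by omega
  rw [hd, scale_eq]
  fin_cases j
  · have := scale_eq α n 1
    simp only [Fin.zero_eta, Fin.coe_ofNat_eq_mod, Fin.isValue] at this ⊢
    rw [show 4 * n + 0 % 4 + 1 = 4 * n + 1 % 4 from rfl, this]; exact h0
  · have := scale_eq α n 2
    simp only [Fin.mk_one, Fin.coe_ofNat_eq_mod, Fin.isValue] at this ⊢
    rw [show 4 * n + 1 % 4 + 1 = 4 * n + 2 % 4 from rfl, this]; exact h1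
  · have := scale_eq α n 3
    simp only [Fin.reduceFinMk, Fin.coe_ofNat_eq_mod, Fin.isValue] at this ⊢
    rw [show 4 * n + 2 % 4 + 1 = 4 * n + 3 % 4 from rfl, this]; exact h2
  · have := scale_eq α (n + 1) 0
    simp only [Fin.reduceFinMk, Fin.coe_ofNat_eq_mod, Fin.isValue] at this ⊢
    rw [show 4 * n + 3 % 4 + 1 = 4 * (n + 1) + 0 % 4 from rfl, this]; exact h3

theorem one_le_scale (α : Fin 4 → ℝ) (m : ℕ) : 1 ≤ scale α m := cfDenom_pos _ _

theorem scale_lt_succ (hα : α ∈ freqSet) {m : ℕ} (hm : 4 ≤ m) : scale α m < scale α (m + 1) := by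
  have h := exp_le_scale_succ hα hm
  have h1 : (1 : ℝ) ≤ (m / 4 : ℕ) := by
    have : 1 ≤ m / 4 := by omega
    exact_mod_cast this
  have h2 : (scale α m : ℝ) ≤ (m / 4 : ℕ) * scale α m :=
    le_mul_of_one_le_left (Nat.cast_nonneg _) h1
  have h3 := Real.add_one_le_exp ((m / 4 : ℕ) * (scale α m : ℝ))
  have : (scale α m : ℝ) < scale α (m + 1) := by linarith
  exact_mod_cast this

theorem scale_mono (hα : α ∈ freqSet) {m m' : ℕ} (hm : 4 ≤ m) (h : m ≤ m') :
    scale α m ≤ scale α m' := by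
  induction m', h using Nat.le_induction with
  | base => exact le_rfl
  | succ k hk ih => exact ih.trans (scale_lt_succ hα (hm.trans hk)).le

theorem le_scale (hα : α ∈ freqSet) (m : ℕ) : m ≤ scale α m + 3 := by
  induction m with
  | zero => omega
  | succ k ih =>
    by_cases hk : 4 ≤ k
    · have := scale_lt_succ hα hk
      omega
    · have := one_le_scale α (k + 1)
      omega

theorem le_cfDenom (hα : α ∈ freqSet) (j : Fin 4) (n : ℕ) : n ≤ cfDenom (α j) n := by
  rcases Nat.lt_or_ge n 2 with h | h
  · have := cfDenom_pos (α j) n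
    omega
  · have := le_scale hα (4 * n + j)
    rw [scale_eq] at this
    omega

/-- The coordinates of `α ∈ Y` and `1` are rationally independent: `α_j` is much better
approximated by rationals whose denominator is a product of denominators of the other coordinates
than the size of these denominators allows. -/
theorem sum_mul_ne_int (hα : α ∈ freqSet) {k : Fin 4 → ℤ} (hk : k ≠ 0) (p : ℤ) :
    ∑ j, k j * α j ≠ p := by
  intro hp
  obtain ⟨j, hj⟩ := Function.ne_iff.1 hk
  simp only [Pi.zero_apply] at hj
  set K : ℝ := ∑ i, |(k i : ℝ)| with hK
  have hKi : ∀ i, |(k i : ℝ)| ≤ K := fun i =>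
    Finset.single_le_sum (f := fun i => |(k i : ℝ)|) (fun i _ => abs_nonneg _) (Finset.mem_univ i)
  have hK1 : 1 ≤ K := by
    refine le_trans ?_ (hKi j)
    exact_mod_cast Int.one_le_abs hj
  obtain ⟨n, hn⟩ := exists_nat_ge (6 * K + 5)
  have hn5 : 5 ≤ n := by
    have : (5 : ℝ) ≤ n := by linarith
    exact_mod_cast this
  set M : ℕ := 4 * n + j with hM
  set q : ℝ := ((scale α M : ℕ) : ℝ) with hq
  set x : ℝ := ((scale α (M - 1) : ℕ) : ℝ) with hx
  have hx1 : 1 ≤ x := by rw [hx]; exact_mod_cast one_le_scale α (M - 1)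
  have hq1 : 1 ≤ q := by rw [hq]; exact_mod_cast one_le_scale α M
  -- the product of the other denominators is much smaller than `q`
  have hxq : K * x ^ 3 < q := by
    have h1 := exp_le_scale_succ hα (m := M - 1) (by omega)
    rw [show M - 1 + 1 = M by omega, ← hq, ← hx] at h1
    refine lt_of_lt_of_le ?_ h1
    have h2 : ((n - 1 : ℝ)) ≤ ((M - 1) / 4 : ℕ) := by
      have : n - 1 ≤ (M - 1) / 4 := by omega
      have h3 : ((n - 1 : ℕ) : ℝ) ≤ ((M - 1) / 4 : ℕ) := by exact_mod_cast this
      rwa [Nat.cast_sub (by omega), Nat.cast_one] at h3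
    have hn1 : (5 : ℝ) ≤ n := by exact_mod_cast hn5
    calc K * x ^ 3 < (6 * K + 1) * (x ^ 3 / 6) := by
          have : 0 < x ^ 3 := by positivity
          nlinarith
      _ ≤ Real.exp (6 * K) * Real.exp x := by
          have h3 := Real.add_one_le_exp (6 * K)
          have h4 := Real.pow_div_factorial_le_exp (x := x) (by linarith) 3
          have h5 : x ^ 3 / 6 = x ^ 3 / (Nat.factorial 3 : ℕ) := by norm_num [Nat.factorial]
          rw [h5]
          exact mul_le_mul h3 h4 (by positivity) (Real.exp_pos _).le
      _ = Real.exp (6 * K + x) := by rw [Real.exp_add]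
      _ ≤ _ := by
          refine Real.exp_le_exp.2 ?_
          have : (6 * K + 1) * x ≤ ((M - 1) / 4 : ℕ) * x :=
            mul_le_mul_of_nonneg_right (by linarith) (by linarith)
          nlinarith
  have hsmall : (q + q ^ 2) * Real.exp (-(n * q)) < 1 := by
    rw [Real.exp_neg, ← div_eq_mul_inv, div_lt_one (Real.exp_pos _)]
    have h1 := Real.add_one_le_exp q
    have hn1 : (5 : ℝ) ≤ n := by exact_mod_cast hn5
    calc q + q ^ 2 = q * (q + 1) := by ring
      _ < (q + 1) * (q + 1) := by nlinarith
      _ ≤ Real.exp q * Real.exp q := mul_le_mul h1 h1 (by linarith) (Real.exp_pos _).le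
      _ = Real.exp (2 * q) := by rw [← Real.exp_add]; ring_nf
      _ ≤ _ := Real.exp_le_exp.2 (by nlinarith)
  have herrj : ∀ m, M ≤ m + 3 → 1 ≤ m / 4 → ∀ i : Fin 4, (i : ℕ) = m % 4 →
      |cfErr (α i) (m / 4)| ≤ Real.exp (-(n * q)) := by
    intro m hm hm1 i hi
    refine (abs_cfErr_bounds (hα.2.1 i) (hα.1 i).1 _).2.trans ?_
    have h1 := scale_eq α (m / 4 + 1) i
    rw [← h1, hi, Real.exp_neg, ← one_div]
    refine one_div_le_one_div_of_le (Real.exp_pos _) ?_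
    have h2 := exp_le_scale_succ hα (m := M) (by omega)
    rw [show M / 4 = n by omega, ← hq] at h2
    refine h2.trans ?_
    exact_mod_cast scale_mono hα (by omega) (by omega)
  -- rational approximations `P i / r i` of the other coordinates
  have happ : ∀ i : Fin 4, ∃ (r P : ℤ), 0 < r ∧ (i ≠ j → (r : ℝ) ≤ x) ∧ (i = j → r = 1) ∧
      (i ≠ j → |r * α i - P| ≤ Real.exp (-(n * q))) := by
    intro i
    by_cases hij : i = j
    · exact ⟨1, 0, one_pos, fun h => absurd hij h, fun _ => rfl, fun h => absurd hij h⟩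
    have hij' : (i : ℕ) ≠ j := fun h => hij (Fin.ext h)
    obtain ⟨N, hN1, hN2, hN3⟩ : ∃ N, 1 ≤ N ∧ 4 * N + i ≤ M - 1 ∧ M ≤ 4 * N + i + 3 := by
      by_cases hlt : (i : ℕ) < j
      · exact ⟨n, by omega, by omega, by omega⟩
      · exact ⟨n - 1, by omega, by omega, by omega⟩
    refine ⟨cfDenom (α i) N, ((α i).convergent N).num, by exact_mod_cast cfDenom_pos _ _,
      fun _ => ?_, fun h => absurd h hij, fun _ => ?_⟩
    · rw [← scale_eq, hx]
      exact_mod_cast scale_mono hα (by omega) hN2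
    · have := herrj (4 * N + i) hN3 (by omega) i (by omega)
      rw [show (4 * N + (i : ℕ)) / 4 = N by omega] at this
      exact_mod_cast this
  choose r P hr0 hrx hrj hrP using happ
  -- multiply the relation by the product `R` of the denominators
  set R : ℤ := ∏ i, r i with hR
  have hRpos : 0 < R := Finset.prod_pos fun i _ => hr0 i
  have hRx : (R : ℝ) ≤ x ^ 3 := by
    have h1 : R = ∏ i ∈ Finset.univ.erase j, r i := by
      rw [hR, ← Finset.mul_prod_erase _ _ (Finset.mem_univ j), hrj j rfl, one_mul]
    rw [h1]
    push_cast
    calc ∏ i ∈ Finset.univ.erase j, (r i : ℝ) ≤ ∏ i ∈ Finset.univ.erase j, x := by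
          refine Finset.prod_le_prod (fun i _ => by exact_mod_cast (hr0 i).le) fun i hi => ?_
          exact hrx i (Finset.ne_of_mem_erase hi)
      _ = x ^ 3 := by
          rw [Finset.prod_const, Finset.card_erase_of_mem (Finset.mem_univ j)]; simp
  have hdvd : ∀ i, ∃ c : ℤ, 0 < c ∧ R = r i * c ∧ c ≤ R := by
    intro i
    obtain ⟨c, hc⟩ := Finset.dvd_prod_of_mem r (Finset.mem_univ i)
    rw [← hR] at hc
    have hc0 : 0 < c := by
      by_contra h
      have := mul_nonpos_of_nonneg_of_nonpos (hr0 i).le (not_lt.1 h)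
      omega
    exact ⟨c, hc0, hc, by rw [hc]; exact le_mul_of_one_le_left hc0.le (hr0 i)⟩
  choose c hc0 hcR hcle using hdvd
  set A : ℤ := R * p - ∑ i ∈ Finset.univ.erase j, k i * (c i * P i) with hA
  have hAerr : |(R : ℝ) * k j * α j - A| ≤ K * R * Real.exp (-(n * q)) := by
    have h1 : (R : ℝ) * k j * α j - A =
        -∑ i ∈ Finset.univ.erase j, (k i : ℝ) * (c i * (r i * α i - P i)) := by
      have h2 : (p : ℝ) = k j * α j + ∑ i ∈ Finset.univ.erase j, (k i : ℝ) * α i := by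
        rw [← hp, ← Finset.add_sum_erase _ _ (Finset.mem_univ j)]
      rw [hA]
      push_cast
      rw [h2, mul_add, Finset.mul_sum, ← Finset.sum_neg_distrib]
      have h3 : ∀ i, (R : ℝ) = r i * c i := fun i => by exact_mod_cast hcR i
      have h4 : ∑ i ∈ Finset.univ.erase j, (R : ℝ) * (k i * α i) =
          ∑ i ∈ Finset.univ.erase j, (r i * c i : ℝ) * (k i * α i) :=
        Finset.sum_congr rfl fun i _ => by rw [h3 i]
      rw [h4]
      have h5 : ∑ i ∈ Finset.univ.erase j, -((k i : ℝ) * (c i * (r i * α i - P i))) =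
          ∑ i ∈ Finset.univ.erase j, (k i : ℝ) * (c i * P i) -
          ∑ i ∈ Finset.univ.erase j, (r i * c i : ℝ) * (k i * α i) := by
        rw [← Finset.sum_sub_distrib]
        exact Finset.sum_congr rfl fun i _ => by ring
      rw [h5]
      ring
    rw [h1, abs_neg]
    refine (Finset.abs_sum_le_sum_abs _ _).trans ?_
    rw [hK, mul_assoc, Finset.sum_mul]
    refine le_trans (Finset.sum_le_sum fun i hi => ?_)
      (Finset.sum_le_sum_of_subset_of_nonneg (Finset.erase_subset j _) fun i _ _ => by positivity)
    rw [abs_mul, abs_mul]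
    refine mul_le_mul_of_nonneg_left ?_ (abs_nonneg _)
    refine mul_le_mul ?_ (hrP i (Finset.ne_of_mem_erase hi)) (abs_nonneg _)
      (by exact_mod_cast hRpos.le)
    rw [abs_of_pos (by exact_mod_cast hc0 i)]
    exact_mod_cast hcle i
  -- compare with the convergent of `α j`
  have hqM : (q : ℝ) = ((α j).convergent n).den := by
    rw [hq, hM, scale_eq]; rfl
  set pj : ℤ := ((α j).convergent n).num with hpj
  have hej : |q * α j - pj| ≤ Real.exp (-(n * q)) := by
    have := herrj M (by omega) (by omega) j (by omega)
    rw [show M / 4 = n by omega] at this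
    unfold cfErr at this
    rw [← hqM] at this
    exact this
  have hne : R * k j * pj - A * ((α j).convergent n).den ≠ 0 := by
    intro h0
    have hd : (((α j).convergent n).den : ℤ) ∣ R * k j * pj := ⟨A, by linarith⟩
    have hcop : IsCoprime (((α j).convergent n).den : ℤ) pj := by
      rw [Int.isCoprime_iff_nat_coprime]
      simpa using ((α j).convergent n).reduced.symm
    have hd2 := hcop.dvd_of_dvd_mul_right hd
    have hle := Int.le_of_dvd (abs_pos.2 (mul_ne_zero hRpos.ne' hj)) ((dvd_abs _ _).2 hd2)
    have hle' : q ≤ |(R * k j : ℝ)| := by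
      rw [hqM]; exact_mod_cast hle
    rw [abs_mul, abs_of_pos (by exact_mod_cast hRpos : (0 : ℝ) < R)] at hle'
    have : (R : ℝ) * |(k j : ℝ)| ≤ x ^ 3 * K :=
      mul_le_mul hRx (hKi j) (abs_nonneg _) (by positivity)
    linarith
  have h1 : (1 : ℝ) ≤ |(R : ℝ) * k j * pj - A * q| := by
    rw [hqM]
    exact_mod_cast Int.one_le_abs hne
  have h2 : (R : ℝ) * k j * pj - A * q =
      q * (R * k j * α j - A) - R * k j * (q * α j - pj) := by ring
  have hRK : (R : ℝ) * K ≤ q := by nlinarith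
  have h3 : |(R : ℝ) * k j * pj - A * q| ≤ (q + q ^ 2) * Real.exp (-(n * q)) := by
    rw [h2]
    refine (abs_sub _ _).trans ?_
    rw [abs_mul, abs_mul (_ * _) (_ - _), abs_mul, abs_of_pos (by linarith : 0 < q),
      abs_of_pos (by exact_mod_cast hRpos : (0 : ℝ) < R)]
    have e0 := Real.exp_pos (-(n * q))
    have h4 : q * |(R : ℝ) * k j * α j - A| ≤ q * (q * Real.exp (-(n * q))) := by
      refine mul_le_mul_of_nonneg_left (hAerr.trans ?_) (by linarith)
      refine mul_le_mul_of_nonneg_right ?_ e0.le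
      linarith
    have h5 : (R : ℝ) * |(k j : ℝ)| * |q * α j - pj| ≤ q * Real.exp (-(n * q)) := by
      refine mul_le_mul ?_ hej (abs_nonneg _) (by linarith)
      refine le_trans ?_ hRK
      exact mul_le_mul_of_nonneg_left (hKi j) (by exact_mod_cast hRpos.le)
    nlinarith
  linarith

/-- At every large time `t`, at least two coordinates are at a scale `n` with
`exp (24 q_n) ≤ t` and `K t² ≤ q_{n+1}`: the coordinate of the last term of the sequence `scale`
satisfying the first condition, and the coordinate of the term before it. The denominators following
these two in their own coordinates come at least two terms after the last one, and are larger than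
`t²` by a double exponential. -/
theorem exists_two_directions (hα : α ∈ freqSet) (A : ℕ) (K : ℝ) :
    ∃ t₀ : ℝ, ∀ t, t₀ ≤ t → ∃ a b : Fin 4, a ≠ b ∧ ∃ na nb : ℕ, A ≤ na ∧ A ≤ nb ∧
      Real.exp (24 * cfDenom (α a) na) ≤ t ∧ K * t ^ 2 ≤ cfDenom (α a) (na + 1) ∧
      Real.exp (24 * cfDenom (α b) nb) ≤ t ∧ K * t ^ 2 ≤ cfDenom (α b) (nb + 1) := by
  obtain ⟨B, hB⟩ := exists_nat_ge K
  set m₀ : ℕ := 4 * A + B + 400 with hm₀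
  refine ⟨Real.exp (24 * scale α m₀), fun t ht => ?_⟩
  have ht0 : 0 < t := (Real.exp_pos _).trans_le ht
  obtain ⟨m, hm, hmax⟩ : ∃ m, (m₀ ≤ m ∧ Real.exp (24 * scale α m) ≤ t) ∧
      t < Real.exp (24 * scale α (m + 1)) := by
    by_contra! hcon
    have hall : ∀ m, m₀ ≤ m → Real.exp (24 * scale α m) ≤ t := by
      intro m hm
      induction m, hm using Nat.le_induction with
      | base => exact ht
      | succ k hk ih => exact hcon k ⟨hk, ih⟩
    obtain ⟨N, hN⟩ := exists_nat_gt t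
    have h1 := hall (m₀ + N + 3) (by omega)
    have h2 : (N : ℝ) ≤ scale α (m₀ + N + 3) := by
      have := le_scale hα (m₀ + N + 3)
      exact_mod_cast (by omega : N ≤ scale α (m₀ + N + 3))
    have h3 := Real.add_one_le_exp (24 * (scale α (m₀ + N + 3) : ℝ))
    linarith [Nat.cast_nonneg (α := ℝ) N]
  obtain ⟨hm0, hmt⟩ := hm
  obtain ⟨a, ha1, ha2, ha3⟩ := exists_scale_eq α m
  obtain ⟨b, hb1, hb2, hb3⟩ := exists_scale_eq α (m - 1)
  have hbig : K * t ^ 2 ≤ scale α (m + 2) := by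
    refine le_trans ?_ (exp_le_scale_succ hα (m := m + 1) (by omega))
    have h49 : (49 : ℝ) ≤ ((m + 1) / 4 : ℕ) := by
      have : 49 ≤ (m + 1) / 4 := by omega
      exact_mod_cast this
    set x : ℝ := ((scale α (m + 1) : ℕ) : ℝ) with hx
    have hx0 : 0 ≤ x := Nat.cast_nonneg _
    have hBx : K ≤ Real.exp x := by
      have h1 := Real.add_one_le_exp x
      have h2 : (B : ℝ) ≤ x := by
        have := le_scale hα (m + 1)
        rw [hx]
        exact_mod_cast (by omega : B ≤ scale α (m + 1))
      linarith
    calc K * t ^ 2 ≤ Real.exp x * (Real.exp (24 * x)) ^ 2 := by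
          refine mul_le_mul hBx (pow_le_pow_left₀ ht0.le hmax.le 2) (by positivity)
            (Real.exp_pos _).le
      _ = Real.exp (49 * x) := by
          rw [← Real.exp_nat_mul, ← Real.exp_add]; congr 1; push_cast; ring
      _ ≤ _ := Real.exp_le_exp.2 (mul_le_mul_of_nonneg_right h49 hx0)
  refine ⟨a, b, ?_, m / 4, (m - 1) / 4, by omega, by omega, ?_, ?_, ?_, ?_⟩
  · intro hab
    rw [hab] at ha1
    omega
  · rw [← ha2]; exact hmt
  · rw [← ha3]
    refine hbig.trans ?_
    exact_mod_cast scale_mono hα (by omega) (by omega)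
  · rw [← hb2]
    refine le_trans (Real.exp_le_exp.2 ?_) hmt
    have : (scale α (m - 1) : ℝ) ≤ scale α m := by
      exact_mod_cast scale_mono hα (by omega) (by omega)
    linarith
  · rw [← hb3]
    refine hbig.trans ?_
    exact_mod_cast scale_mono hα (by omega) (by omega)

end FreqSet

/-! ### The trigonometric series defining the ceiling -/

/-- The function `y ↦ cos (2π q y)` on the circle. -/
def cosMode (q : ℕ) (y : UnitAddCircle) : ℝ := (fourier (q : ℤ) y : ℂ).re

/-- The function `y ↦ sin (2π q y)` on the circle. -/
def sinMode (q : ℕ) (y : UnitAddCircle) : ℝ := (fourier (q : ℤ) y : ℂ).im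

theorem cosMode_coe (q : ℕ) (y : ℝ) : cosMode q (y : UnitAddCircle) = Real.cos (2 * Real.pi * q * y) := by
  unfold cosMode
  rw [fourier_coe_apply]
  have : (2 * Real.pi * Complex.I * ((q : ℤ) : ℂ) * y / ((1 : ℝ) : ℂ)) =
      ((2 * Real.pi * q * y : ℝ) : ℂ) * Complex.I := by push_cast; ring
  rw [this, Complex.exp_ofReal_mul_I_re]

theorem sinMode_coe (q : ℕ) (y : ℝ) : sinMode q (y : UnitAddCircle) = Real.sin (2 * Real.pi * q * y) := by
  unfold sinMode
  rw [fourier_coe_apply]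
  have : (2 * Real.pi * Complex.I * ((q : ℤ) : ℂ) * y / ((1 : ℝ) : ℂ)) =
      ((2 * Real.pi * q * y : ℝ) : ℂ) * Complex.I := by push_cast; ring
  rw [this, Complex.exp_ofReal_mul_I_im]

theorem continuous_cosMode (q : ℕ) : Continuous (cosMode q) :=
  Complex.continuous_re.comp (fourier (q : ℤ)).continuous

theorem continuous_sinMode (q : ℕ) : Continuous (sinMode q) :=
  Complex.continuous_im.comp (fourier (q : ℤ)).continuous

theorem abs_cosMode_le (q : ℕ) (y : UnitAddCircle) : |cosMode q y| ≤ 1 := by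
  induction y using QuotientAddGroup.induction_on with
  | H y => exact (cosMode_coe q y) ▸ Real.abs_cos_le_one _

theorem abs_sinMode_le (q : ℕ) (y : UnitAddCircle) : |sinMode q y| ≤ 1 := by
  induction y using QuotientAddGroup.induction_on with
  | H y => exact (sinMode_coe q y) ▸ Real.abs_sin_le_one _

theorem cosMode_neg (q : ℕ) (y : UnitAddCircle) : cosMode q (-y) = cosMode q y := by
  induction y using QuotientAddGroup.induction_on with
  | H y =>
    change cosMode q (-(y : UnitAddCircle)) = cosMode q (y : UnitAddCircle)
    rw [← AddCircle.coe_neg, cosMode_coe, cosMode_coe, mul_neg, Real.cos_neg]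

theorem hasDerivAt_cosMode (q : ℕ) (y : ℝ) :
    HasDerivAt (fun h : ℝ => cosMode q (h : UnitAddCircle))
      (-(2 * Real.pi * q) * sinMode q (y : UnitAddCircle)) y := by
  simp_rw [cosMode_coe, sinMode_coe]
  have := ((hasDerivAt_id y).const_mul (2 * Real.pi * q)).cos
  simp only [id, mul_one] at this
  exact this.congr_deriv (by ring)

theorem hasDerivAt_sinMode (q : ℕ) (y : ℝ) :
    HasDerivAt (fun h : ℝ => sinMode q (h : UnitAddCircle))
      ((2 * Real.pi * q) * cosMode q (y : UnitAddCircle)) y := by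
  simp_rw [cosMode_coe, sinMode_coe]
  have := ((hasDerivAt_id y).const_mul (2 * Real.pi * q)).sin
  simp only [id, mul_one] at this
  exact this.congr_deriv (by ring)

section Series

variable {q : ℕ → ℕ}

/-- If `q` grows at least linearly then `∑ q ^ m e ^ (-q)` converges. -/
theorem summable_pow_div_exp (hq : ∀ k, k ≤ q k) (m : ℕ) :
    Summable fun k => (q k : ℝ) ^ m / Real.exp (q k) := by
  have hs : Summable fun k : ℕ => ((m.factorial : ℝ) * 2 ^ m) * Real.exp (-(1 / 2)) ^ k := by
    refine Summable.mul_left _ (summable_geometric_of_lt_one (Real.exp_pos _).le ?_)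
    rw [Real.exp_lt_one_iff]; norm_num
  refine Summable.of_nonneg_of_le (fun k => by positivity) (fun k => ?_) hs
  have h1 := Real.pow_div_factorial_le_exp ((q k : ℝ) / 2) (by positivity) m
  have h2 : (q k : ℝ) ^ m ≤ (m.factorial * 2 ^ m) * Real.exp ((q k : ℝ) / 2) := by
    rw [div_pow, div_div, div_le_iff₀ (by positivity)] at h1
    linarith
  rw [div_le_iff₀ (Real.exp_pos _), ← Real.exp_nat_mul, mul_assoc, ← Real.exp_add]
  refine h2.trans ?_
  have : (k : ℝ) ≤ q k := by exact_mod_cast hq k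
  gcongr
  linarith

/-- The trigonometric series `∑ cos (2π q_k y) / e ^ {q_k}` on the circle. -/
def modeSum (q : ℕ → ℕ) (y : UnitAddCircle) : ℝ := ∑' k, cosMode (q k) y / Real.exp (q k)

/-- The derivative of `modeSum`. -/
def modeSumDeriv (q : ℕ → ℕ) (y : UnitAddCircle) : ℝ :=
  ∑' k, -(2 * Real.pi * q k) * sinMode (q k) y / Real.exp (q k)

theorem norm_modeSumDeriv_term_le (q : ℕ → ℕ) (k : ℕ) (y : UnitAddCircle) :
    ‖-(2 * Real.pi * q k) * sinMode (q k) y / Real.exp (q k)‖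
      ≤ 2 * Real.pi * ((q k : ℝ) ^ 1 / Real.exp (q k)) := by
  rw [norm_div, norm_mul, norm_neg, Real.norm_of_nonneg (by positivity : 0 ≤ 2 * Real.pi * (q k : ℝ)),
    Real.norm_of_nonneg (Real.exp_pos _).le, pow_one, ← mul_div_assoc, Real.norm_eq_abs]
  exact div_le_div_of_nonneg_right
    (mul_le_of_le_one_right (by positivity) (abs_sinMode_le _ _)) (Real.exp_pos _).le

theorem continuous_modeSum (hq : ∀ k, k ≤ q k) : Continuous (modeSum q) := by
  refine continuous_tsum (fun _ => (continuous_cosMode _).div_const _)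
    (summable_pow_div_exp hq 0) fun k _ => ?_
  rw [norm_div, Real.norm_of_nonneg (Real.exp_pos _).le, pow_zero]
  gcongr
  exact abs_cosMode_le _ _

theorem continuous_modeSumDeriv (hq : ∀ k, k ≤ q k) : Continuous (modeSumDeriv q) :=
  continuous_tsum (fun _ => ((continuous_sinMode _).const_mul _).div_const _)
    ((summable_pow_div_exp hq 1).mul_left _) fun k => norm_modeSumDeriv_term_le q k

theorem modeSum_neg (q : ℕ → ℕ) (y : UnitAddCircle) : modeSum q (-y) = modeSum q y := by
  simp_rw [modeSum, cosMode_neg]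

theorem hasDerivAt_modeSum (hq : ∀ k, k ≤ q k) (y : ℝ) :
    HasDerivAt (fun h : ℝ => modeSum q (h : UnitAddCircle)) (modeSumDeriv q (y : UnitAddCircle)) y := by
  refine hasDerivAt_tsum (u := fun k => 2 * Real.pi * ((q k : ℝ) ^ 1 / Real.exp (q k)))
    (g := fun k (h : ℝ) => cosMode (q k) (h : UnitAddCircle) / Real.exp (q k))
    (g' := fun k (h : ℝ) => -(2 * Real.pi * q k) * sinMode (q k) (h : UnitAddCircle) / Real.exp (q k))
    (y₀ := 0) ((summable_pow_div_exp hq 1).mul_left _)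
    (fun k h => (hasDerivAt_cosMode _ _).div_const _)
    (fun k _ => norm_modeSumDeriv_term_le q k _) ?_ y
  refine Summable.of_norm_bounded (summable_pow_div_exp hq 0) fun k => ?_
  rw [norm_div, Real.norm_of_nonneg (Real.exp_pos _).le, pow_zero]
  gcongr
  exact abs_cosMode_le _ _

theorem contDiff_modeSum (hq : ∀ k, k ≤ q k) :
    ContDiff ℝ ∞ (fun h : ℝ => modeSum q (h : UnitAddCircle)) := by
  have hterm (k : ℕ) : (fun h : ℝ => cosMode (q k) (h : UnitAddCircle) / Real.exp (q k)) =
      fun h : ℝ => (Real.exp (q k))⁻¹ * Real.cos (2 * Real.pi * q k * h) := by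
    ext h; rw [cosMode_coe, div_eq_inv_mul]
  refine contDiff_tsum (f := fun k (h : ℝ) => cosMode (q k) (h : UnitAddCircle) / Real.exp (q k))
    (v := fun m k => (2 * Real.pi) ^ m * ((q k : ℝ) ^ m / Real.exp (q k)))
    (fun k => ?_) (fun m _ => (summable_pow_div_exp hq m).mul_left _) fun m k h _ => ?_
  · rw [hterm]
    exact contDiff_const.mul (Real.contDiff_cos.comp (contDiff_const.mul contDiff_id))
  · rw [hterm, norm_iteratedFDeriv_eq_norm_iteratedDeriv, iteratedDeriv_const_mul_field,
      iteratedDeriv_comp_const_mul (f := Real.cos) Real.contDiff_cos]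
    simp only [norm_mul, norm_inv, Real.norm_eq_abs, Real.abs_exp, abs_pow]
    rw [abs_of_nonneg (by positivity : 0 ≤ (2 * Real.pi)  * (q k : ℝ)), mul_pow]
    rw [div_eq_inv_mul]
    calc _ ≤ (Real.exp (q k))⁻¹ * ((2 * Real.pi) ^ m * (q k : ℝ) ^ m * 1) := by
          gcongr
          exact Real.abs_iteratedDeriv_cos_le_one _ _
      _ = _ := by ring

end Series

/-- The Birkhoff sums of `sin (2π q y)` over the rotation by `a` are bounded uniformly in their
length: they are imaginary parts of geometric sums of ratio `e(q a)`. -/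
theorem abs_sum_sinMode_le (q N : ℕ) (a y : UnitAddCircle) (ha : (fourier (q : ℤ) a : ℂ) ≠ 1) :
    |∑ l ∈ Finset.range N, sinMode q (y + l • a)| ≤ 2 / ‖(fourier (q : ℤ) a : ℂ) - 1‖ := by
  have h1 (l : ℕ) : (fourier (q : ℤ) (y + l • a) : ℂ) =
      fourier (q : ℤ) y * (fourier (q : ℤ) a : ℂ) ^ l := by
    simp only [fourier_apply, smul_add, AddCircle.toCircle_add, Circle.coe_mul]
    rw [smul_comm, AddCircle.toCircle_nsmul, Circle.coe_pow]
  have h2 : ∑ l ∈ Finset.range N, sinMode q (y + l • a) =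
      (fourier (q : ℤ) y * (((fourier (q : ℤ) a : ℂ) ^ N - 1) / ((fourier (q : ℤ) a : ℂ) - 1))).im := by
    rw [← geom_sum_eq ha, Finset.mul_sum, Complex.im_sum]
    simp_rw [← h1]; rfl
  rw [h2]
  refine (Complex.abs_im_le_norm _).trans ?_
  have hn (z : UnitAddCircle) : ‖(fourier (q : ℤ) z : ℂ)‖ = 1 := by
    rw [fourier_apply]; exact Circle.norm_coe _
  rw [norm_mul, norm_div, hn, one_mul]
  gcongr
  refine (norm_sub_le _ _).trans ?_
  rw [norm_pow, hn]; norm_num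

theorem fourier_sub_one_norm (q : ℕ) (a : ℝ) :
    ‖(fourier (q : ℤ) (a : UnitAddCircle) : ℂ) - 1‖ = 2 * |Real.sin (Real.pi * (q * a))| := by
  rw [fourier_coe_apply]
  have : (2 * Real.pi * Complex.I * ((q : ℤ) : ℂ) * a / ((1 : ℝ) : ℂ)) =
      Complex.I * ((2 * Real.pi * (q * a) : ℝ) : ℂ) := by push_cast; ring
  rw [this, Complex.norm_exp_I_mul_ofReal_sub_one, norm_mul, Real.norm_eq_abs, Real.norm_eq_abs]
  rw [show 2 * Real.pi * (q * a) / 2 = Real.pi * (q * a) by ring, abs_two]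

/-! ### Birkhoff sums of the derivative of the ceiling -/

theorem cfErr_eq (a : ℝ) (n : ℕ) :
    (cfDenom a n : ℝ) * a = cfErr a n + ((a.convergent n).num : ℤ) := by
  unfold cfErr cfDenom; ring

theorem abs_sinMode_shift_sub_le (a : ℝ) (n l : ℕ) (y : UnitAddCircle) :
    |sinMode (cfDenom a n) (y + l • (a : UnitAddCircle)) - sinMode (cfDenom a n) y|
      ≤ 2 * Real.pi * (l * |cfErr a n|) := by
  induction y using QuotientAddGroup.induction_on with
  | H y =>
    change |sinMode (cfDenom a n) ((y : UnitAddCircle) + l • (a : UnitAddCircle)) -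
      sinMode (cfDenom a n) (y : UnitAddCircle)| ≤ _
    rw [← AddCircle.coe_nsmul, ← AddCircle.coe_add, sinMode_coe, sinMode_coe]
    have h1 : 2 * Real.pi * (cfDenom a n : ℝ) * (y + l • a) =
        (2 * Real.pi * cfDenom a n * y + 2 * Real.pi * (l * cfErr a n)) +
          ((l * (a.convergent n).num : ℤ) : ℝ) * (2 * Real.pi) := by
      have := cfErr_eq a n
      rw [nsmul_eq_mul]; push_cast
      linear_combination (2 * Real.pi * l) * this
    rw [h1, Real.sin_add_int_mul_two_pi]
    refine (Real.abs_sin_sub_sin_le _ _).trans ?_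
    rw [add_sub_cancel_left, abs_mul (2 * Real.pi), abs_of_pos Real.two_pi_pos, abs_mul (l : ℝ),
      Nat.abs_cast]

theorem fourier_cfDenom_ne_one {a : ℝ} (h : Irrational a) (n : ℕ) :
    (fourier (cfDenom a n : ℤ) (a : UnitAddCircle) : ℂ) ≠ 1 := by
  rw [← sub_ne_zero, ← norm_ne_zero_iff, fourier_sub_one_norm]
  refine mul_ne_zero two_ne_zero (abs_ne_zero.2 fun h0 => ?_)
  obtain ⟨p, hp⟩ := Real.sin_eq_zero_iff.1 h0
  have h1 : (cfDenom a n : ℝ) * a = p := by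
    have := Real.pi_ne_zero
    apply mul_left_cancel₀ this; linarith
  have h2 : Irrational ((cfDenom a n : ℝ) * a) := h.natCast_mul (cfDenom_pos a n).ne'
  exact h2.ne_int p h1

/-- The geometric sums of the mode `q_n` are bounded by `q_{n+1}`, since `q_n a` is at distance
at least `1 / (2 q_{n+1})` from the integers. -/
theorem two_div_fourier_sub_one_le {a : ℝ} (h : Irrational a) (h0 : 0 ≤ a) {n : ℕ}
    (hn : 2 ≤ cfDenom a (n + 1)) :
    2 / ‖(fourier (cfDenom a n : ℤ) (a : UnitAddCircle) : ℂ) - 1‖ ≤ cfDenom a (n + 1) := by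
  have hpi := Real.pi_pos
  have hQ : (2 : ℝ) ≤ cfDenom a (n + 1) := by exact_mod_cast hn
  have hQ0 : (0 : ℝ) < cfDenom a (n + 1) := by linarith
  obtain ⟨hl, hu⟩ := abs_cfErr_bounds h h0 n
  have hsin : |Real.sin (Real.pi * ((cfDenom a n : ℝ) * a))| = |Real.sin (Real.pi * cfErr a n)| := by
    rw [cfErr_eq, mul_add, mul_comm Real.pi (((a.convergent n).num : ℤ) : ℝ),
      Real.sin_add_int_mul_pi, abs_mul, abs_zpow, abs_neg, abs_one, one_zpow, one_mul]
  have hhalf : |cfErr a n| ≤ 1 / 2 := hu.trans (by gcongr)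
  have h2 := Real.mul_abs_le_abs_sin (x := Real.pi * cfErr a n) (by
    rw [abs_mul, abs_of_pos hpi]; nlinarith)
  rw [abs_mul, abs_of_pos hpi] at h2
  have h3 : 2 * |cfErr a n| ≤ |Real.sin (Real.pi * cfErr a n)| := by
    refine le_trans (le_of_eq ?_) h2
    field_simp
  have h4 : 1 / (cfDenom a (n + 1) : ℝ) ≤ |Real.sin (Real.pi * cfErr a n)| := by
    refine le_trans ?_ h3
    refine le_trans (le_of_eq ?_) (mul_le_mul_of_nonneg_left hl zero_le_two)
    field_simp
  rw [fourier_sub_one_norm, hsin]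
  have h5 : 0 < |Real.sin (Real.pi * cfErr a n)| := lt_of_lt_of_le (by positivity) h4
  rw [div_le_iff₀ (by positivity)]
  rw [div_le_iff₀ hQ0] at h4
  linarith

/-- The Birkhoff sums over the rotation by `a` of the derivative of the trigonometric series
built on the denominators `q_n` of `a`: if `N` is small compared with `√q_{n+1}`, then up to an
error `O(q_n)` only the mode `q_n` contributes, and it contributes as if the rotation
were the identity. -/
theorem exists_sum_modeSumDeriv_bound {a : ℝ} (h : Irrational a) (h0 : 0 ≤ a) (n₀ : ℕ)
    (hq : ∀ n, n ≤ cfDenom a n) :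
    ∃ C : ℝ, 0 ≤ C ∧ ∀ n, n₀ ≤ n → ∀ N : ℕ, N ^ 2 ≤ cfDenom a (n + 1) → ∀ y : UnitAddCircle,
      |∑ l ∈ Finset.range N,
          modeSumDeriv (fun k => cfDenom a (n₀ + k)) (y + l • (a : UnitAddCircle))
        + 2 * Real.pi * cfDenom a n / Real.exp (cfDenom a n) * N * sinMode (cfDenom a n) y|
      ≤ C * cfDenom a n := by
  set Q : ℕ → ℕ := fun k => cfDenom a (n₀ + k) with hQdef
  have hQ : ∀ k, k ≤ Q k := fun k => (Nat.le_add_left _ _).trans (hq _)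
  have hQmono : Monotone Q := fun i j hij => cfDenom_mono h h0 (by omega)
  have hQ1 : ∀ k, (1 : ℝ) ≤ Q k := fun k => by exact_mod_cast cfDenom_pos a _
  set B : ℝ := 2 / ‖(fourier (cfDenom a 0 : ℤ) (a : UnitAddCircle) : ℂ) - 1‖ with hB
  have hB0 : 0 ≤ B := by positivity
  have hpi := Real.pi_pos
  have hs := summable_pow_div_exp hQ 2
  set S : ℝ := ∑' k, (Q k : ℝ) ^ 2 / Real.exp (Q k) with hS
  have hS0 : 0 ≤ S := tsum_nonneg fun k => by positivity
  refine ⟨(B + 1 + 2 * Real.pi) * (2 * Real.pi) * S, by positivity, fun n hn N hN y => ?_⟩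
  obtain ⟨m, rfl⟩ := Nat.exists_eq_add_of_le hn
  change |_ + 2 * Real.pi * (Q m : ℝ) / Real.exp (Q m) * N * sinMode (Q m) y| ≤ _ * (Q m : ℝ)
  change N ^ 2 ≤ Q (m + 1) at hN
  have hN1 : (N : ℝ) ^ 2 ≤ Q (m + 1) := by exact_mod_cast hN
  -- the contribution of the mode `k`
  set s : ℕ → ℝ := fun k => ∑ l ∈ Finset.range N, sinMode (Q k) (y + l • (a : UnitAddCircle))
    with hsdef
  have hsN : ∀ k, |s k| ≤ N := fun k => by
    refine (Finset.abs_sum_le_sum_abs _ _).trans ?_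
    refine (Finset.sum_le_sum fun l _ => abs_sinMode_le _ _).trans ?_
    simp
  have hterm : ∀ z : UnitAddCircle, Summable fun k => -(2 * Real.pi * Q k) * sinMode (Q k) z /
      Real.exp (Q k) := fun z =>
    Summable.of_norm_bounded ((summable_pow_div_exp hQ 1).mul_left (2 * Real.pi))
      fun k => norm_modeSumDeriv_term_le Q k z
  have hsum : ∑ l ∈ Finset.range N, modeSumDeriv Q (y + l • (a : UnitAddCircle)) =
      ∑' k, -(2 * Real.pi * Q k) * s k / Real.exp (Q k) := by
    unfold modeSumDeriv
    rw [← Summable.tsum_finsetSum fun l _ => hterm _]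
    refine tsum_congr fun k => ?_
    rw [hsdef]; simp only
    rw [Finset.mul_sum, Finset.sum_div]
  have hsummable : Summable fun k => -(2 * Real.pi * Q k) * s k / Real.exp (Q k) := by
    have := summable_sum (s := Finset.range N) fun l _ => hterm (y + l • (a : UnitAddCircle))
    refine this.congr fun k => ?_
    rw [hsdef]; simp only
    rw [Finset.mul_sum, Finset.sum_div]
  set e : ℕ → ℝ := fun k => s k - if k = m then N * sinMode (Q m) y else 0 with he
  have hmain : ∑' k, (-(2 * Real.pi * Q k) * (if k = m then N * sinMode (Q m) y else 0) /
      Real.exp (Q k)) = -(2 * Real.pi * (Q m : ℝ) / Real.exp (Q m) * N * sinMode (Q m) y) := by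
    rw [tsum_eq_single m fun k hk => by simp [hk]]
    simp only [if_true]; ring
  have hmainS : Summable fun k => (-(2 * Real.pi * Q k) *
      (if k = m then N * sinMode (Q m) y else 0) / Real.exp (Q k)) :=
    summable_of_ne_finset_zero (s := {m}) fun k hk => by
      simp only [Finset.mem_singleton] at hk; simp [hk]
  have hdiff : ∑ l ∈ Finset.range N, modeSumDeriv Q (y + l • (a : UnitAddCircle))
      + 2 * Real.pi * (Q m : ℝ) / Real.exp (Q m) * N * sinMode (Q m) y =
      ∑' k, -(2 * Real.pi * Q k) * e k / Real.exp (Q k) := by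
    rw [hsum, ← sub_neg_eq_add, ← hmain, ← hsummable.tsum_sub hmainS]
    refine tsum_congr fun k => ?_
    rw [he]; ring
  have hek : ∀ k, |e k| ≤ (B + 1 + 2 * Real.pi) * (Q m * Q k) := by
    intro k
    have hprod : (Q m : ℝ) ≤ Q m * Q k := le_mul_of_one_le_right (by linarith [hQ1 m]) (hQ1 k)
    have hprod' : (Q k : ℝ) ≤ Q m * Q k := le_mul_of_one_le_left (by linarith [hQ1 k]) (hQ1 m)
    have hone : (1 : ℝ) ≤ Q m * Q k := (hQ1 m).trans hprod
    have hbig : ∀ c : ℝ, 0 ≤ c → c ≤ B + 1 + 2 * Real.pi → c * (Q m * Q k : ℝ) ≤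
        (B + 1 + 2 * Real.pi) * (Q m * Q k) := fun c _ hc => by gcongr
    rcases lt_trichotomy k m with hk | hk | hk
    · -- low modes: the geometric sum
      have h1 : e k = s k := by rw [he]; simp [hk.ne]
      rw [h1]
      have h2 : |s k| ≤ 2 / ‖(fourier (Q k : ℤ) (a : UnitAddCircle) : ℂ) - 1‖ :=
        abs_sum_sinMode_le _ _ _ _ (fourier_cfDenom_ne_one h _)
      have h3 : 2 / ‖(fourier (Q k : ℤ) (a : UnitAddCircle) : ℂ) - 1‖ ≤ (B + 1) * Q m := by
        rcases Nat.eq_zero_or_pos (n₀ + k) with h4 | h4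
        · have : Q k = cfDenom a 0 := by rw [hQdef]; simp only [h4]
          rw [this, ← hB]
          nlinarith [hQ1 m]
        · have h5 : 2 ≤ cfDenom a (n₀ + k + 1) := le_trans (by omega) (hq _)
          have h6 : (cfDenom a (n₀ + k + 1) : ℝ) ≤ Q m := by
            exact_mod_cast hQmono (show k + 1 ≤ m from hk)
          have h7 := (two_div_fourier_sub_one_le h h0 h5).trans h6
          refine h7.trans ?_
          nlinarith [hQ1 m]
      refine (h2.trans h3).trans ?_
      refine le_trans ?_ (hbig (B + 1) (by linarith) (by linarith))
      gcongr
    · -- the resonant mode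
      subst hk
      have h1 : e k = ∑ l ∈ Finset.range N,
          (sinMode (Q k) (y + l • (a : UnitAddCircle)) - sinMode (Q k) y) := by
        rw [he]; simp [hsdef]
      have h2 : |cfErr a (n₀ + k)| ≤ 1 / Q (k + 1) := (abs_cfErr_bounds h h0 _).2
      have h3 : |e k| ≤ 2 * Real.pi := by
        rw [h1]
        refine (Finset.abs_sum_le_sum_abs _ _).trans ?_
        calc _ ≤ ∑ l ∈ Finset.range N, 2 * Real.pi * (N * (1 / Q (k + 1))) := by
              refine Finset.sum_le_sum fun l hl => ?_
              refine (abs_sinMode_shift_sub_le a (n₀ + k) l y).trans ?_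
              have : (l : ℝ) ≤ N := by exact_mod_cast (Finset.mem_range.1 hl).le
              gcongr
          _ = 2 * Real.pi * ((N : ℝ) ^ 2 / Q (k + 1)) := by simp; ring
          _ ≤ 2 * Real.pi * 1 := by
              gcongr
              rw [div_le_one (by linarith [hQ1 (k + 1)])]
              exact hN1
          _ = _ := mul_one _
      refine h3.trans (le_trans ?_ (hbig (2 * Real.pi) (by linarith) (by linarith)))
      exact le_mul_of_one_le_right (by linarith) hone
    · -- high modes: the trivial bound
      have h1 : e k = s k := by rw [he]; simp [hk.ne']
      rw [h1]
      have h2 : N ≤ Q k := by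
        have h3 : Q (m + 1) ≤ Q k := hQmono hk
        nlinarith
      have h3 : (N : ℝ) ≤ Q k := by exact_mod_cast h2
      refine ((hsN k).trans h3).trans (hprod'.trans (le_trans ?_ (hbig 1 zero_le_one (by linarith))))
      rw [one_mul]
  rw [hdiff]
  have hfin : ∀ k, ‖-(2 * Real.pi * Q k) * e k / Real.exp (Q k)‖ ≤
      ((B + 1 + 2 * Real.pi) * (2 * Real.pi) * Q m) * ((Q k : ℝ) ^ 2 / Real.exp (Q k)) := by
    intro k
    rw [norm_div, norm_mul, norm_neg, Real.norm_of_nonneg (by positivity : 0 ≤ 2 * Real.pi * (Q k : ℝ)),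
      Real.norm_of_nonneg (Real.exp_pos _).le, ← mul_div_assoc, Real.norm_eq_abs]
    refine div_le_div_of_nonneg_right ?_ (Real.exp_pos _).le
    refine (mul_le_mul_of_nonneg_left (hek k) (by positivity)).trans (le_of_eq ?_)
    ring
  have := tsum_of_norm_bounded (hs.hasSum.mul_left _) hfin
  rw [Real.norm_eq_abs] at this
  refine this.trans (le_of_eq ?_)
  rw [← hS]; ring

/-! ### The special flow as a quotient of a vertical flow -/

section Cocycle

variable {α : Fin 4 → ℝ} {φ : Torus4 → ℝ}

theorem birkhoff_zero (x : Torus4) : birkhoff α φ 0 x = 0 := by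
  change birkhoff α φ (Int.ofNat 0) x = 0
  simp [birkhoff]

theorem birkhoff_one (x : Torus4) : birkhoff α φ 1 x = φ x := by
  have := birkhoff_succ α φ 0 x
  simpa [birkhoff_zero] using this

/-- The cocycle identity of the Birkhoff sums. -/
theorem birkhoff_add (m n : ℤ) (x : Torus4) :
    birkhoff α φ (m + n) x = birkhoff α φ m x + birkhoff α φ n (x + m • proj α) := by
  induction n using Int.induction_on with
  | zero => simp [birkhoff_zero]
  | succ n ih =>
    rw [← add_assoc, birkhoff_succ, ih, birkhoff_succ, add_zsmul, ← add_assoc x, add_assoc]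
  | pred n ih =>
    have h1 := birkhoff_succ α φ (m + (-n - 1)) x
    have h2 := birkhoff_succ α φ (-n - 1) (x + m • proj α)
    rw [show m + (-(n : ℤ) - 1) + 1 = m + -n by ring, ih] at h1
    rw [sub_add_cancel] at h2
    rw [add_zsmul (proj α) m, ← add_assoc x] at h1
    linarith

theorem continuous_birkhoff (hφ : Continuous φ) (n : ℤ) : Continuous (birkhoff α φ n) := by
  rcases n with n | n
  · change Continuous fun x => ∑ k ∈ Finset.range n, φ (x + k • proj α)
    fun_prop
  · change Continuous fun x => -∑ k ∈ Finset.range (n + 1), φ (x - (k + 1) • proj α)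
    fun_prop

theorem birkhoff_le_of_le {c : ℝ} (hφ : ∀ x, c ≤ φ x) {m n : ℤ} (h : m ≤ n) (x : Torus4) :
    birkhoff α φ m x + (n - m) * c ≤ birkhoff α φ n x := by
  induction n, h using Int.leInduction with
  | base => simp
  | succ n _ ih =>
    rw [birkhoff_succ]
    push_cast
    linarith [hφ (x + n • proj α)]

theorem birkhoff_le_of_le' {c : ℝ} (hφ : ∀ x, φ x ≤ c) {m n : ℤ} (h : m ≤ n) (x : Torus4) :
    birkhoff α φ n x ≤ birkhoff α φ m x + (n - m) * c := by
  induction n, h using Int.leInduction with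
  | base => simp
  | succ n _ ih =>
    rw [birkhoff_succ]
    push_cast
    linarith [hφ (x + n • proj α)]

end Cocycle

/-- The covering `(x, u) ↦ T^u (x, 0)` of the phase space by `𝕋⁴ × ℝ`. -/
def cover (α : Fin 4 → ℝ) (φ : Torus4 → ℝ) (z : Torus4 × ℝ) : Torus4 × ℝ := flow α φ z.2 (z.1, 0)

/-- The iterates of the deck transformation `(x, u) ↦ (x + α, u - φ(x))` of the covering `cover`. -/
def deck (α : Fin 4 → ℝ) (φ : Torus4 → ℝ) (n : ℤ) (z : Torus4 × ℝ) : Torus4 × ℝ :=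
  (z.1 + n • proj α, z.2 - birkhoff α φ n z.1)

section Flow

variable {α : Fin 4 → ℝ} {φ : Torus4 → ℝ}

theorem isReturnCount_iff {x : Torus4} {s t : ℝ} {n : ℤ} :
    IsReturnCount α φ x s t n ↔ deck α φ n (x, t + s) ∈ phase φ := Iff.rfl

theorem deck_zero (z : Torus4 × ℝ) : deck α φ 0 z = z := by
  simp [deck, birkhoff_zero]

theorem deck_add (m n : ℤ) (z : Torus4 × ℝ) : deck α φ (m + n) z = deck α φ n (deck α φ m z) := by
  simp only [deck, birkhoff_add, add_zsmul, add_assoc, sub_sub]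

/-- The deck transformations commute with the vertical translations. -/
theorem deck_vertical (n : ℤ) (x : Torus4) (u t : ℝ) :
    deck α φ n (x, u + t) = ((deck α φ n (x, u)).1, (deck α φ n (x, u)).2 + t) := by
  simp only [deck, Prod.mk.injEq, true_and]; ring

/-- In the covering the special flow is the vertical translation. -/
theorem flow_eq_cover (t : ℝ) (z : Torus4 × ℝ) : flow α φ t z = cover α φ (z.1, t + z.2) := by
  have h : IsReturnCount α φ z.1 z.2 t = IsReturnCount α φ z.1 0 (t + z.2) := by
    ext n; simp [IsReturnCount]
  simp only [cover, flow, returnCount, h, add_zero]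

variable {c : ℝ} (hc : 0 < c) (hφ : ∀ x, c ≤ φ x)
include hc hφ

theorem existsUnique_deck_mem (z : Torus4 × ℝ) : ∃! n : ℤ, deck α φ n z ∈ phase φ := by
  have := existsUnique_isReturnCount α φ hc hφ z.1 0 z.2
  simpa only [isReturnCount_iff, add_zero] using this

theorem cover_eq_deck {z : Torus4 × ℝ} {n : ℤ} (h : deck α φ n z ∈ phase φ) :
    cover α φ z = deck α φ n z := by
  have h1 : IsReturnCount α φ z.1 0 z.2 n := by
    rw [isReturnCount_iff, add_zero]; exact h
  have h2 : returnCount α φ z.1 0 z.2 = n :=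
    (existsUnique_isReturnCount α φ hc hφ z.1 0 z.2).unique
      (Classical.epsilon_spec (p := IsReturnCount α φ z.1 0 z.2) ⟨n, h1⟩) h1
  simp only [cover, flow, h2, deck, add_zero]

theorem exists_cover_eq_deck (z : Torus4 × ℝ) :
    ∃ n : ℤ, deck α φ n z ∈ phase φ ∧ cover α φ z = deck α φ n z := by
  obtain ⟨n, hn, -⟩ := existsUnique_deck_mem (α := α) hc hφ z
  exact ⟨n, hn, cover_eq_deck hc hφ hn⟩

theorem cover_mem_phase (z : Torus4 × ℝ) : cover α φ z ∈ phase φ := by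
  obtain ⟨n, hn, h⟩ := exists_cover_eq_deck (α := α) hc hφ z
  exact h ▸ hn

theorem flow_mem_phase (t : ℝ) (z : Torus4 × ℝ) : flow α φ t z ∈ phase φ := by
  rw [flow_eq_cover]; exact cover_mem_phase hc hφ _

theorem cover_of_mem {z : Torus4 × ℝ} (hz : z ∈ phase φ) : cover α φ z = z := by
  have := cover_eq_deck (α := α) (n := 0) hc hφ (by rwa [deck_zero])
  rwa [deck_zero] at this

theorem cover_deck (k : ℤ) (z : Torus4 × ℝ) : cover α φ (deck α φ k z) = cover α φ z := by
  obtain ⟨n, hn, h⟩ := exists_cover_eq_deck (α := α) hc hφ z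
  have h1 : deck α φ n z = deck α φ (n - k) (deck α φ k z) := by
    rw [← deck_add]; congr 1; ring
  rw [h, h1]
  exact cover_eq_deck hc hφ (by rwa [← h1])

theorem flow_cover (t : ℝ) (x : Torus4) (u : ℝ) :
    flow α φ t (cover α φ (x, u)) = cover α φ (x, t + u) := by
  obtain ⟨n, -, h⟩ := exists_cover_eq_deck (α := α) hc hφ (x, u)
  rw [flow_eq_cover, h, ← cover_deck hc hφ n (x, t + u), add_comm t u, deck_vertical, add_comm t]

theorem flow_add (s t : ℝ) (z : Torus4 × ℝ) : flow α φ (s + t) z = flow α φ s (flow α φ t z) := by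
  rw [flow_eq_cover t z, flow_cover hc hφ, flow_eq_cover, add_assoc]

theorem flow_zero {z : Torus4 × ℝ} (hz : z ∈ phase φ) : flow α φ 0 z = z := by
  rw [flow_eq_cover, zero_add]; exact cover_of_mem hc hφ hz

end Flow

section Measure

variable {α : Fin 4 → ℝ} {φ : Torus4 → ℝ} (hcont : Continuous φ)
include hcont

theorem measurableSet_phase : MeasurableSet (phase φ) := by
  refine MeasurableSet.inter ?_ ?_
  · exact measurableSet_le measurable_const measurable_snd
  · exact measurableSet_lt measurable_snd (hcont.measurable.comp measurable_fst)

theorem measurePreserving_deck (n : ℤ) : MeasurePreserving (deck α φ n) := by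
  have h1 : MeasurePreserving (fun x : Torus4 => x + n • proj α) :=
    measurePreserving_add_right volume _
  have h2 := h1.skew_product (μc := (volume : Measure ℝ)) (μd := (volume : Measure ℝ))
    (g := fun x u => u - birkhoff α φ n x) (by
      have := (continuous_birkhoff (α := α) hcont n).measurable
      simp only [Function.uncurry_def]
      fun_prop)
    (ae_of_all _ fun x => (measurePreserving_sub_right volume (birkhoff α φ n x)).map_eq)
  exact h2

theorem measurable_flow {c : ℝ} (hc : 0 < c) (hφ : ∀ x, c ≤ φ x) (t : ℝ) :
    Measurable (flow α φ t) := by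
  intro E hE
  have h1 : flow α φ t ⁻¹' E = ⋃ n : ℤ,
      (fun z : Torus4 × ℝ => deck α φ n (z.1, z.2 + t)) ⁻¹' (phase φ ∩ E) := by
    ext z
    simp only [mem_preimage, mem_iUnion, mem_inter_iff]
    rw [flow_eq_cover, add_comm t]
    constructor
    · intro h
      obtain ⟨n, hn, h2⟩ := exists_cover_eq_deck (α := α) hc hφ (z.1, z.2 + t)
      exact ⟨n, hn, h2 ▸ h⟩
    · rintro ⟨n, hn, h⟩
      rwa [cover_eq_deck hc hφ hn]
  rw [h1]
  refine MeasurableSet.iUnion fun n => ?_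
  refine ((measurePreserving_deck hcont n).measurable.comp ?_)
    ((measurableSet_phase hcont).inter hE)
  fun_prop

/-- The special flow preserves the measure: `M` and all its images under vertical translations
are fundamental domains of the measure preserving action of the deck transformations. -/
theorem measurePreserving_flow {c : ℝ} (hc : 0 < c) (hφ : ∀ x, c ≤ φ x) (t : ℝ) :
    MeasurePreserving (flow α φ t) (phaseMeasure φ) (phaseMeasure φ) := by
  refine ⟨measurable_flow hcont hc hφ t, ?_⟩
  ext E hE
  have hM := measurableSet_phase hcont
  rw [Measure.map_apply (measurable_flow hcont hc hφ t) hE, phaseMeasure,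
    Measure.restrict_apply (measurable_flow hcont hc hφ t hE), Measure.restrict_apply hE]
  -- `G n = T^t` on the part of `M` where the return count is `n`
  let G : ℤ → Torus4 × ℝ → Torus4 × ℝ := fun n z => deck α φ n (z.1, z.2 + t)
  have hv (r : ℝ) : MeasurePreserving (fun z : Torus4 × ℝ => (z.1, z.2 + r)) :=
    (MeasurePreserving.id volume).prod (measurePreserving_add_right volume r)
  have hG (n : ℤ) : MeasurePreserving (G n) := (measurePreserving_deck hcont n).comp (hv t)
  let G' : ℤ → Torus4 × ℝ → Torus4 × ℝ := fun n z => deck α φ n (z.1, z.2 + (-t))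
  have hG' (n : ℤ) : MeasurePreserving (G' n) := (measurePreserving_deck hcont n).comp (hv (-t))
  have hGG' (n : ℤ) (z : Torus4 × ℝ) : G (-n) (G' n z) = z := by
    simp only [G, G']
    rw [← deck_vertical, neg_add_cancel_right, ← deck_add, add_neg_cancel, deck_zero]
  have h1 : flow α φ t ⁻¹' E ∩ phase φ = ⋃ n : ℤ, G n ⁻¹' (phase φ ∩ E) ∩ phase φ := by
    rw [← iUnion_inter]
    congr 1
    ext z
    simp only [mem_preimage, mem_iUnion, mem_inter_iff]
    rw [flow_eq_cover, add_comm t]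
    constructor
    · intro h
      obtain ⟨n, hn, h2⟩ := exists_cover_eq_deck (α := α) hc hφ (z.1, z.2 + t)
      rw [h2] at h
      exact ⟨n, hn, h⟩
    · rintro ⟨n, hn, h⟩
      rwa [cover_eq_deck hc hφ hn]
  have h2 : E ∩ phase φ = ⋃ n : ℤ, (phase φ ∩ E) ∩ G' n ⁻¹' phase φ := by
    rw [← inter_iUnion, inter_comm E]
    refine (inter_eq_left.2 fun z _ => ?_).symm
    obtain ⟨n, hn, -⟩ := existsUnique_deck_mem (α := α) hc hφ (z.1, z.2 + (-t))
    exact mem_iUnion.2 ⟨n, hn⟩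
  rw [h1, h2, measure_iUnion, measure_iUnion]
  · rw [← (Equiv.neg ℤ).tsum_eq]
    refine tsum_congr fun n => ?_
    rw [← (hG' n).measure_preimage]
    · congr 1
      ext z
      simp only [mem_preimage, mem_inter_iff, Equiv.neg_apply, hGG']
    · exact (((hG _).measurable (hM.inter hE)).inter hM).nullMeasurableSet
  · intro m n hmn
    refine Set.disjoint_left.2 fun z hz hz' => hmn ?_
    exact (existsUnique_deck_mem (α := α) hc hφ _).unique hz.2 hz'.2
  · exact fun n => (hM.inter hE).inter ((hG' n).measurable hM)
  · intro m n hmn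
    refine Set.disjoint_left.2 fun z hz hz' => hmn ?_
    exact (existsUnique_deck_mem (α := α) hc hφ _).unique hz.1.1 hz'.1.1
  · exact fun n => ((hG n).measurable (hM.inter hE)).inter hM

omit hcont in
theorem isFiniteMeasure_phaseMeasure {Φ : ℝ} (hΦ : ∀ x, φ x ≤ Φ) :
    IsFiniteMeasure (phaseMeasure φ) := by
  refine ⟨?_⟩
  rw [phaseMeasure, Measure.restrict_apply_univ]
  have h1 : phase φ ⊆ univ ×ˢ Icc 0 Φ := fun z hz => ⟨mem_univ _, hz.1, hz.2.le.trans (hΦ _)⟩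
  refine (measure_mono h1).trans_lt ?_
  rw [Measure.volume_eq_prod, Measure.prod_prod]
  refine ENNReal.mul_lt_top (measure_lt_top _ _) ?_
  simp

end Measure

/-! ### Partial derivatives and integration by parts on the torus -/

instance : IsProbabilityMeasure (volume : Measure UnitAddCircle) :=
  ⟨by rw [AddCircle.measure_univ]; simp⟩

instance : IsProbabilityMeasure (volume : Measure Torus4) :=
  inferInstanceAs (IsProbabilityMeasure (Measure.pi fun _ : Fin 4 => (volume : Measure UnitAddCircle)))

/-- The element `h e_j` of the torus. -/
def dirShift (j : Fin 4) (h : ℝ) : Torus4 := Pi.single j (h : UnitAddCircle)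

theorem dirShift_zero (j : Fin 4) : dirShift j 0 = 0 := by
  simp [dirShift]

theorem dirShift_one (j : Fin 4) : dirShift j 1 = 0 := by
  have : ((1 : ℝ) : UnitAddCircle) = 0 := AddCircle.coe_period 1
  simp [dirShift, this]

theorem dirShift_add (j : Fin 4) (h k : ℝ) : dirShift j (h + k) = dirShift j h + dirShift j k := by
  simp [dirShift, Pi.single_add]

theorem continuous_dirShift (j : Fin 4) : Continuous (dirShift j) :=
  (continuous_single j).comp (AddCircle.continuous_mk' 1)

theorem proj_add (x y : Fin 4 → ℝ) : proj (x + y) = proj x + proj y := by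
  ext i; simp [proj]

theorem proj_single (j : Fin 4) (h : ℝ) : proj (Pi.single j h) = dirShift j h := by
  ext i
  rcases eq_or_ne i j with rfl | hij
  · simp [proj, dirShift]
  · simp [proj, dirShift, hij]

/-- `K'` is the partial derivative of `K` in the direction of the coordinate `j`. -/
def HasDirDeriv (j : Fin 4) (K K' : Torus4 → ℝ) : Prop :=
  ∀ x, HasDerivAt (fun h : ℝ => K (x + dirShift j h)) (K' x) 0

section DirDeriv

variable {j : Fin 4} {K K' L L' : Torus4 → ℝ}

theorem HasDirDeriv.mul (hK : HasDirDeriv j K K') (hL : HasDirDeriv j L L') :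
    HasDirDeriv j (fun x => K x * L x) (fun x => K' x * L x + K x * L' x) := fun x => by
  have := (hK x).mul (hL x)
  simpa only [dirShift_zero, add_zero] using! this

theorem HasDirDeriv.inv (hK : HasDirDeriv j K K') (h0 : ∀ x, K x ≠ 0) :
    HasDirDeriv j (fun x => (K x)⁻¹) (fun x => -K' x / K x ^ 2) := fun x => by
  have := (hK x).inv (h0 _)
  simpa only [dirShift_zero, add_zero] using! this

theorem HasDirDeriv.hasDerivAt (hK : HasDirDeriv j K K') (x : Torus4) (h₀ : ℝ) :
    HasDerivAt (fun h : ℝ => K (x + dirShift j h)) (K' (x + dirShift j h₀)) h₀ := by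
  have h1 := hK (x + dirShift j h₀)
  rw [← sub_self h₀] at h1
  have h2 := h1.comp_sub_const h₀ h₀
  refine h2.congr_of_eventuallyEq (Eventually.of_forall fun h => ?_)
  simp only [add_assoc, ← dirShift_add, add_sub_cancel]

/-- The integral of a partial derivative over the torus vanishes. -/
theorem HasDirDeriv.integral_eq_zero (hK : HasDirDeriv j K K') (hc : Continuous K') :
    ∫ x, K' x = 0 := by
  have hcont : Continuous fun p : ℝ × Torus4 => K' (p.2 + dirShift j p.1) :=
    hc.comp (continuous_snd.add ((continuous_dirShift j).comp continuous_fst))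
  have h1 (x : Torus4) : ∫ h in (0 : ℝ)..1, K' (x + dirShift j h) = 0 := by
    rw [intervalIntegral.integral_eq_sub_of_hasDerivAt (f := fun h => K (x + dirShift j h))
      (fun h _ => hK.hasDerivAt x h) (by
        apply Continuous.intervalIntegrable
        exact hc.comp (continuous_const.add (continuous_dirShift j)))]
    simp [dirShift_zero, dirShift_one]
  obtain ⟨B, hB⟩ : ∃ B, ∀ x, ‖K' x‖ ≤ B := by
    obtain ⟨x₀, -, h⟩ := isCompact_univ.exists_isMaxOn (univ_nonempty (α := Torus4))
      hc.norm.continuousOn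
    exact ⟨_, fun x => h (mem_univ x)⟩
  have h2 : ∫ h in (0 : ℝ)..1, ∫ x, K' (x + dirShift j h) = 0 := by
    rw [intervalIntegral.integral_of_le zero_le_one, integral_integral_swap]
    · simp_rw [← intervalIntegral.integral_of_le (zero_le_one' ℝ), h1, integral_zero]
    · refine Integrable.of_bound hcont.aestronglyMeasurable B (ae_of_all _ fun p => hB _)
  simpa only [integral_add_right_eq_self, intervalIntegral.integral_const, sub_zero, one_smul]
    using h2

theorem continuous_integrable {X : Type*} [TopologicalSpace X] [CompactSpace X] [MeasurableSpace X]
    [OpensMeasurableSpace X] {μ : Measure X} [IsFiniteMeasure μ] [SecondCountableTopology X]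
    {K : X → ℝ} (hK : Continuous K) : Integrable K μ :=
  hK.integrable_of_hasCompactSupport (HasCompactSupport.of_compactSpace K)

/-- Integration by parts on the torus. -/
theorem HasDirDeriv.integral_mul_eq (hK : HasDirDeriv j K K') (hL : HasDirDeriv j L L')
    (hKc : Continuous K) (hKc' : Continuous K') (hLc : Continuous L) (hLc' : Continuous L') :
    ∫ x, K' x * L x = -∫ x, K x * L' x := by
  have h1 := (hK.mul hL).integral_eq_zero (by fun_prop)
  rw [integral_add (continuous_integrable (by fun_prop)) (continuous_integrable (by fun_prop))] at h1
  linarith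

theorem HasDirDeriv.sum {ι : Type*} (s : Finset ι) {K K' : ι → Torus4 → ℝ}
    (h : ∀ i ∈ s, HasDirDeriv j (K i) (K' i)) :
    HasDirDeriv j (fun x => ∑ i ∈ s, K i x) (fun x => ∑ i ∈ s, K' i x) := fun x =>
  HasDerivAt.fun_sum fun i hi => h i hi x

theorem HasDirDeriv.comp_add (hK : HasDirDeriv j K K') (a : Torus4) :
    HasDirDeriv j (fun x => K (x + a)) (fun x => K' (x + a)) := fun x => by
  have := hK (x + a)
  simpa only [add_right_comm] using this

/-- The partial derivative of a function of the coordinate `j` alone. -/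
theorem hasDirDeriv_coord {k k' : UnitAddCircle → ℝ}
    (h : ∀ y : ℝ, HasDerivAt (fun s : ℝ => k (s : UnitAddCircle)) (k' (y : UnitAddCircle)) y)
    (j : Fin 4) : HasDirDeriv j (fun x => k (x j)) (fun x => k' (x j)) := fun x => by
  obtain ⟨y, hy⟩ := QuotientAddGroup.mk_surjective (x j)
  have h1 := h y
  rw [show y = y + 0 by ring] at h1
  have h2 := h1.comp_const_add y 0
  rw [add_zero] at h2
  change HasDerivAt (fun s : ℝ => k ((x + dirShift j s) j)) (k' (x j)) 0
  rw [← hy]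
  refine h2.congr_of_eventuallyEq (Eventually.of_forall fun s => ?_)
  simp only [dirShift, Pi.add_apply, Pi.single_eq_same, ← hy]
  rfl

theorem hasDirDeriv_coord_of_ne (k : UnitAddCircle → ℝ) {i j : Fin 4} (hij : i ≠ j) :
    HasDirDeriv j (fun x => k (x i)) (fun _ => 0) := fun x => by
  simpa [dirShift, hij] using hasDerivAt_const (0 : ℝ) (k (x i))

end DirDeriv

/-- The integration by parts behind the decay of correlations. If a derivative `Ψ'` is `κ ν σ F`
up to a bounded error, the integral of `F σ W` is that of `Ψ' W / (κ ν)` up to a small error; moving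
the derivative to `W / ν` gains the factor `κ ν`, at the cost of the derivatives of `W` and `ν`. -/
theorem abs_integral_mul_le_of_resonance {j : Fin 4} {F Ψ Ψ' ν ν' σ W W' : Torus4 → ℝ}
    (hF : Continuous F) (hΨ : Continuous Ψ) (hΨ' : Continuous Ψ') (hν : Continuous ν)
    (hν' : Continuous ν') (hσ : Continuous σ) (hW : Continuous W) (hW' : Continuous W')
    (dΨ : HasDirDeriv j Ψ Ψ') (dν : HasDirDeriv j ν ν') (dW : HasDirDeriv j W W')
    {κ ν₀ ν₁ R w₀ w₁ B₀ : ℝ} (hκ : 0 < κ) (hν₀ : 0 < ν₀) (hνl : ∀ x, ν₀ ≤ ν x)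
    (hν₁ : ∀ x, |ν' x| ≤ ν₁) (hR : ∀ x, |κ * ν x * σ x * F x - Ψ' x| ≤ R)
    (hw₀ : ∀ x, |W x| ≤ w₀) (hw₁ : ∫ x, |W' x| ≤ w₁) (hB₀ : ∀ x, |Ψ x| ≤ B₀) :
    |∫ x, F x * σ x * W x| ≤ (R * w₀ + B₀ * (w₁ + w₀ * ν₁ / ν₀)) / (κ * ν₀) := by
  have hνpos : ∀ x, 0 < ν x := fun x => hν₀.trans_le (hνl x)
  have hν0 : ∀ x, ν x ≠ 0 := fun x => (hνpos x).ne'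
  have x₀ : Torus4 := 0
  have hB0 : 0 ≤ B₀ := (abs_nonneg _).trans (hB₀ x₀)
  have hw0 : 0 ≤ w₀ := (abs_nonneg _).trans (hw₀ x₀)
  have hR0 : 0 ≤ R := (abs_nonneg _).trans (hR x₀)
  have hν10 : 0 ≤ ν₁ := (abs_nonneg _).trans (hν₁ x₀)
  have dL := dW.mul ((dν.inv hν0))
  have hLc : Continuous fun x => W x * (ν x)⁻¹ := hW.mul (hν.inv₀ hν0)
  have hLc' : Continuous fun x => W' x * (ν x)⁻¹ + W x * (-ν' x / ν x ^ 2) :=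
    (hW'.mul (hν.inv₀ hν0)).add (hW.mul (hν'.neg.div (hν.pow 2) fun x => pow_ne_zero 2 (hν0 x)))
  have hparts := dΨ.integral_mul_eq dL hΨ hΨ' hLc hLc'
  have hsplit : ∀ x, F x * σ x * W x = κ⁻¹ *
      ((κ * ν x * σ x * F x - Ψ' x) * (W x * (ν x)⁻¹) + Ψ' x * (W x * (ν x)⁻¹)) := fun x => by
    have := hν0 x
    field_simp
    ring
  have hc1 : Continuous fun x => (κ * ν x * σ x * F x - Ψ' x) * (W x * (ν x)⁻¹) :=
    (((((continuous_const.mul hν).mul hσ).mul hF).sub hΨ').mul hLc)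
  have hint : ∫ x, F x * σ x * W x = κ⁻¹ *
      ((∫ x, (κ * ν x * σ x * F x - Ψ' x) * (W x * (ν x)⁻¹)) -
        ∫ x, Ψ x * (W' x * (ν x)⁻¹ + W x * (-ν' x / ν x ^ 2))) := by
    simp_rw [hsplit]
    rw [integral_const_mul, integral_add (continuous_integrable hc1)
      (continuous_integrable (by fun_prop)), hparts, sub_eq_add_neg]
  have hinv : ∀ x, (ν x)⁻¹ ≤ ν₀⁻¹ := fun x => inv_anti₀ hν₀ (hνl x)
  have hb1 : |∫ x, (κ * ν x * σ x * F x - Ψ' x) * (W x * (ν x)⁻¹)| ≤ R * (w₀ * ν₀⁻¹) := by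
    rw [← Real.norm_eq_abs]
    refine (norm_integral_le_of_norm_le_const (C := R * (w₀ * ν₀⁻¹)) (ae_of_all _ fun x => ?_)).trans ?_
    · rw [norm_mul, norm_mul, norm_inv, Real.norm_eq_abs, Real.norm_eq_abs, Real.norm_eq_abs,
        abs_of_pos (hνpos x)]
      have := (inv_pos.2 (hνpos x)).le
      exact mul_le_mul (hR x) (mul_le_mul (hw₀ x) (hinv x) this hw0) (by positivity) hR0
    · simp
  have hb2 : |∫ x, Ψ x * (W' x * (ν x)⁻¹ + W x * (-ν' x / ν x ^ 2))| ≤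
      B₀ * ((w₁ + w₀ * ν₁ / ν₀) * ν₀⁻¹) := by
    have hpt : ∀ x, |Ψ x * (W' x * (ν x)⁻¹ + W x * (-ν' x / ν x ^ 2))| ≤
        B₀ * ν₀⁻¹ * |W' x| + B₀ * (w₀ * ν₁ / ν₀ * ν₀⁻¹) := fun x => by
      rw [abs_mul]
      have hi := (inv_pos.2 (hνpos x)).le
      calc _ ≤ B₀ * (|W' x| * ν₀⁻¹ + w₀ * (ν₁ * (ν₀⁻¹ * ν₀⁻¹))) := by
            refine mul_le_mul (hB₀ x) ?_ (abs_nonneg _) hB0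
            refine (abs_add_le _ _).trans (add_le_add ?_ ?_)
            · rw [abs_mul, abs_inv, abs_of_pos (hνpos x)]
              exact mul_le_mul_of_nonneg_left (hinv x) (abs_nonneg _)
            · rw [abs_mul, neg_div, abs_neg, abs_div, abs_of_pos (pow_pos (hνpos x) 2),
                div_eq_mul_inv, ← inv_pow, pow_two]
              refine mul_le_mul (hw₀ x) ?_ (by positivity) hw0
              refine mul_le_mul (hν₁ x) ?_ (by positivity) hν10
              exact mul_le_mul (hinv x) (hinv x) hi (by positivity)
        _ = _ := by field_simp
    refine (abs_integral_le_integral_abs).trans ?_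
    refine (integral_mono (continuous_integrable (hΨ.mul hLc').abs)
      (continuous_integrable (by fun_prop)) hpt).trans ?_
    rw [integral_add (continuous_integrable (by fun_prop)) (continuous_integrable (by fun_prop)),
      integral_const_mul]
    simp only [integral_const, smul_eq_mul, probReal_univ, one_mul]
    have : B₀ * ν₀⁻¹ * ∫ x, |W' x| ≤ B₀ * ν₀⁻¹ * w₁ := by gcongr
    refine (add_le_add_left this _).trans (le_of_eq (by ring))
  rw [hint, abs_mul, abs_inv, abs_of_pos hκ]
  calc _ ≤ κ⁻¹ * (R * (w₀ * ν₀⁻¹) + B₀ * ((w₁ + w₀ * ν₁ / ν₀) * ν₀⁻¹)) := by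
        gcongr
        exact (abs_sub _ _).trans (add_le_add hb1 hb2)
    _ = _ := by field_simp

/-! ### Cutoffs near the zeros of a mode -/

/-- The bump `η² / (σ² + η²)`, `σ = sin (2π q y)`, concentrated near the zeros of `σ`. -/
def resBump (η : ℝ) (q : ℕ) (y : UnitAddCircle) : ℝ := η ^ 2 / (sinMode q y ^ 2 + η ^ 2)

/-- The regularized inverse `σ / (σ² + η²)` of `σ = sin (2π q y)`. -/
def resWeight (η : ℝ) (q : ℕ) (y : UnitAddCircle) : ℝ := sinMode q y / (sinMode q y ^ 2 + η ^ 2)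

/-- The derivative of `resWeight`. -/
def resWeightDeriv (η : ℝ) (q : ℕ) (y : UnitAddCircle) : ℝ :=
  2 * Real.pi * q * cosMode q y * (η ^ 2 - sinMode q y ^ 2) / (sinMode q y ^ 2 + η ^ 2) ^ 2

section Weights

variable {η : ℝ} (hη : 0 < η) (q : ℕ)
include hη

theorem res_denom_pos (y : UnitAddCircle) : 0 < sinMode q y ^ 2 + η ^ 2 := by positivity

theorem continuous_resBump : Continuous (resBump η q) :=
  continuous_const.div (((continuous_sinMode q).pow 2).add continuous_const)
    fun y => (res_denom_pos hη q y).ne'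

theorem continuous_resWeight : Continuous (resWeight η q) :=
  (continuous_sinMode q).div (((continuous_sinMode q).pow 2).add continuous_const)
    fun y => (res_denom_pos hη q y).ne'

theorem continuous_resWeightDeriv : Continuous (resWeightDeriv η q) := by
  have h1 := continuous_sinMode q
  have h2 := continuous_cosMode q
  refine Continuous.div (by fun_prop) (by fun_prop) fun y => pow_ne_zero 2 (res_denom_pos hη q y).ne'

theorem resBump_nonneg (y : UnitAddCircle) : 0 ≤ resBump η q y := by
  unfold resBump; positivity

theorem resBump_le_one (y : UnitAddCircle) : resBump η q y ≤ 1 := by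
  unfold resBump
  rw [div_le_one (res_denom_pos hη q y)]
  linarith [sq_nonneg (sinMode q y)]

/-- Away from the zeros of `σ` a function can be divided by `σ`; the rest is localized. -/
theorem sinMode_mul_resWeight (y : UnitAddCircle) :
    sinMode q y * resWeight η q y = 1 - resBump η q y := by
  have := (res_denom_pos hη q y).ne'
  unfold resBump resWeight
  field_simp
  ring

theorem abs_resWeight_le (y : UnitAddCircle) : |resWeight η q y| ≤ 1 / (2 * η) := by
  have h := res_denom_pos hη q y
  unfold resWeight
  rw [abs_div, abs_of_pos h, div_le_div_iff₀ h (by positivity), ← sq_abs (sinMode q y)]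
  nlinarith [sq_nonneg (|sinMode q y| - η)]

theorem hasDerivAt_resWeight (y : ℝ) : HasDerivAt (fun s : ℝ => resWeight η q (s : UnitAddCircle))
    (resWeightDeriv η q (y : UnitAddCircle)) y := by
  have h := res_denom_pos hη q (y : UnitAddCircle)
  have h1 := hasDerivAt_sinMode q y
  refine (h1.div ((h1.pow 2).add_const (η ^ 2)) h.ne').congr_deriv ?_
  unfold resWeightDeriv
  simp only [Pi.pow_apply]
  field_simp
  push_cast
  ring

/-- The derivative of the weight is of order `q / η²`, but only on the support of the bump, so that
its integral is of order `q / η`. -/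
theorem abs_resWeightDeriv_le (y : UnitAddCircle) :
    |resWeightDeriv η q y| ≤ 2 * Real.pi * q / η ^ 2 * resBump η q y := by
  have h := res_denom_pos hη q y
  have hpi := Real.pi_pos
  unfold resWeightDeriv resBump
  rw [abs_div, abs_mul, abs_mul, abs_of_nonneg (by positivity : 0 ≤ 2 * Real.pi * (q : ℝ)),
    abs_of_pos (pow_pos h 2)]
  have h1 : |η ^ 2 - sinMode q y ^ 2| ≤ sinMode q y ^ 2 + η ^ 2 := by
    rw [abs_le]; constructor <;> nlinarith [sq_nonneg (sinMode q y), sq_nonneg η]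
  have h2 := abs_cosMode_le q y
  calc _ ≤ 2 * Real.pi * q * 1 * (sinMode q y ^ 2 + η ^ 2) / (sinMode q y ^ 2 + η ^ 2) ^ 2 := by
        gcongr
    _ = _ := by field_simp

/-- A Cauchy bump of width `η / 4` has mass at most `π η / 4`. -/
theorem integral_cauchy_le :
    ∫ y in (-(1 / 4) : ℝ)..(1 / 4), η ^ 2 / (16 * y ^ 2 + η ^ 2) ≤ Real.pi / 4 * η := by
  have hd : ∀ y : ℝ, HasDerivAt (fun y => η / 4 * Real.arctan (4 / η * y))
      (η ^ 2 / (16 * y ^ 2 + η ^ 2)) y := fun y => by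
    have h1 := (((hasDerivAt_id y).const_mul (4 / η)).arctan).const_mul (η / 4)
    refine h1.congr_deriv ?_
    have : 16 * y ^ 2 + η ^ 2 ≠ 0 := by positivity
    have h3 : (1 + (4 / η * id y) ^ 2) ≠ 0 := by positivity
    simp only [id] at h3 ⊢
    field_simp
    ring
  rw [intervalIntegral.integral_eq_sub_of_hasDerivAt (fun y _ => hd y)]
  · have h1 := Real.arctan_lt_pi_div_two (4 / η * (1 / 4))
    have h2 := Real.neg_pi_div_two_lt_arctan (4 / η * (-(1 / 4)))
    nlinarith
  · refine ContinuousOn.intervalIntegrable (Continuous.continuousOn ?_)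
    refine Continuous.div (by fun_prop) (by fun_prop) fun y => by positivity

theorem integral_resBump_le (hq : q ≠ 0) : ∫ y, resBump η q y ≤ Real.pi / 2 * η := by
  -- the map `y ↦ q y` reduces to the case `q = 1`
  have h1 : ∫ y, resBump η q y = ∫ y, resBump η 1 y := by
    have hmp : MeasurePreserving (fun y : UnitAddCircle => (q : ℤ) • y) volume volume :=
      Measure.measurePreserving_zsmul volume (by exact_mod_cast hq)
    have h2 : ∀ y, resBump η q y = resBump η 1 ((q : ℤ) • y) := fun y => by
      simp only [resBump, sinMode, fourier_apply, Nat.cast_one, one_zsmul]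
    simp_rw [h2]
    rw [← integral_map hmp.measurable.aemeasurable
      (continuous_resBump hη 1).aestronglyMeasurable, hmp.map_eq]
  have hcont : Continuous fun y : ℝ => resBump η 1 (y : UnitAddCircle) :=
    (continuous_resBump hη 1).comp (AddCircle.continuous_mk' 1)
  rw [h1, ← UnitAddCircle.intervalIntegral_preimage (-(1 / 4)),
    ← intervalIntegral.integral_add_adjacent_intervals (b := 1 / 4)
      (hcont.intervalIntegrable _ _) (hcont.intervalIntegrable _ _)]
  -- `sin²` has period `1 / 2`, so one of its two zeros suffices
  have hshift : ∫ y in (1 / 4 : ℝ)..(-(1 / 4) + 1), resBump η 1 (y : UnitAddCircle) =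
      ∫ y in (-(1 / 4) : ℝ)..(1 / 4), resBump η 1 (y : UnitAddCircle) := by
    have h2 : ∀ y : ℝ, resBump η 1 (y : UnitAddCircle) =
        resBump η 1 ((y + 1 / 2 : ℝ) : UnitAddCircle) := fun y => by
      unfold resBump
      rw [sinMode_coe, sinMode_coe]
      have : 2 * Real.pi * (1 : ℕ) * (y + 1 / 2) = 2 * Real.pi * (1 : ℕ) * y + Real.pi := by
        push_cast; ring
      rw [this, Real.sin_add_pi, neg_sq]
    rw [intervalIntegral.integral_congr (a := -(1 / 4)) fun y _ => h2 y,
      intervalIntegral.integral_comp_add_right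
        (fun y : ℝ => resBump η 1 (y : UnitAddCircle)) (1 / 2)]
    norm_num
  have hle : ∫ y in (-(1 / 4) : ℝ)..(1 / 4), resBump η 1 (y : UnitAddCircle) ≤
      Real.pi / 4 * η := by
    refine le_trans ?_ (integral_cauchy_le hη)
    refine intervalIntegral.integral_mono_on (by norm_num) (hcont.intervalIntegrable _ _) ?_ ?_
    · refine ContinuousOn.intervalIntegrable (Continuous.continuousOn ?_)
      refine Continuous.div (by fun_prop) (by fun_prop) fun y => by positivity
    · intro y hy
      have hpi := Real.pi_pos
      have h3 : |y| ≤ 1 / 4 := abs_le.2 ⟨hy.1, hy.2⟩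
      have h2 := Real.mul_abs_le_abs_sin (x := 2 * Real.pi * y) (by
        rw [abs_mul, abs_of_pos (by positivity)]; nlinarith)
      have h4 : 4 * |y| ≤ |Real.sin (2 * Real.pi * y)| := by
        refine le_trans (le_of_eq ?_) h2
        rw [abs_mul, abs_of_pos (by positivity : 0 < 2 * Real.pi)]
        field_simp
        ring
      have h5 : 16 * y ^ 2 ≤ Real.sin (2 * Real.pi * y) ^ 2 := by
        rw [← sq_abs y, ← sq_abs (Real.sin _)]
        nlinarith [abs_nonneg y]
      unfold resBump
      rw [sinMode_coe, Nat.cast_one, mul_one]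
      gcongr
  rw [hshift]
  linarith

theorem integral_resBump_coord_le (hq : q ≠ 0) (j : Fin 4) :
    ∫ x : Torus4, resBump η q (x j) ≤ Real.pi / 2 * η := by
  have hmp : MeasurePreserving (fun x : Torus4 => x j) volume volume :=
    measurePreserving_eval (fun _ : Fin 4 => (volume : Measure UnitAddCircle)) j
  rw [← integral_map (φ := fun x : Torus4 => x j) (f := resBump η q) hmp.measurable.aemeasurable
    (continuous_resBump hη q).aestronglyMeasurable, hmp.map_eq]
  exact integral_resBump_le hη q hq

/-- The bumps in two different coordinates are independent, so their product has mass
`O(η²)`. -/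
theorem integral_resBump_mul_resBump_le {q' : ℕ} (hq : q ≠ 0) (hq' : q' ≠ 0) {a b : Fin 4}
    (hab : a ≠ b) :
    ∫ x : Torus4, resBump η q (x a) * resBump η q' (x b) ≤ (Real.pi / 2 * η) ^ 2 := by
  have h1 : ∀ x : Torus4, resBump η q (x a) * resBump η q' (x b) =
      ∏ i, (if i = a then resBump η q else if i = b then resBump η q' else fun _ => 1) (x i) := by
    intro x
    rw [Finset.prod_eq_mul a b hab]
    · simp [hab.symm]
    · rintro i - ⟨hi, hi'⟩; simp [hi, hi']
    · simp
    · simp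
  simp_rw [h1]
  rw [integral_fintype_prod_volume_eq_prod, Finset.prod_eq_mul a b hab]
  · simp only [if_true, if_neg hab.symm]
    rw [pow_two]
    have hb : 0 ≤ ∫ y, resBump η q' y := integral_nonneg fun y => resBump_nonneg hη q' y
    have hpi := Real.pi_pos
    exact mul_le_mul (integral_resBump_le hη q hq) (integral_resBump_le hη q' hq') hb (by positivity)
  · rintro i - ⟨hi, hi'⟩
    simp [hi, hi']
  · simp
  · simp

end Weights

/-! ### Roof functions and the smoothed return count -/

/-- `φ` is an even smooth roof function with values in `[c, Φ]`, whose partial derivative in the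
direction `j` is a function `dφ j` of the coordinate `x_j` alone. -/
structure IsRoof (φ : Torus4 → ℝ) (dφ : Fin 4 → UnitAddCircle → ℝ) (c Φ : ℝ) : Prop where
  pos : 0 < c
  le : ∀ x, c ≤ φ x
  ge : ∀ x, φ x ≤ Φ
  smooth : ContDiff ℝ ∞ fun x => φ (proj x)
  cont : Continuous φ
  dcont : ∀ j, Continuous (dφ j)
  deriv : ∀ j, HasDirDeriv j φ fun x => dφ j (x j)
  even : ∀ x, φ (-x) = φ x

/-- The partial derivative in the direction `j` of the `N`-th Birkhoff sum of the roof function. -/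
def derivSum (α : Fin 4 → ℝ) (dφ : Fin 4 → UnitAddCircle → ℝ) (j : Fin 4) (N : ℕ)
    (y : UnitAddCircle) : ℝ :=
  ∑ l ∈ Finset.range N, dφ j (y + l • (α j : UnitAddCircle))

/-- A smooth substitute for the return count `N(x, 0, u)`, which is the number of `k` with
`S_{k+1} φ(x) ≤ u`: the indicator of `0 ≤ u - S_{k+1} φ(x)` is replaced by a smooth transition. The
number `K` of terms only has to be large enough. -/
def smoothCount (α : Fin 4 → ℝ) (φ : Torus4 → ℝ) (K : ℕ) (u : ℝ) (x : Torus4) : ℝ :=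
  ∑ k ∈ Finset.range K, Real.smoothTransition (u - birkhoff α φ ((k + 1 : ℕ) : ℤ) x)

theorem exists_deriv_smoothTransition_bound :
    ∃ B : ℝ, 0 ≤ B ∧ (∀ x, |deriv Real.smoothTransition x| ≤ B) ∧
      ∀ x, x ∉ Icc (0 : ℝ) 1 → deriv Real.smoothTransition x = 0 := by
  have hcont : Continuous (deriv Real.smoothTransition) :=
    (Real.smoothTransition.contDiff (n := 1)).continuous_deriv le_rfl
  have hout : ∀ x, x ∉ Icc (0 : ℝ) 1 → deriv Real.smoothTransition x = 0 := by
    intro x hx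
    rw [mem_Icc, not_and_or, not_le, not_le] at hx
    rcases hx with hx | hx
    · have : Real.smoothTransition =ᶠ[𝓝 x] fun _ => 0 := by
        filter_upwards [Iio_mem_nhds hx] with y hy
        exact Real.smoothTransition.zero_of_nonpos (le_of_lt hy)
      rw [this.deriv_eq, deriv_const]
    · have : Real.smoothTransition =ᶠ[𝓝 x] fun _ => 1 := by
        filter_upwards [Ioi_mem_nhds hx] with y hy
        exact Real.smoothTransition.one_of_one_le (le_of_lt hy)
      rw [this.deriv_eq, deriv_const]
  obtain ⟨x₀, -, h⟩ := (isCompact_Icc (a := (0 : ℝ)) (b := 1)).exists_isMaxOn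
    (nonempty_Icc.2 zero_le_one) hcont.abs.continuousOn
  refine ⟨|deriv Real.smoothTransition x₀|, abs_nonneg _, fun x => ?_, hout⟩
  by_cases hx : x ∈ Icc (0 : ℝ) 1
  · exact h hx
  · rw [hout x hx, abs_zero]; exact abs_nonneg _

/-- A set of indices on which a sequence with gaps at least `c` stays in an interval of length `1`
has at most `1 / c + 1` elements. -/
theorem card_le_of_gaps {b : ℕ → ℝ} {c : ℝ} (hc : 0 < c)
    (hb : ∀ k m : ℕ, k ≤ m → b k + ((m : ℝ) - k) * c ≤ b m) {A : Finset ℕ} {v : ℝ}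
    (hA : ∀ k ∈ A, 0 ≤ v - b k ∧ v - b k ≤ 1) : (A.card : ℝ) ≤ 1 / c + 1 := by
  rcases A.eq_empty_or_nonempty with rfl | hne
  · simp; positivity
  have h1 : A ⊆ Finset.Icc (A.min' hne) (A.max' hne) := fun k hk =>
    Finset.mem_Icc.2 ⟨A.min'_le k hk, A.le_max' k hk⟩
  have h2 := Finset.card_le_card h1
  rw [Nat.card_Icc] at h2
  have hmm : A.min' hne ≤ A.max' hne := A.min'_le _ (A.max'_mem hne)
  have h3 := hb _ _ hmm
  have h4 := hA _ (A.min'_mem hne)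
  have h5 := hA _ (A.max'_mem hne)
  have h6 : ((A.max' hne : ℝ) - A.min' hne) * c ≤ 1 := by linarith
  have h7 : (A.max' hne : ℝ) - A.min' hne ≤ 1 / c := by rwa [le_div_iff₀ hc]
  have h8 : (A.card : ℝ) ≤ (A.max' hne : ℝ) - A.min' hne + 1 := by
    have : A.card + A.min' hne ≤ A.max' hne + 1 := by omega
    have : (A.card : ℝ) + A.min' hne ≤ A.max' hne + 1 := by exact_mod_cast this
    linarith
  linarith

namespace IsRoof

variable {α : Fin 4 → ℝ} {φ : Torus4 → ℝ} {dφ : Fin 4 → UnitAddCircle → ℝ} {c Φ : ℝ}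
  (h : IsRoof φ dφ c Φ)
include h

theorem pos' : 0 < Φ := h.pos.trans_le ((h.le 0).trans (h.ge 0))

theorem hasDirDeriv_birkhoff (j : Fin 4) (N : ℕ) :
    HasDirDeriv j (birkhoff α φ N) fun x => derivSum α dφ j N (x j) :=
  HasDirDeriv.sum (Finset.range N) fun l _ => (h.deriv j).comp_add (l • proj α)

omit h in
theorem continuous_derivSum (hd : ∀ j, Continuous (dφ j)) (j : Fin 4) (N : ℕ) :
    Continuous (derivSum α dφ j N) := by
  have := hd j
  unfold derivSum
  fun_prop

/-- The return count is a natural number comparable with the time. -/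
theorem exists_nat_deck_mem (x : Torus4) {u : ℝ} (hu : 0 ≤ u) :
    ∃ N : ℕ, deck α φ N (x, u) ∈ phase φ ∧ N * c ≤ u ∧ u < (N + 1) * Φ := by
  obtain ⟨n, ⟨h1, h2⟩, -⟩ := existsUnique_deck_mem (α := α) h.pos h.le (x, u)
  have h2' : u < birkhoff α φ (n + 1) x := by
    rw [birkhoff_succ]
    simp only [deck] at h2
    linarith
  have hn : 0 ≤ n := by
    by_contra hneg
    have h3 := birkhoff_le_of_le (α := α) h.le (show n + 1 ≤ 0 by omega) x
    rw [birkhoff_zero] at h3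
    have h4 : ((n + 1 : ℤ) : ℝ) ≤ 0 := by exact_mod_cast (show n + 1 ≤ 0 by omega)
    have : 0 ≤ (((0 : ℤ) : ℝ) - ((n + 1 : ℤ) : ℝ)) * c :=
      mul_nonneg (by push_cast at h4 ⊢; linarith) h.pos.le
    linarith
  lift n to ℕ using hn
  refine ⟨n, ⟨h1, h2⟩, ?_, ?_⟩
  · have h3 := birkhoff_le_of_le (α := α) h.le (Int.natCast_nonneg n) x
    rw [birkhoff_zero] at h3
    simp only [deck] at h1
    push_cast at h3
    linarith
  · have h3 := birkhoff_le_of_le' (α := α) h.ge (show (0 : ℤ) ≤ (n : ℤ) + 1 by omega) x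
    rw [birkhoff_zero] at h3
    push_cast at h3
    linarith

theorem birkhoff_gaps (x : Torus4) (k m : ℕ) (hkm : k ≤ m) :
    birkhoff α φ ((k + 1 : ℕ) : ℤ) x + ((m : ℝ) - k) * c ≤ birkhoff α φ ((m + 1 : ℕ) : ℤ) x := by
  have := birkhoff_le_of_le (α := α) h.le (show ((k + 1 : ℕ) : ℤ) ≤ ((m + 1 : ℕ) : ℤ) by omega) x
  push_cast at this ⊢
  linarith

/-- The smoothed count differs from the count by a bounded amount, since only boundedly many
Birkhoff sums lie in an interval of length `1`. -/
theorem abs_smoothCount_sub_le {x : Torus4} {u : ℝ} {N K : ℕ} (hN : deck α φ N (x, u) ∈ phase φ)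
    (hK : N ≤ K) : |smoothCount α φ K u x - N| ≤ 1 / c + 1 := by
  classical
  obtain ⟨h1, h2⟩ := hN
  simp only [deck] at h1 h2
  set A := (Finset.range K).filter fun k =>
    0 ≤ u - birkhoff α φ ((k + 1 : ℕ) : ℤ) x ∧ u - birkhoff α φ ((k + 1 : ℕ) : ℤ) x ≤ 1 with hA
  have hNsum : (N : ℝ) = ∑ k ∈ Finset.range K, if k < N then (1 : ℝ) else 0 := by
    rw [← Finset.sum_filter, Finset.sum_const, nsmul_one]
    congr 1
    have : (Finset.range K).filter (fun k => k < N) = Finset.range N := by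
      ext k; simp only [Finset.mem_filter, Finset.mem_range]; omega
    rw [this, Finset.card_range]
  have hcard : (A.card : ℝ) ≤ 1 / c + 1 :=
    card_le_of_gaps h.pos (h.birkhoff_gaps (α := α) x) (v := u) fun k hk => (Finset.mem_filter.1 hk).2
  have hterm : ∀ k ∈ Finset.range K,
      |Real.smoothTransition (u - birkhoff α φ ((k + 1 : ℕ) : ℤ) x) - if k < N then (1 : ℝ) else 0| ≤
        if 0 ≤ u - birkhoff α φ ((k + 1 : ℕ) : ℤ) x ∧ u - birkhoff α φ ((k + 1 : ℕ) : ℤ) x ≤ 1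
          then 1 else 0 := by
    intro k _
    by_cases hk : k < N
    · have h3 := birkhoff_le_of_le (α := α) h.le (show ((k + 1 : ℕ) : ℤ) ≤ N by omega) x
      have h4 : (0 : ℝ) ≤ (((N : ℕ) : ℤ) : ℝ) - (((k + 1 : ℕ) : ℤ) : ℝ) := by
        have : k + 1 ≤ N := hk
        have : ((k + 1 : ℕ) : ℝ) ≤ N := by exact_mod_cast this
        push_cast at this ⊢; linarith
      have h5 := mul_nonneg h4 h.pos.le
      have h6 : 0 ≤ u - birkhoff α φ ((k + 1 : ℕ) : ℤ) x := by linarith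
      rw [if_pos hk]
      by_cases h7 : u - birkhoff α φ ((k + 1 : ℕ) : ℤ) x ≤ 1
      · rw [if_pos ⟨h6, h7⟩, abs_le]
        constructor <;> linarith [Real.smoothTransition.nonneg (u - birkhoff α φ ((k + 1 : ℕ) : ℤ) x),
          Real.smoothTransition.le_one (u - birkhoff α φ ((k + 1 : ℕ) : ℤ) x)]
      · rw [Real.smoothTransition.one_of_one_le (not_le.1 h7).le, sub_self, abs_zero]
        split_ifs <;> norm_num
    · have h3 := birkhoff_le_of_le (α := α) h.le (show (N : ℤ) + 1 ≤ ((k + 1 : ℕ) : ℤ) by omega) x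
      have h4 : (0 : ℝ) ≤ (((k + 1 : ℕ) : ℤ) : ℝ) - (((N : ℤ) + 1 : ℤ) : ℝ) := by
        have : N + 1 ≤ k + 1 := by omega
        have : ((N + 1 : ℕ) : ℝ) ≤ ((k + 1 : ℕ) : ℝ) := by exact_mod_cast this
        push_cast at this ⊢; linarith
      have h5 := mul_nonneg h4 h.pos.le
      rw [birkhoff_succ] at h3
      rw [if_neg hk, Real.smoothTransition.zero_of_nonpos (by linarith), sub_self, abs_zero]
      split_ifs <;> norm_num
  rw [smoothCount, hNsum, ← Finset.sum_sub_distrib]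
  refine (Finset.abs_sum_le_sum_abs _ _).trans ((Finset.sum_le_sum hterm).trans ?_)
  rw [← Finset.sum_filter, Finset.sum_const, nsmul_one]
  exact hcard

theorem continuous_smoothCount (K : ℕ) (u : ℝ) : Continuous (smoothCount α φ K u) :=
  continuous_finsetSum _ fun _ _ => Real.smoothTransition.continuous.comp
    (continuous_const.sub (continuous_birkhoff h.cont _))

/-- The smoothed count is differentiable, and its derivative is controlled by those of the
Birkhoff sums since only boundedly many terms are not locally constant. -/
theorem exists_smoothCount_deriv {B : ℝ} (hB0 : ∀ x, |_root_.deriv Real.smoothTransition x| ≤ B)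
    (hB1 : ∀ x, x ∉ Icc (0 : ℝ) 1 → _root_.deriv Real.smoothTransition x = 0)
    (j : Fin 4) (K : ℕ) (u : ℝ) {D : ℝ} (hD0 : 0 ≤ D)
    (hD : ∀ k ≤ K, ∀ y, |derivSum α dφ j k y| ≤ D) :
    ∃ ν' : Torus4 → ℝ, Continuous ν' ∧ HasDirDeriv j (smoothCount α φ K u) ν' ∧
      ∀ x, |ν' x| ≤ (1 / c + 1) * (B * D) := by
  classical
  have hstd : Continuous (_root_.deriv Real.smoothTransition) :=
    (Real.smoothTransition.contDiff (n := 1)).continuous_deriv le_rfl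
  have hB : 0 ≤ B := (abs_nonneg _).trans (hB0 0)
  refine ⟨fun x => ∑ k ∈ Finset.range K,
    _root_.deriv Real.smoothTransition (u - birkhoff α φ ((k + 1 : ℕ) : ℤ) x) *
      (-derivSum α dφ j (k + 1) (x j)), ?_, ?_, ?_⟩
  · refine continuous_finsetSum _ fun k _ => ?_
    refine (hstd.comp (continuous_const.sub (continuous_birkhoff h.cont _))).mul ?_
    exact ((continuous_derivSum h.dcont j (k + 1)).comp (continuous_apply j)).neg
  · refine HasDirDeriv.sum _ fun k _ x => ?_
    have h1 : HasDerivAt Real.smoothTransition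
        (_root_.deriv Real.smoothTransition (u - birkhoff α φ ((k + 1 : ℕ) : ℤ) x))
        (u - birkhoff α φ ((k + 1 : ℕ) : ℤ) (x + dirShift j 0)) := by
      rw [dirShift_zero, add_zero]
      exact ((Real.smoothTransition.contDiff (n := 1)).differentiable one_ne_zero _).hasDerivAt
    have h2 := ((h.hasDirDeriv_birkhoff (α := α) j (k + 1)) x).const_sub u
    exact h1.comp (0 : ℝ) h2
  · intro x
    have hcard : ((((Finset.range K).filter fun k =>
        0 ≤ u - birkhoff α φ ((k + 1 : ℕ) : ℤ) x ∧
          u - birkhoff α φ ((k + 1 : ℕ) : ℤ) x ≤ 1).card : ℕ) : ℝ) ≤ 1 / c + 1 :=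
      card_le_of_gaps h.pos (h.birkhoff_gaps (α := α) x) (v := u)
        fun k hk => (Finset.mem_filter.1 hk).2
    refine (Finset.abs_sum_le_sum_abs _ _).trans ?_
    calc _ ≤ ∑ k ∈ Finset.range K, if 0 ≤ u - birkhoff α φ ((k + 1 : ℕ) : ℤ) x ∧
          u - birkhoff α φ ((k + 1 : ℕ) : ℤ) x ≤ 1 then B * D else 0 := by
          refine Finset.sum_le_sum fun k hk => ?_
          rw [abs_mul, abs_neg]
          split_ifs with hcond
          · exact mul_le_mul (hB0 _) (hD _ (Finset.mem_range.1 hk) _) (abs_nonneg _) hB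
          · rw [hB1 _ hcond, abs_zero, zero_mul]
      _ ≤ _ := by
          rw [← Finset.sum_filter, Finset.sum_const, nsmul_eq_mul]
          gcongr

end IsRoof

/-! ### The decay estimate on horizontal slices -/

/-- The pull-backs `F`, `Ψ` to `𝕋⁴ × ℝ` of a coboundary and of its transfer function, with the
partial derivatives `Ψ' j` of `Ψ`. The relation `rel` comes from differentiating the invariance of
`Ψ` under the deck transformations; the derivative of the Birkhoff sum appears with the factor `F`
because `F` is the vertical derivative of `Ψ`. -/
structure IsCoverPair (α : Fin 4 → ℝ) (φ : Torus4 → ℝ) (dφ : Fin 4 → UnitAddCircle → ℝ)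
    (F Ψ : Torus4 × ℝ → ℝ) (Ψ' : Fin 4 → Torus4 × ℝ → ℝ) (B₀ : ℝ) (B₁ : Fin 4 → ℝ) : Prop where
  contF : Continuous F
  contΨ : Continuous Ψ
  contΨ' : ∀ j, Continuous (Ψ' j)
  deriv : ∀ j u, HasDirDeriv j (fun x => Ψ (x, u)) fun x => Ψ' j (x, u)
  boundF : ∀ z, |F z| ≤ B₀
  boundΨ : ∀ z, |Ψ z| ≤ B₀
  boundΨ' : ∀ j, ∀ z ∈ phase φ, |Ψ' j z| ≤ B₁ j
  rel : ∀ j (N : ℕ) x u, Ψ' j (x, u) =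
    Ψ' j (deck α φ N (x, u)) - derivSum α dφ j N (x j) * F (x, u)

/-- The direction `j` is resonant at the scale `q`: up to an error `O(q)`, the derivatives of the
Birkhoff sums of length at most `L` are those of the single mode `q`. -/
def IsResonant (α : Fin 4 → ℝ) (dφ : Fin 4 → UnitAddCircle → ℝ) (C L : ℝ) (j : Fin 4)
    (q : ℕ) : Prop :=
  ∀ N : ℕ, N ≤ L → ∀ y : UnitAddCircle,
    |derivSum α dφ j N y + 2 * Real.pi * q / Real.exp q * N * sinMode q y| ≤ C * q

/-- The arithmetic of the error terms in `exists_abs_integral_le_of_isResonant`. -/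
theorem resonance_error_le {c Φ B Cr A κ q η u B₀ b₁ g₀ g₁ M : ℝ} (hc : 0 < c) (hΦ : 0 < Φ)
    (hB : 0 ≤ B) (hCr : 0 ≤ Cr) (hA : 0 ≤ A) (hκ1 : κ ≤ 2 * Real.pi) (hq1 : 1 ≤ q)
    (hη : 0 < η) (hu1 : 1 ≤ u) (hB₀ : 0 ≤ B₀) (hB₁ : 0 ≤ b₁) (hg₀0 : 0 ≤ g₀) (hg₁0 : 0 ≤ g₁)
    (hM : B₀ * (g₀ + g₁) + b₁ * g₀ ≤ M) :
    (b₁ + (Cr * q + κ * A) * B₀) * (g₀ * (1 / (2 * η))) +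
      B₀ * ((g₁ / 2 + Real.pi ^ 2 * q * g₀) / η + g₀ * (1 / (2 * η)) *
        (A * (B * (κ * (2 / c * u) + Cr * q))) / (u / (2 * Φ))) ≤
      q / η * ((1 + (Cr + 2 * Real.pi * A) / 2 + Real.pi ^ 2 +
        B * A * Φ * (4 * Real.pi / c + Cr)) * M) := by
  have hpi := Real.pi_pos
  have hu0 : 0 < u := by linarith
  have hS1 : 0 ≤ (Cr + 2 * Real.pi * A) / 2 := by positivity
  set S := B * A * Φ * (4 * Real.pi / c + Cr) with hS
  have hS2 : 0 ≤ S := by positivity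
  have hCrA : Cr * q + κ * A ≤ q * (Cr + 2 * Real.pi * A) := by
    have : κ * A ≤ q * (2 * Real.pi * A) := by
      calc κ * A ≤ 2 * Real.pi * A := by gcongr
        _ ≤ _ := le_mul_of_one_le_left (by positivity) hq1
    linarith
  have hν₁ : A * (B * (κ * (2 / c * u) + Cr * q)) / (u / (2 * Φ)) ≤ 2 * q * S := by
    rw [div_le_iff₀ (by positivity)]
    have h1 : κ * (2 / c * u) + Cr * q ≤ q * u * (4 * Real.pi / c + Cr) := by
      have h2 : κ * (2 / c * u) ≤ q * u * (4 * Real.pi / c) := by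
        calc κ * (2 / c * u) ≤ 2 * Real.pi * (2 / c * u) := by gcongr
          _ = 1 * (u * (4 * Real.pi / c)) := by ring
          _ ≤ q * (u * (4 * Real.pi / c)) := by gcongr
          _ = _ := by ring
      have h3 : Cr * q ≤ q * u * Cr := by
        calc Cr * q = q * 1 * Cr := by ring
          _ ≤ _ := by gcongr
      linarith
    calc _ ≤ A * (B * (q * u * (4 * Real.pi / c + Cr))) := by gcongr
      _ = _ := by rw [hS]; field_simp
  have e1 : (b₁ + (Cr * q + κ * A) * B₀) * (g₀ * (1 / (2 * η))) ≤
      q / η * (((Cr + 2 * Real.pi * A) / 2) * (B₀ * g₀) + b₁ * g₀) := by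
    calc _ ≤ (q * (2 * b₁) + q * (Cr + 2 * Real.pi * A) * B₀) * (g₀ * (1 / (2 * η))) := by
          gcongr
          nlinarith
      _ = _ := by field_simp; ring
  have e2 : (g₁ / 2 + Real.pi ^ 2 * q * g₀) / η ≤ q / η * (g₁ + Real.pi ^ 2 * g₀) := by
    calc _ ≤ (q * g₁ + Real.pi ^ 2 * q * g₀) / η := by
          gcongr
          nlinarith
      _ = _ := by ring
  have e3 : g₀ * (1 / (2 * η)) * (A * (B * (κ * (2 / c * u) + Cr * q))) / (u / (2 * Φ))
      ≤ q / η * (g₀ * S) := by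
    rw [mul_div_assoc]
    calc _ ≤ g₀ * (1 / (2 * η)) * (2 * q * S) := by gcongr
      _ = _ := by field_simp
  have e5 : ((Cr + 2 * Real.pi * A) / 2) * (B₀ * g₀) + b₁ * g₀ +
      B₀ * (g₁ + Real.pi ^ 2 * g₀ + g₀ * S) ≤
      (1 + (Cr + 2 * Real.pi * A) / 2 + Real.pi ^ 2 + S) * M := by
    have hx : 0 ≤ B₀ * g₀ := by positivity
    have hy : 0 ≤ B₀ * g₁ := by positivity
    have hz : 0 ≤ b₁ * g₀ := by positivity
    have hS3 : 0 ≤ Real.pi ^ 2 := by positivity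
    calc _ ≤ (1 + (Cr + 2 * Real.pi * A) / 2 + Real.pi ^ 2 + S) * (B₀ * (g₀ + g₁) + b₁ * g₀) := by
          nlinarith [mul_nonneg hS1 hy, mul_nonneg hS1 hz, mul_nonneg hS2 hy, mul_nonneg hS2 hz,
            mul_nonneg hS3 hy, mul_nonneg hS3 hz]
      _ ≤ _ := by gcongr
  calc _ ≤ q / η * (((Cr + 2 * Real.pi * A) / 2) * (B₀ * g₀) + b₁ * g₀) +
        B₀ * (q / η * (g₁ + Real.pi ^ 2 * g₀) + q / η * (g₀ * S)) := by gcongr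
    _ = q / η * (((Cr + 2 * Real.pi * A) / 2) * (B₀ * g₀) + b₁ * g₀ +
        B₀ * (g₁ + Real.pi ^ 2 * g₀ + g₀ * S)) := by ring
    _ ≤ _ := by gcongr

section Core

variable {α : Fin 4 → ℝ} {φ : Torus4 → ℝ} {dφ : Fin 4 → UnitAddCircle → ℝ} {c Φ : ℝ}

/-- The gain from one resonant direction `j`: on the part of the torus where the mode
`sin (2π q x_j)` is not small, integration by parts gains the time `u`, up to a factor `e^q / η`. The
factor `m` is a cutoff not depending on the coordinate `j`, so that it costs no derivative. -/
theorem exists_abs_integral_le_of_isResonant (h : IsRoof φ dφ c Φ) {Cr : ℝ} (hCr : 0 ≤ Cr) :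
    ∃ C T₀ : ℝ, 0 ≤ C ∧ ∀ (F Ψ : Torus4 × ℝ → ℝ) (Ψ' : Fin 4 → Torus4 × ℝ → ℝ) (B₀ : ℝ)
      (B₁ : Fin 4 → ℝ), IsCoverPair α φ dφ F Ψ Ψ' B₀ B₁ →
      ∀ (j : Fin 4) (G G' m : Torus4 → ℝ) (g₀ g₁ M : ℝ), Continuous G → Continuous G' →
      HasDirDeriv j G G' → (∀ x, |G x| ≤ g₀) → (∀ x, |G' x| ≤ g₁) →
      B₀ * (g₀ + g₁) + B₁ j * g₀ ≤ M →
      Continuous m → (∀ x, 0 ≤ m x) → (∀ x, m x ≤ 1) → HasDirDeriv j m (fun _ => 0) →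
      ∀ (q : ℕ) (η u : ℝ), 1 ≤ q → 0 < η → T₀ ≤ u →
      IsResonant α dφ Cr (2 / c * u) j q →
      |∫ x, F (x, u) * sinMode q (x j) * (G x * m x * resWeight η q (x j))| ≤
        C * M * (Real.exp q / (u * η)) := by
  obtain ⟨B, hB, hB0, hB1⟩ := exists_deriv_smoothTransition_bound
  have hc := h.pos
  have hΦ := h.pos'
  have hpi := Real.pi_pos
  set A : ℝ := 1 / c + 1 with hA
  have hA0 : 0 < A := by positivity
  set C' : ℝ := 1 + (Cr + 2 * Real.pi * A) / 2 + Real.pi ^ 2 +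
    B * A * Φ * (4 * Real.pi / c + Cr) with hC'
  have hC'0 : 0 ≤ C' := by positivity
  refine ⟨C' * Φ / Real.pi, max (max 1 c) (2 * Φ * (1 + A)), by positivity, ?_⟩
  intro F Ψ Ψ' B₀ B₁ hP j G G' m g₀ g₁ M hG hG' dG hg₀ hg₁ hM hm hm0 hm1 dm q η u hq hη hu hres
  have hu1 : 1 ≤ u := (le_max_left _ _).trans ((le_max_left _ _).trans hu)
  have huc : c ≤ u := (le_max_right _ _).trans ((le_max_left _ _).trans hu)
  have huΦ : 2 * Φ * (1 + A) ≤ u := (le_max_right _ _).trans hu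
  have hu0 : 0 < u := by linarith
  have hq1 : (1 : ℝ) ≤ q := by exact_mod_cast hq
  have hB₀ : 0 ≤ B₀ := (abs_nonneg _).trans (hP.boundF (0, 0))
  have hB₁ : 0 ≤ B₁ j := (abs_nonneg _).trans (hP.boundΨ' j (0, 0)
    ⟨le_rfl, hc.trans_le (h.le 0)⟩)
  have hg₀0 : 0 ≤ g₀ := (abs_nonneg _).trans (hg₀ 0)
  have hg₁0 : 0 ≤ g₁ := (abs_nonneg _).trans (hg₁ 0)
  set κ : ℝ := 2 * Real.pi * q / Real.exp q with hκ
  have hκ0 : 0 < κ := by positivity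
  have hκ1 : κ ≤ 2 * Real.pi := by
    rw [hκ, div_le_iff₀ (Real.exp_pos _)]
    have := Real.add_one_le_exp (q : ℝ)
    gcongr; linarith
  set K : ℕ := ⌊u / c⌋₊ + 1 with hK
  have hKl : u < K * c := by
    rw [← div_lt_iff₀ hc, hK]; push_cast; exact Nat.lt_floor_add_one _
  have hKu : (K : ℝ) ≤ 2 / c * u := by
    rw [hK]; push_cast
    have h1 := Nat.floor_le (show 0 ≤ u / c by positivity)
    have h2 : 1 ≤ u / c := by rwa [le_div_iff₀ hc, one_mul]
    have : 2 / c * u = u / c + u / c := by ring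
    linarith
  set ν := smoothCount α φ K u with hν
  -- the bound on the derivatives of the Birkhoff sums up to time `K`
  have hD : ∀ k ≤ K, ∀ y, |derivSum α dφ j k y| ≤ κ * (2 / c * u) + Cr * q := by
    intro k hk y
    have hk' : (k : ℝ) ≤ 2 / c * u := le_trans (by exact_mod_cast hk) hKu
    have h1 := hres k hk' y
    have h2 : |κ * k * sinMode q y| ≤ κ * (2 / c * u) := by
      rw [abs_mul, abs_of_nonneg (by positivity : 0 ≤ κ * (k : ℝ))]
      calc _ ≤ κ * k * 1 := by gcongr; exact abs_sinMode_le _ _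
        _ ≤ _ := by rw [mul_one]; gcongr
    have h3 : derivSum α dφ j k y =
        (derivSum α dφ j k y + κ * k * sinMode q y) - κ * k * sinMode q y := by ring
    rw [h3]
    exact (abs_sub _ _).trans (by linarith)
  obtain ⟨ν', hν'c, dν, hν'⟩ := h.exists_smoothCount_deriv (α := α) hB0 hB1 j K u
    (by positivity) hD
  have hcount : ∀ x, ∃ N : ℕ, deck α φ N (x, u) ∈ phase φ ∧ (N : ℝ) ≤ 2 / c * u ∧
      |ν x - N| ≤ A ∧ u < (N + 1) * Φ := by
    intro x
    obtain ⟨N, hN, h1, h2⟩ := h.exists_nat_deck_mem (α := α) x hu0.le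
    have hNK : N ≤ K := by
      have : (N : ℝ) * c < K * c := h1.trans_lt hKl
      have := lt_of_mul_lt_mul_right this hc.le
      exact_mod_cast this.le
    exact ⟨N, hN, le_trans (by exact_mod_cast hNK) hKu, h.abs_smoothCount_sub_le hN hNK, h2⟩
  -- the count grows linearly with the time
  have hνl : ∀ x, u / (2 * Φ) ≤ ν x := by
    intro x
    obtain ⟨N, -, -, h1, h2⟩ := hcount x
    have h3 : u / Φ < N + 1 := by rwa [div_lt_iff₀ hΦ]
    have h4 : 1 + A ≤ u / (2 * Φ) := by rw [le_div_iff₀ (by positivity)]; linarith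
    have h5 : u / Φ = u / (2 * Φ) + u / (2 * Φ) := by field_simp; norm_num
    have := (abs_le.1 h1).1
    linarith
  -- the resonance: `Ψ' = κ ν σ F` up to a bounded error
  have hR : ∀ x, |κ * ν x * sinMode q (x j) * F (x, u) - Ψ' j (x, u)| ≤
      B₁ j + (Cr * q + κ * A) * B₀ := by
    intro x
    obtain ⟨N, hN, hNL, h1, -⟩ := hcount x
    have h2 := hres N hNL (x j)
    rw [hP.rel j N x u]
    have h3 : κ * ν x * sinMode q (x j) * F (x, u) -
        (Ψ' j (deck α φ N (x, u)) - derivSum α dφ j N (x j) * F (x, u)) =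
        ((derivSum α dφ j N (x j) + κ * N * sinMode q (x j)) +
          κ * ((ν x - N) * sinMode q (x j))) * F (x, u) - Ψ' j (deck α φ N (x, u)) := by ring
    rw [h3]
    refine (abs_sub _ _).trans ?_
    rw [add_comm, abs_mul]
    refine add_le_add (hP.boundΨ' j _ hN) ?_
    refine mul_le_mul ((abs_add_le _ _).trans (add_le_add h2 ?_)) (hP.boundF _) (abs_nonneg _)
      (by positivity)
    rw [abs_mul, abs_of_pos hκ0, abs_mul]
    calc _ ≤ κ * (A * 1) := by
          gcongr; exact abs_sinMode_le _ _
      _ = _ := by rw [mul_one]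
  have hp := integral_resBump_coord_le hη q (by omega) j
  have hwc : Continuous fun x : Torus4 => resWeight η q (x j) :=
    (continuous_resWeight hη q).comp (continuous_apply j)
  have hwc' : Continuous fun x : Torus4 => resWeightDeriv η q (x j) :=
    (continuous_resWeightDeriv hη q).comp (continuous_apply j)
  have hpc : Continuous fun x : Torus4 => resBump η q (x j) :=
    (continuous_resBump hη q).comp (continuous_apply j)
  have dw := hasDirDeriv_coord (hasDerivAt_resWeight hη q) j
  have dW := (dG.mul dm).mul dw
  have hGm : ∀ x, |G x * m x| ≤ g₀ := fun x => by
    rw [abs_mul, abs_of_nonneg (hm0 x)]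
    exact (mul_le_of_le_one_right (abs_nonneg _) (hm1 x)).trans (hg₀ x)
  have hw₀ : ∀ x, |G x * m x * resWeight η q (x j)| ≤ g₀ * (1 / (2 * η)) := fun x => by
    rw [abs_mul]
    exact mul_le_mul (hGm x) (abs_resWeight_le hη q _) (abs_nonneg _) hg₀0
  have hWc' : Continuous fun x : Torus4 => (G' x * m x + G x * 0) * resWeight η q (x j) +
      G x * m x * resWeightDeriv η q (x j) := by fun_prop
  have hw₁ : ∫ x : Torus4, |(G' x * m x + G x * 0) * resWeight η q (x j) +
      G x * m x * resWeightDeriv η q (x j)| ≤ (g₁ / 2 + Real.pi ^ 2 * q * g₀) / η := by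
    have hpt : ∀ x : Torus4, |(G' x * m x + G x * 0) * resWeight η q (x j) +
        G x * m x * resWeightDeriv η q (x j)| ≤
        g₁ * (1 / (2 * η)) + g₀ * (2 * Real.pi * q / η ^ 2) * resBump η q (x j) := fun x => by
      refine (abs_add_le _ _).trans (add_le_add ?_ ?_)
      · rw [mul_zero, add_zero, abs_mul]
        refine mul_le_mul ?_ (abs_resWeight_le hη q _) (abs_nonneg _) hg₁0
        rw [abs_mul, abs_of_nonneg (hm0 x)]
        exact (mul_le_of_le_one_right (abs_nonneg _) (hm1 x)).trans (hg₁ x)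
      · rw [abs_mul, mul_assoc]
        exact mul_le_mul (hGm x) (abs_resWeightDeriv_le hη q _) (abs_nonneg _) hg₀0
    refine (integral_mono (continuous_integrable hWc'.abs)
      (continuous_integrable (by fun_prop)) hpt).trans ?_
    rw [integral_add (continuous_integrable (by fun_prop)) (continuous_integrable (by fun_prop)),
      integral_const_mul (g₀ * (2 * Real.pi * q / η ^ 2))]
    simp only [integral_const, smul_eq_mul, probReal_univ, one_mul]
    calc _ ≤ g₁ * (1 / (2 * η)) + g₀ * (2 * Real.pi * q / η ^ 2) * (Real.pi / 2 * η) := by gcongr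
      _ = _ := by field_simp
  have key := abs_integral_mul_le_of_resonance (j := j) (F := fun x => F (x, u))
    (Ψ := fun x => Ψ (x, u)) (Ψ' := fun x => Ψ' j (x, u)) (ν := ν) (ν' := ν')
    (σ := fun x => sinMode q (x j))
    (hP.contF.comp (by fun_prop)) (hP.contΨ.comp (by fun_prop)) ((hP.contΨ' j).comp (by fun_prop))
    (h.continuous_smoothCount K u) hν'c ((continuous_sinMode q).comp (continuous_apply j))
    (by fun_prop) hWc' (hP.deriv j u) dν dW hκ0 (by positivity) hνl hν' hR hw₀ hw₁
    (fun x => hP.boundΨ _)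
  refine key.trans ?_
  refine (div_le_div_of_nonneg_right (resonance_error_le hc hΦ hB hCr (A := A) hA0.le hκ1
    hq1 hη hu1 hB₀ hB₁ hg₀0 hg₁0 hM) (by positivity)).trans (le_of_eq ?_)
  rw [hκ, hC']
  field_simp

/-- Two resonant directions give a decay faster than `u ^ (-1/2)`. The function `1` is split into a
part divisible by the mode `q` of the direction `a`, a part divisible by the mode `q'` of the
direction `b`, and a part localized where both modes are small. One direction alone would leave a
set of mass `η` instead of `η²`, and a decay slower than `u ^ (-1/2)`. -/
theorem exists_abs_integral_le_rpow (h : IsRoof φ dφ c Φ) {Cr : ℝ} (hCr : 0 ≤ Cr)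
    (hres : ∃ T₁ : ℝ, ∀ u ≥ T₁, ∃ a b : Fin 4, a ≠ b ∧ ∃ q q' : ℕ,
      (1 ≤ q ∧ Real.exp (24 * q) ≤ u ∧ IsResonant α dφ Cr (2 / c * u) a q) ∧
      (1 ≤ q' ∧ Real.exp (24 * q') ≤ u ∧ IsResonant α dφ Cr (2 / c * u) b q')) :
    ∃ C T₀ : ℝ, 0 ≤ C ∧ 1 ≤ T₀ ∧ ∀ (F Ψ : Torus4 × ℝ → ℝ) (Ψ' : Fin 4 → Torus4 × ℝ → ℝ) (B₀ : ℝ)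
      (B₁ : Fin 4 → ℝ), IsCoverPair α φ dφ F Ψ Ψ' B₀ B₁ →
      ∀ (G : Torus4 → ℝ) (G' : Fin 4 → Torus4 → ℝ) (g₀ : ℝ) (g₁ : Fin 4 → ℝ) (M : ℝ),
      Continuous G → (∀ j, Continuous (G' j)) → (∀ j, HasDirDeriv j G (G' j)) →
      (∀ x, |G x| ≤ g₀) → (∀ j x, |G' j x| ≤ g₁ j) →
      (∀ j, B₀ * (g₀ + g₁ j) + B₁ j * g₀ ≤ M) →
      ∀ u ≥ T₀, |∫ x, F (x, u) * G x| ≤ C * M * u ^ (-5 / 8 : ℝ) := by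
  obtain ⟨C₁, T₂, hC₁, hdir⟩ := exists_abs_integral_le_of_isResonant (α := α) h hCr
  obtain ⟨T₁, hres⟩ := hres
  have hpi := Real.pi_pos
  refine ⟨2 * C₁ + (Real.pi / 2) ^ 2, max 1 (max T₁ T₂), by positivity, le_max_left _ _, ?_⟩
  intro F Ψ Ψ' B₀ B₁ hP G G' g₀ g₁ M hG hG' dG hg₀ hg₁ hM u hu
  have hu1 : 1 ≤ u := (le_max_left _ _).trans hu
  have hu0 : 0 < u := by linarith
  have huT₁ : T₁ ≤ u := (le_max_left _ _).trans ((le_max_right _ _).trans hu)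
  have huT₂ : T₂ ≤ u := (le_max_right _ _).trans ((le_max_right _ _).trans hu)
  have hB₀ : 0 ≤ B₀ := (abs_nonneg _).trans (hP.boundF (0, 0))
  have hg₀0 : 0 ≤ g₀ := (abs_nonneg _).trans (hg₀ 0)
  have hMB : B₀ * g₀ ≤ M := by
    have h1 := hM 0
    have h2 : 0 ≤ B₀ * g₁ 0 := mul_nonneg hB₀ ((abs_nonneg _).trans (hg₁ 0 0))
    have h3 : 0 ≤ B₁ 0 * g₀ := mul_nonneg ((abs_nonneg _).trans (hP.boundΨ' 0 (0, 0)
      ⟨le_rfl, h.pos.trans_le (h.le 0)⟩)) hg₀0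
    nlinarith
  have hM0 : 0 ≤ M := (mul_nonneg hB₀ hg₀0).trans hMB
  obtain ⟨a, b, hab, q, q', ⟨hq, hqu, hra⟩, ⟨hq', hqu', hrb⟩⟩ := hres u huT₁
  -- the width `η` nearly balances the gain `u ^ (1 / 24) / (u η)` of one integration by parts with
  -- the mass `η ^ 2` of the set where both modes are small: the two exponents are `-5 / 8`, `-2 / 3`
  set η : ℝ := u ^ (-1 / 3 : ℝ) with hη
  have hη0 : 0 < η := Real.rpow_pos_of_pos hu0 _
  have hexp : ∀ k : ℕ, Real.exp (24 * k) ≤ u → Real.exp k / (u * η) ≤ u ^ (-5 / 8 : ℝ) := by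
    intro k hk
    have h1 : Real.exp k ≤ u ^ (1 / 24 : ℝ) := by
      have h2 : Real.exp k = Real.exp (24 * k) ^ (1 / 24 : ℝ) := by
        rw [← Real.exp_mul]; congr 1; ring
      rw [h2]
      exact Real.rpow_le_rpow (Real.exp_pos _).le hk (by norm_num)
    rw [div_le_iff₀ (by positivity)]
    refine h1.trans (le_of_eq ?_)
    rw [hη, show u * u ^ (-1 / 3 : ℝ) = u ^ (1 : ℝ) * u ^ (-1 / 3 : ℝ) by rw [Real.rpow_one],
      ← Real.rpow_add hu0, ← Real.rpow_add hu0]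
    norm_num
  have hcoord (j : Fin 4) {k : UnitAddCircle → ℝ} (hk : Continuous k) :
      Continuous fun x : Torus4 => k (x j) := hk.comp (continuous_apply j)
  have hFc := hP.contF
  have hsa := hcoord a (continuous_sinMode q)
  have hsb := hcoord b (continuous_sinMode q')
  have hwa := hcoord a (continuous_resWeight hη0 q)
  have hwb := hcoord b (continuous_resWeight hη0 q')
  have hpa := hcoord a (continuous_resBump hη0 q)
  have hpb := hcoord b (continuous_resBump hη0 q')
  -- the partition `1 = σ_a w_a + p_a σ_b w_b + p_a p_b`
  have hsplit : ∀ x : Torus4, F (x, u) * G x =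
      F (x, u) * sinMode q (x a) * (G x * 1 * resWeight η q (x a)) +
      F (x, u) * sinMode q' (x b) * (G x * resBump η q (x a) * resWeight η q' (x b)) +
      F (x, u) * G x * (resBump η q (x a) * resBump η q' (x b)) := fun x => by
    have h1 := sinMode_mul_resWeight hη0 q (x a)
    have h2 := sinMode_mul_resWeight hη0 q' (x b)
    linear_combination (-F (x, u) * G x) * h1 - (F (x, u) * G x * resBump η q (x a)) * h2
  have hI1 := hdir F Ψ Ψ' B₀ B₁ hP a G (G' a) (fun _ => 1) g₀ (g₁ a) M hG (hG' a) (dG a) hg₀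
    (hg₁ a) (hM a) continuous_const (fun _ => zero_le_one) (fun _ => le_rfl)
    (fun x => hasDerivAt_const _ _) q η u hq hη0 huT₂ hra
  have hI2 := hdir F Ψ Ψ' B₀ B₁ hP b G (G' b) (fun x => resBump η q (x a)) g₀ (g₁ b) M hG (hG' b)
    (dG b) hg₀ (hg₁ b) (hM b) hpa (fun x => resBump_nonneg hη0 q _) (fun x => resBump_le_one hη0 q _)
    (hasDirDeriv_coord_of_ne _ hab) q' η u hq' hη0 huT₂ hrb
  have hI3 : |∫ x : Torus4, F (x, u) * G x * (resBump η q (x a) * resBump η q' (x b))| ≤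
      M * (Real.pi / 2 * η) ^ 2 := by
    refine abs_integral_le_integral_abs.trans ?_
    have hpt : ∀ x : Torus4, |F (x, u) * G x * (resBump η q (x a) * resBump η q' (x b))| ≤
        M * (resBump η q (x a) * resBump η q' (x b)) := fun x => by
      have h1 := mul_nonneg (resBump_nonneg hη0 q (x a)) (resBump_nonneg hη0 q' (x b))
      rw [abs_mul, abs_of_nonneg h1, abs_mul]
      gcongr
      exact (mul_le_mul (hP.boundF _) (hg₀ x) (abs_nonneg _) hB₀).trans hMB
    refine (integral_mono (continuous_integrable (Continuous.abs (by fun_prop)))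
      (continuous_integrable (by fun_prop)) hpt).trans ?_
    rw [integral_const_mul]
    gcongr
    exact integral_resBump_mul_resBump_le hη0 q (by omega) (by omega) hab
  have hη2 : η ^ 2 ≤ u ^ (-5 / 8 : ℝ) := by
    rw [hη, ← Real.rpow_natCast, ← Real.rpow_mul hu0.le]
    exact Real.rpow_le_rpow_of_exponent_le hu1 (by norm_num)
  rw [show (fun x => F (x, u) * G x) = _ from funext hsplit]
  rw [integral_add (continuous_integrable (by fun_prop)) (continuous_integrable (by fun_prop)),
    integral_add (continuous_integrable (by fun_prop)) (continuous_integrable (by fun_prop))]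
  refine (abs_add_le _ _).trans ((add_le_add ((abs_add_le _ _).trans (add_le_add hI1 hI2)) hI3).trans ?_)
  calc _ ≤ C₁ * M * u ^ (-5 / 8 : ℝ) + C₁ * M * u ^ (-5 / 8 : ℝ) +
        M * ((Real.pi / 2) ^ 2 * u ^ (-5 / 8 : ℝ)) := by
        rw [mul_pow]
        gcongr
        · exact hexp q hqu
        · exact hexp q' hqu'
    _ = _ := by ring

end Core

/-! ### The ceiling function -/

/-- The partial derivative of `ceiling α n₀` in the direction `j`, as a function of `x_j`. -/
def ceilingDeriv (α : Fin 4 → ℝ) (n₀ : ℕ) (j : Fin 4) : UnitAddCircle → ℝ :=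
  modeSumDeriv fun k => cfDenom (α j) (n₀ + k)

theorem ceiling_eq (α : Fin 4 → ℝ) (n₀ : ℕ) (x : Torus4) :
    ceiling α n₀ x = 1 + ∑ j, modeSum (fun k => cfDenom (α j) (n₀ + k)) (x j) := rfl

section

variable {α : Fin 4 → ℝ} (hα : α ∈ freqSet) (n₀ : ℕ)
include hα

theorem le_cfDenom_add (j : Fin 4) (k : ℕ) : k ≤ cfDenom (α j) (n₀ + k) :=
  (Nat.le_add_left k n₀).trans (le_cfDenom hα j _)

theorem continuous_ceiling : Continuous (ceiling α n₀) := by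
  have (j : Fin 4) := continuous_modeSum (le_cfDenom_add hα n₀ j)
  simp_rw [funext (ceiling_eq α n₀)]
  fun_prop

theorem exists_isRoof_ceiling (hpos : ∀ x, 0 < ceiling α n₀ x) :
    ∃ c Φ : ℝ, IsRoof (ceiling α n₀) (ceilingDeriv α n₀) c Φ := by
  have hcont := continuous_ceiling hα n₀
  obtain ⟨x₀, -, h₀⟩ := isCompact_univ.exists_isMinOn (univ_nonempty (α := Torus4)) hcont.continuousOn
  obtain ⟨x₁, -, h₁⟩ := isCompact_univ.exists_isMaxOn (univ_nonempty (α := Torus4)) hcont.continuousOn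
  refine ⟨ceiling α n₀ x₀, ceiling α n₀ x₁, hpos x₀, fun x => h₀ (mem_univ x),
    fun x => h₁ (mem_univ x), ?_, hcont,
    fun j => continuous_modeSumDeriv (le_cfDenom_add hα n₀ j), fun j => ?_, fun x => ?_⟩
  · simp_rw [ceiling_eq]
    refine contDiff_const.add (ContDiff.sum fun j _ => ?_)
    exact (contDiff_modeSum (le_cfDenom_add hα n₀ j)).comp (contDiff_apply ℝ ℝ j)
  · have h1 : HasDirDeriv j (fun x => ∑ i, modeSum (fun k => cfDenom (α i) (n₀ + k)) (x i))
        (fun x => ∑ i, if i = j then ceilingDeriv α n₀ j (x j) else 0) := by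
      refine HasDirDeriv.sum
        (K := fun i x => modeSum (fun k => cfDenom (α i) (n₀ + k)) (x i))
        (K' := fun i x => if i = j then ceilingDeriv α n₀ j (x j) else 0) _ fun i _ => ?_
      rcases eq_or_ne i j with rfl | hij
      · simp only [if_true]
        exact hasDirDeriv_coord (hasDerivAt_modeSum (le_cfDenom_add hα n₀ i)) i
      · simp only [if_neg hij]
        exact hasDirDeriv_coord_of_ne _ hij
    intro x
    have h2 := (h1 x).const_add 1
    simpa only [ceiling_eq, Finset.sum_ite_eq', Finset.mem_univ, if_true] using h2
  · simp_rw [ceiling_eq, Pi.neg_apply, modeSum_neg]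

/-- At every large time there are two resonant directions. -/
theorem exists_isResonant_pair (c : ℝ) :
    ∃ Cr : ℝ, 0 ≤ Cr ∧ ∃ T₁ : ℝ, ∀ u ≥ T₁, ∃ a b : Fin 4, a ≠ b ∧ ∃ q q' : ℕ,
      (1 ≤ q ∧ Real.exp (24 * q) ≤ u ∧ IsResonant α (ceilingDeriv α n₀) Cr (2 / c * u) a q) ∧
      (1 ≤ q' ∧ Real.exp (24 * q') ≤ u ∧
        IsResonant α (ceilingDeriv α n₀) Cr (2 / c * u) b q') := by
  have hbound (j : Fin 4) := exists_sum_modeSumDeriv_bound (hα.2.1 j) (hα.1 j).1 n₀ (le_cfDenom hα j)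
  choose C hC0 hC using hbound
  have hCle (j : Fin 4) : C j ≤ ∑ i, C i :=
    Finset.single_le_sum (fun i _ => hC0 i) (Finset.mem_univ j)
  obtain ⟨T₁, hT₁⟩ := exists_two_directions hα n₀ ((2 / c) ^ 2)
  have hres (j : Fin 4) (n : ℕ) (hn : n₀ ≤ n) {u : ℝ}
      (hu : (2 / c) ^ 2 * u ^ 2 ≤ cfDenom (α j) (n + 1)) :
      IsResonant α (ceilingDeriv α n₀) (∑ i, C i) (2 / c * u) j (cfDenom (α j) n) := by
    intro N hN y
    have h1 : N ^ 2 ≤ cfDenom (α j) (n + 1) := by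
      have : (N : ℝ) ^ 2 ≤ (2 / c * u) ^ 2 := by gcongr
      rw [mul_pow] at this
      exact_mod_cast this.trans hu
    refine (hC j n hn N h1 y).trans ?_
    gcongr
    exact hCle j
  refine ⟨∑ i, C i, Finset.sum_nonneg fun i _ => hC0 i, T₁, fun u hu => ?_⟩
  obtain ⟨a, b, hab, na, nb, hna, hnb, h1, h2, h3, h4⟩ := hT₁ u hu
  exact ⟨a, b, hab, _, _, ⟨cfDenom_pos _ _, h1, hres a na hna h2⟩,
    ⟨cfDenom_pos _ _, h3, hres b nb hnb h4⟩⟩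

end

/-! ### Lifts to Euclidean space and time reversal -/

/-- The projection `ℝ⁴ × ℝ → 𝕋⁴ × ℝ`. -/
def projProd (p : (Fin 4 → ℝ) × ℝ) : Torus4 × ℝ := (proj p.1, p.2)

theorem isOpenQuotientMap_proj : IsOpenQuotientMap proj :=
  IsOpenQuotientMap.piMap fun _ => QuotientAddGroup.isOpenQuotientMap_mk

theorem isOpenQuotientMap_projProd : IsOpenQuotientMap projProd :=
  isOpenQuotientMap_proj.prodMap IsOpenQuotientMap.id

theorem continuous_proj : Continuous proj := isOpenQuotientMap_proj.continuous

theorem partialBase_eq (j : Fin 4) (u : Torus4 × ℝ → ℝ) (x : Torus4) (s : ℝ) :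
    partialBase j u (x, s) = deriv (fun h : ℝ => u (x + dirShift j h, s)) 0 := rfl

section Lift

variable {H : Torus4 × ℝ → ℝ} (hH : ContDiff ℝ 1 fun p => H (projProd p))
include hH

theorem continuous_of_lift : Continuous H :=
  isOpenQuotientMap_projProd.continuous_comp_iff.1 hH.continuous

theorem hasDerivAt_lift (j : Fin 4) (x : Fin 4 → ℝ) (u : ℝ) :
    HasDerivAt (fun h : ℝ => H (proj x + dirShift j h, u))
      (fderiv ℝ (fun p => H (projProd p)) (x, u) (Pi.single j 1, 0)) 0 := by
  have h1 : HasFDerivAt (fun p => H (projProd p)) (fderiv ℝ (fun p => H (projProd p)) (x, u))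
      (x + (0 : ℝ) • Pi.single j 1, u) := by
    rw [zero_smul, add_zero]
    exact (hH.differentiable one_ne_zero _).hasFDerivAt
  have h2 : HasDerivAt (fun h : ℝ => (x + h • (Pi.single j 1 : Fin 4 → ℝ), u))
      ((Pi.single j 1 : Fin 4 → ℝ), (0 : ℝ)) 0 := by
    refine HasDerivAt.prodMk ?_ (hasDerivAt_const _ _)
    simpa using ((hasDerivAt_id (0 : ℝ)).smul_const (Pi.single j 1 : Fin 4 → ℝ)).const_add x
  refine (h1.comp_hasDerivAt (0 : ℝ) h2).congr_of_eventuallyEq (Eventually.of_forall fun h => ?_)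
  simp only [Function.comp_apply, projProd, proj_add]
  rw [← Pi.single_smul, smul_eq_mul, mul_one, proj_single]

theorem partialBase_lift (j : Fin 4) (p : (Fin 4 → ℝ) × ℝ) :
    partialBase j H (projProd p) = fderiv ℝ (fun p => H (projProd p)) p (Pi.single j 1, 0) :=
  (hasDerivAt_lift hH j p.1 p.2).deriv

theorem hasDirDeriv_lift (j : Fin 4) (u : ℝ) :
    HasDirDeriv j (fun x => H (x, u)) fun x => partialBase j H (x, u) := fun x => by
  obtain ⟨y, rfl⟩ := isOpenQuotientMap_proj.surjective x
  have h1 := hasDerivAt_lift hH j y u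
  rw [← partialBase_lift hH j (y, u)] at h1
  exact h1

theorem continuous_partialBase (j : Fin 4) : Continuous (partialBase j H) := by
  rw [← isOpenQuotientMap_projProd.continuous_comp_iff]
  have : partialBase j H ∘ projProd =
      fun p => fderiv ℝ (fun p => H (projProd p)) p (Pi.single j 1, 0) :=
    funext fun p => partialBase_lift hH j p
  rw [this]
  exact (hH.continuous_fderiv one_ne_zero).clm_apply continuous_const

end Lift

theorem HasDirDeriv.comp_sub_left {j : Fin 4} {K K' : Torus4 → ℝ} (hK : HasDirDeriv j K K')
    (a : Torus4) : HasDirDeriv j (fun x => K (a - x)) (fun x => -K' (a - x)) := fun x => by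
  have h1 := hK (a - x)
  rw [← neg_zero] at h1
  have h2 := h1.scomp (0 : ℝ) (hasDerivAt_neg (0 : ℝ))
  simp only [neg_smul, one_smul] at h2
  refine h2.congr_of_eventuallyEq (Eventually.of_forall fun h => ?_)
  have : dirShift j (-h) = -dirShift j h := by
    simp [dirShift, Pi.single_neg]
  simp only [Function.comp_apply, this]
  congr 1; abel

section Pair

variable {α : Fin 4 → ℝ} {φ : Torus4 → ℝ} {dφ : Fin 4 → UnitAddCircle → ℝ} {c Φ : ℝ}

/-- The partial derivative of an invariant function, transported by the deck transformations. -/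
theorem partialBase_deck_rel (h : IsRoof φ dφ c Φ) {F Ψ : Torus4 × ℝ → ℝ}
    (hΨ : ContDiff ℝ 1 fun p => Ψ (projProd p))
    (hd : ∀ x u, HasDerivAt (fun u => Ψ (x, u)) (F (x, u)) u)
    (hF : ∀ (N : ℕ) z, F (deck α φ N z) = F z) (hinv : ∀ (N : ℕ) z, Ψ (deck α φ N z) = Ψ z)
    (j : Fin 4) (N : ℕ) (x : Torus4) (u : ℝ) :
    partialBase j Ψ (x, u) =
      partialBase j Ψ (deck α φ N (x, u)) - derivSum α dφ j N (x j) * F (x, u) := by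
  obtain ⟨y, rfl⟩ := isOpenQuotientMap_proj.surjective x
  set L := fderiv ℝ (fun p => Ψ (projProd p)) (y + N • α, u - birkhoff α φ N (proj y)) with hL
  have hpN : proj (y + N • α) = proj y + N • proj α := by
    ext i; simp [proj]
  have hγ : HasDerivAt (fun s : ℝ => (y + N • α + s • (Pi.single j 1 : Fin 4 → ℝ),
      u - birkhoff α φ N (proj y + dirShift j s)))
      ((Pi.single j 1 : Fin 4 → ℝ), -derivSum α dφ j N (proj y j)) 0 := by
    refine HasDerivAt.prodMk ?_ ((h.hasDirDeriv_birkhoff (α := α) j N (proj y)).const_sub u)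
    simpa using ((hasDerivAt_id (0 : ℝ)).smul_const (Pi.single j 1 : Fin 4 → ℝ)).const_add (y + N • α)
  have h1 : HasFDerivAt (fun p => Ψ (projProd p)) L
      (y + N • α + (0 : ℝ) • (Pi.single j 1 : Fin 4 → ℝ),
        u - birkhoff α φ N (proj y + dirShift j 0)) := by
    rw [zero_smul, add_zero, dirShift_zero, add_zero]
    exact (hΨ.differentiable one_ne_zero _).hasFDerivAt
  have h2 : HasDerivAt (fun s : ℝ => Ψ (proj y + dirShift j s, u))
      (L ((Pi.single j 1 : Fin 4 → ℝ), -derivSum α dφ j N (proj y j))) 0 := by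
    refine (h1.comp_hasDerivAt (0 : ℝ) hγ).congr_of_eventuallyEq
      (Eventually.of_forall fun s => ?_)
    simp only [Function.comp_apply, projProd, proj_add, hpN]
    rw [← Pi.single_smul, smul_eq_mul, mul_one, proj_single, ← hinv N]
    simp only [deck, natCast_zsmul]
    congr 2; abel
  have h3 : L ((0 : Fin 4 → ℝ), (1 : ℝ)) = F (proj y, u) := by
    have h4 : HasDerivAt (fun s : ℝ => (y + N • α, s)) ((0 : Fin 4 → ℝ), (1 : ℝ))
        (u - birkhoff α φ N (proj y)) := (hasDerivAt_const _ _).prodMk (hasDerivAt_id _)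
    have h5 := (hΨ.differentiable one_ne_zero
      (y + N • α, u - birkhoff α φ N (proj y))).hasFDerivAt.comp_hasDerivAt _ h4
    have h6 := hd (proj (y + N • α)) (u - birkhoff α φ N (proj y))
    have h7 := h5.unique h6
    rw [← hF N (proj y, u)]
    simp only [deck, natCast_zsmul]
    rw [← hpN]
    exact h7
  have h4 : partialBase j Ψ (deck α φ N (proj y, u)) = L ((Pi.single j 1 : Fin 4 → ℝ), 0) := by
    have := partialBase_lift hΨ j (y + N • α, u - birkhoff α φ N (proj y))
    rw [← hL] at this
    rw [← this]
    simp only [projProd, hpN, deck, natCast_zsmul]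
  have h5 : ((Pi.single j 1 : Fin 4 → ℝ), -derivSum α dφ j N (proj y j)) =
      ((Pi.single j 1 : Fin 4 → ℝ), (0 : ℝ)) -
        derivSum α dφ j N (proj y j) • ((0 : Fin 4 → ℝ), (1 : ℝ)) := by
    simp
  rw [partialBase_eq, h2.deriv, h4, h5, map_sub, map_smul, h3, smul_eq_mul]

theorem deck_nat_invariant {F : Torus4 × ℝ → ℝ} (hF : ∀ z, F (deck α φ 1 z) = F z) (N : ℕ)
    (z : Torus4 × ℝ) : F (deck α φ N z) = F z := by
  induction N with
  | zero => rw [Nat.cast_zero, deck_zero]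
  | succ N ih => rw [Nat.cast_succ, deck_add, hF, ih]

theorem isCoverPair_of_lift (h : IsRoof φ dφ c Φ) {F Ψ : Torus4 × ℝ → ℝ} {B₀ : ℝ}
    {B₁ : Fin 4 → ℝ} (hΨ : ContDiff ℝ 1 fun p => Ψ (projProd p)) (hFc : Continuous F)
    (hd : ∀ x u, HasDerivAt (fun u => Ψ (x, u)) (F (x, u)) u)
    (hF : ∀ z, F (deck α φ 1 z) = F z) (hinv : ∀ z, Ψ (deck α φ 1 z) = Ψ z)
    (bF : ∀ z, |F z| ≤ B₀) (bΨ : ∀ z, |Ψ z| ≤ B₀)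
    (bΨ' : ∀ j, ∀ z ∈ phase φ, |partialBase j Ψ z| ≤ B₁ j) :
    IsCoverPair α φ dφ F Ψ (fun j => partialBase j Ψ) B₀ B₁ where
  contF := hFc
  contΨ := continuous_of_lift hΨ
  contΨ' := continuous_partialBase hΨ
  deriv := hasDirDeriv_lift hΨ
  boundF := bF
  boundΨ := bΨ
  boundΨ' := bΨ'
  rel := partialBase_deck_rel h hΨ hd (deck_nat_invariant hF) (deck_nat_invariant hinv)

/-- Time reversal: since the roof function is even, `(x, u) ↦ (α - x, -u)` normalizes the
deck transformations, so the reversed functions are again a pair as in `IsCoverPair`. -/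
theorem isCoverPair_reverse (h : IsRoof φ dφ c Φ) {F Ψ : Torus4 × ℝ → ℝ} {B₀ D : ℝ}
    {B₁ : Fin 4 → ℝ} (hΨ : ContDiff ℝ 1 fun p => Ψ (projProd p)) (hFc : Continuous F)
    (hd : ∀ x u, HasDerivAt (fun u => Ψ (x, u)) (F (x, u)) u)
    (hF : ∀ z, F (deck α φ 1 z) = F z) (hinv : ∀ z, Ψ (deck α φ 1 z) = Ψ z)
    (bF : ∀ z, |F z| ≤ B₀) (bΨ : ∀ z, |Ψ z| ≤ B₀)
    (bΨ' : ∀ j, ∀ z ∈ phase φ, |partialBase j Ψ z| ≤ B₁ j) (hD : ∀ j y, |dφ j y| ≤ D) :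
    IsCoverPair α φ dφ (fun z => F (proj α - z.1, -z.2)) (fun z => -Ψ (proj α - z.1, -z.2))
      (fun j => partialBase j fun z => -Ψ (proj α - z.1, -z.2)) B₀ (fun j => B₁ j + D * B₀) := by
  have hB₀ : 0 ≤ B₀ := (abs_nonneg _).trans (bF 0)
  have hD0 : 0 ≤ D := (abs_nonneg _).trans (hD 0 0)
  have hdeck (z : Torus4 × ℝ) : (proj α - z.1, -z.2) = deck α φ 1 (-z.1, φ z.1 - z.2) := by
    simp only [deck, birkhoff_one, one_zsmul, h.even]
    refine Prod.ext ?_ ?_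
    · simp only; abel
    · simp only; ring
  have hdeck' (z : Torus4 × ℝ) : (proj α - (deck α φ 1 z).1, -(deck α φ 1 z).2) =
      (-z.1, φ z.1 - z.2) := by
    simp only [deck, birkhoff_one, one_zsmul]
    refine Prod.ext ?_ ?_
    · simp only; abel
    · simp only; ring
  refine isCoverPair_of_lift h ?_ (hFc.comp (by fun_prop)) ?_ ?_ ?_ (fun z => bF _) ?_ ?_
  · have h1 : (fun p : (Fin 4 → ℝ) × ℝ => -Ψ (proj α - (projProd p).1, -(projProd p).2)) =
        fun p => -Ψ (projProd (α - p.1, -p.2)) := by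
      ext p
      have : proj (α - p.1) = proj α - proj p.1 := by ext i; simp [proj]
      simp only [projProd, this]
    rw [h1]
    refine ContDiff.neg (hΨ.comp (g := fun p => Ψ (projProd p))
      (f := fun p : (Fin 4 → ℝ) × ℝ => (α - p.1, -p.2)) ?_)
    exact (contDiff_const.sub contDiff_fst).prodMk contDiff_snd.neg
  · intro x u
    have h1 := (hd (proj α - x) (-u)).scomp u (hasDerivAt_neg u)
    simpa using! h1.neg
  · intro z; rw [hdeck', hdeck z, hF]
  · intro z; rw [hdeck', hdeck z, hinv]
  · intro z; rw [abs_neg]; exact bΨ _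
  · intro j z hz
    have hP := isCoverPair_of_lift h hΨ hFc hd hF hinv bF bΨ bΨ'
    have h1 : partialBase j (fun z => -Ψ (proj α - z.1, -z.2)) z =
        partialBase j Ψ (proj α - z.1, -z.2) := by
      have := ((hasDirDeriv_lift hΨ j (-z.2)).comp_sub_left (proj α) z.1).neg.deriv
      rw [neg_neg] at this
      exact this
    rw [h1]
    -- the reversed point lies one deck transformation below the fundamental domain, except over
    -- the base, where it is in the domain already
    rcases hz.1.eq_or_lt with h0 | h0
    · refine (bΨ' j _ ⟨?_, ?_⟩).trans (le_add_of_nonneg_right (by positivity))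
      · simp [← h0]
      · simp only [← h0, neg_zero]; exact h.pos.trans_le (h.le _)
    · have h2 := hP.rel j 1 (-z.1) (φ z.1 - z.2)
      rw [Nat.cast_one, ← hdeck] at h2
      have h3 : partialBase j Ψ (proj α - z.1, -z.2) = partialBase j Ψ (-z.1, φ z.1 - z.2) +
          derivSum α dφ j 1 ((-z.1) j) * F (-z.1, φ z.1 - z.2) := by linarith
      rw [h3]
      refine (abs_add_le _ _).trans (add_le_add (bΨ' j _ ⟨?_, ?_⟩) ?_)
      · have := hz.2; simp only; linarith
      · simp only [h.even]; linarith
      · rw [abs_mul]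
        refine mul_le_mul ?_ (bF _) (abs_nonneg _) hD0
        simp only [derivSum, Finset.sum_range_one]
        exact hD _ _

end Pair

/-! ### Norms and bounds on the phase space -/

theorem norm0_nonneg (φ : Torus4 → ℝ) (u : Torus4 × ℝ → ℝ) : 0 ≤ norm0 φ u :=
  Real.iSup_nonneg fun _ => abs_nonneg _

theorem abs_le_norm0 {φ : Torus4 → ℝ} {u : Torus4 × ℝ → ℝ} (hb : ∃ B, ∀ z ∈ phase φ, |u z| ≤ B)
    {z : Torus4 × ℝ} (hz : z ∈ phase φ) : |u z| ≤ norm0 φ u := by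
  obtain ⟨B, hB⟩ := hb
  exact le_ciSup (f := fun z : phase φ => |u z|) ⟨B, by rintro _ ⟨w, rfl⟩; exact hB _ w.2⟩ ⟨z, hz⟩

theorem le_normN1 (φ : Torus4 → ℝ) (f ψ g : Torus4 × ℝ → ℝ) (j : Fin 4) :
    (norm0 φ f + norm0 φ ψ) * norm1 φ j g + (norm1 φ j f + norm1 φ j ψ) * norm0 φ g ≤
      normN1 φ f ψ g :=
  le_ciSup (f := fun j : Fin 4 => (norm0 φ f + norm0 φ ψ) * norm1 φ j g
    + (norm1 φ j f + norm1 φ j ψ) * norm0 φ g) (Set.finite_range _).bddAbove j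

section

variable {α : Fin 4 → ℝ} {φ : Torus4 → ℝ} {dφ : Fin 4 → UnitAddCircle → ℝ} {c Φ : ℝ}
  (h : IsRoof φ dφ c Φ)
include h

theorem exists_bound_of_continuous {H : Torus4 × ℝ → ℝ} (hH : Continuous H) :
    ∃ B, ∀ z ∈ phase φ, |H z| ≤ B := by
  have hK : IsCompact ((univ : Set Torus4) ×ˢ Icc (0 : ℝ) Φ) := isCompact_univ.prod isCompact_Icc
  obtain ⟨B, hB⟩ := hK.exists_bound_of_continuousOn hH.continuousOn
  exact ⟨B, fun z hz => hB z ⟨mem_univ _, hz.1, hz.2.le.trans (h.ge _)⟩⟩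

theorem eventually_mem_phase {z : Torus4 × ℝ} (hz : z ∈ phase φ) (j : Fin 4) :
    ∀ᶠ s : ℝ in 𝓝 0, (z.1 + dirShift j s, z.2) ∈ phase φ := by
  have h1 : Continuous fun s : ℝ => φ (z.1 + dirShift j s) :=
    h.cont.comp (continuous_const.add (continuous_dirShift j))
  have h2 : ∀ᶠ s : ℝ in 𝓝 0, z.2 < φ (z.1 + dirShift j s) :=
    h1.continuousAt.eventually_const_lt (by simpa only [dirShift_zero, add_zero] using hz.2)
  filter_upwards [h2] with s hs using ⟨hz.1, hs⟩

theorem partialBase_comp_cover (u : Torus4 × ℝ → ℝ) (j : Fin 4) {z : Torus4 × ℝ}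
    (hz : z ∈ phase φ) : partialBase j (fun w => u (cover α φ w)) z = partialBase j u z := by
  refine EventuallyEq.deriv_eq ?_
  filter_upwards [eventually_mem_phase h hz j] with s hs
  change u (cover α φ (z.1 + dirShift j s, z.2)) = _
  rw [cover_of_mem h.pos h.le hs]; rfl

/-- The transfer function is an antiderivative of the coboundary along the flow lines. -/
theorem hasDerivAt_cover_of_coboundary {f ψ : Torus4 × ℝ → ℝ} (hf : IsSmoothCoboundary α φ f ψ)
    (x : Torus4) (u : ℝ) :
    HasDerivAt (fun u => ψ (cover α φ (x, u))) (f (cover α φ (x, u))) u := by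
  have hc : Continuous fun z => f (cover α φ z) :=
    continuous_of_lift (hf.1.of_le (by exact_mod_cast le_top))
  have hcx : Continuous fun t => f (cover α φ (x, t)) := hc.comp (by fun_prop)
  have h1 : HasDerivAt (fun v => ψ (cover α φ (x, u - 1)) +
      ∫ t in (u - 1)..v, f (cover α φ (x, t))) (f (cover α φ (x, u))) u :=
    (intervalIntegral.integral_hasDerivAt_right (hcx.intervalIntegrable _ _)
      (hcx.stronglyMeasurableAtFilter _ _) hcx.continuousAt).const_add _
  refine h1.congr_of_eventuallyEq ?_
  filter_upwards [Ioi_mem_nhds (show u - 1 < u by linarith)] with v hv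
  have := hf.2.2 (x, 0) ⟨le_rfl, h.pos.trans_le (h.le x)⟩ (u - 1) v hv
  change ∫ t in (u - 1)..v, f (cover α φ (x, t)) =
    ψ (cover α φ (x, v)) - ψ (cover α φ (x, u - 1)) at this
  linarith

theorem exists_bound_of_smoothOnPhase {f : Torus4 × ℝ → ℝ} (hf : SmoothOnPhase α φ f) :
    ∃ B, ∀ z ∈ phase φ, |f z| ≤ B := by
  have hc : Continuous fun z => f (cover α φ z) :=
    continuous_of_lift (hf.of_le (by exact_mod_cast le_top))
  obtain ⟨B, hB⟩ := exists_bound_of_continuous h hc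
  refine ⟨B, fun z hz => ?_⟩
  have := hB z hz
  rwa [cover_of_mem h.pos h.le hz] at this

theorem exists_bound_partialBase_of_smoothOnPhase {f : Torus4 × ℝ → ℝ} (hf : SmoothOnPhase α φ f)
    (j : Fin 4) : ∃ B, ∀ z ∈ phase φ, |partialBase j f z| ≤ B := by
  have hc : Continuous (partialBase j fun z => f (cover α φ z)) :=
    continuous_partialBase (hf.of_le (by exact_mod_cast le_top)) j
  obtain ⟨B, hB⟩ := exists_bound_of_continuous h hc
  refine ⟨B, fun z hz => ?_⟩
  have := hB z hz
  rwa [partialBase_comp_cover h f j hz] at this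

/-- The domain `{(x, s) : 0 ≤ s < φ(x)}` of `ℝ⁴ × ℝ` contains its bottom, where derivatives are
one-sided; they are still unique. -/
theorem uniqueDiffOn_phase : UniqueDiffOn ℝ {p : (Fin 4 → ℝ) × ℝ | projProd p ∈ phase φ} := by
  intro p hp
  rcases hp.1.eq_or_lt with h0 | h0
  · have h1 : (univ : Set (Fin 4 → ℝ)) ×ˢ Ico (0 : ℝ) c ⊆ {p | projProd p ∈ phase φ} :=
      fun q hq => ⟨hq.2.1, hq.2.2.trans_le (h.le _)⟩
    have h2 : UniqueDiffOn ℝ ((univ : Set (Fin 4 → ℝ)) ×ˢ Ico (0 : ℝ) c) :=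
      uniqueDiffOn_univ.prod (uniqueDiffOn_Ico 0 c)
    refine (h2 p ⟨mem_univ _, ?_⟩).mono h1
    have : p.2 = 0 := h0.symm
    rw [this]; exact ⟨le_rfl, h.pos⟩
  · refine uniqueDiffWithinAt_of_mem_nhds ?_
    have h1 : ∀ᶠ q : (Fin 4 → ℝ) × ℝ in 𝓝 p, 0 < q.2 :=
      continuous_snd.continuousAt.eventually_const_lt h0
    have h2 : ∀ᶠ q : (Fin 4 → ℝ) × ℝ in 𝓝 p, q.2 < φ (proj q.1) :=
      continuous_snd.continuousAt.eventually_lt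
        ((h.cont.comp (continuous_proj.comp continuous_fst)).continuousAt) hp.2
    filter_upwards [h1, h2] with q hq hq' using ⟨hq.le, hq'⟩

theorem partialBase_of_isC1 {g : Torus4 × ℝ → ℝ} (hg : IsC1OnPhase φ g) (j : Fin 4)
    {p : (Fin 4 → ℝ) × ℝ} (hp : projProd p ∈ phase φ) :
    partialBase j g (projProd p) = fderivWithin ℝ (fun p => g (projProd p))
      {p | projProd p ∈ phase φ} p (Pi.single j 1, 0) := by
  have h1 : HasFDerivWithinAt (fun p => g (projProd p)) (fderivWithin ℝ (fun p => g (projProd p))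
      {p | projProd p ∈ phase φ} p) {p | projProd p ∈ phase φ}
      (p.1 + (0 : ℝ) • (Pi.single j 1 : Fin 4 → ℝ), p.2) := by
    rw [zero_smul, add_zero]
    exact (hg.differentiableOn one_ne_zero p hp).hasFDerivWithinAt
  have h2 : HasDerivAt (fun s : ℝ => (p.1 + s • (Pi.single j 1 : Fin 4 → ℝ), p.2))
      ((Pi.single j 1 : Fin 4 → ℝ), (0 : ℝ)) 0 := by
    refine HasDerivAt.prodMk ?_ (hasDerivAt_const _ _)
    simpa using ((hasDerivAt_id (0 : ℝ)).smul_const (Pi.single j 1 : Fin 4 → ℝ)).const_add p.1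
  have hline (s : ℝ) : projProd (p.1 + s • (Pi.single j 1 : Fin 4 → ℝ), p.2) =
      (proj p.1 + dirShift j s, p.2) := by
    simp only [projProd, proj_add]
    rw [← Pi.single_smul, smul_eq_mul, mul_one, proj_single]
  set I : Set ℝ := {s | (proj p.1 + dirShift j s, p.2) ∈ phase φ} with hI
  have h3 := h1.comp_hasDerivWithinAt (s := I) (0 : ℝ) h2.hasDerivWithinAt
    (fun s hs => by
      change projProd (p.1 + s • (Pi.single j 1 : Fin 4 → ℝ), p.2) ∈ phase φ
      rw [hline]; exact hs)
  have h4 := h3.hasDerivAt (eventually_mem_phase h hp j)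
  refine (HasDerivAt.deriv (h4.congr_of_eventuallyEq (Eventually.of_forall fun s => ?_)))
  simp only [Function.comp_apply, hline]
  rfl

theorem isCompact_zeta (ζ : ℝ) : IsCompact {p : (Fin 4 → ℝ) × ℝ |
    p.1 ∈ Icc (0 : Fin 4 → ℝ) 1 ∧ 0 ≤ p.2 ∧ p.2 ≤ φ (proj p.1) - ζ} := by
  have h1 : IsCompact (Icc (0 : Fin 4 → ℝ) 1 ×ˢ Icc (0 : ℝ) (Φ - ζ)) :=
    isCompact_Icc.prod isCompact_Icc
  have hcφ : Continuous fun p : (Fin 4 → ℝ) × ℝ => φ (proj p.1) :=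
    h.cont.comp (continuous_proj.comp continuous_fst)
  refine h1.of_isClosed_subset ?_ fun p hp => ⟨hp.1, hp.2.1, hp.2.2.trans ?_⟩
  · refine IsClosed.inter ?_ (IsClosed.inter ?_ ?_)
    · exact isClosed_Icc.preimage continuous_fst
    · exact isClosed_le continuous_const continuous_snd
    · exact isClosed_le continuous_snd (hcφ.sub continuous_const)
  · linarith [h.ge (proj p.1)]

omit h in
theorem exists_mem_Icc_proj_eq (x : Torus4) : ∃ y ∈ Icc (0 : Fin 4 → ℝ) 1, proj y = x := by
  have h1 : ∀ j, ∃ y : ℝ, y ∈ Ico (0 : ℝ) 1 ∧ (y : UnitAddCircle) = x j := fun j => by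
    have := AddCircle.coe_image_Ico_eq (p := (1 : ℝ)) 0
    obtain ⟨y, hy, hxy⟩ := this.symm ▸ (mem_univ (x j))
    rw [zero_add] at hy
    exact ⟨y, hy, hxy⟩
  choose y hy hxy using h1
  exact ⟨y, ⟨fun j => (hy j).1, fun j => (hy j).2.le⟩, funext hxy⟩

/-- A `C¹` function supported in `M_ζ` is bounded, because `M_ζ` lies over a compact set. -/
theorem exists_bound_of_isC1 {g : Torus4 × ℝ → ℝ} {ζ : ℝ} (hζ : 0 < ζ) (hg : IsC1OnPhase φ g)
    (hs : SupportedInZeta φ ζ g) : ∃ B, ∀ z ∈ phase φ, |g z| ≤ B := by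
  have hsub : {p : (Fin 4 → ℝ) × ℝ | p.1 ∈ Icc (0 : Fin 4 → ℝ) 1 ∧ 0 ≤ p.2 ∧
      p.2 ≤ φ (proj p.1) - ζ} ⊆ {p | projProd p ∈ phase φ} :=
    fun p hp => ⟨hp.2.1, lt_of_le_of_lt hp.2.2 (by simp only [projProd]; linarith)⟩
  obtain ⟨B, hB⟩ := (isCompact_zeta h ζ).exists_bound_of_continuousOn (hg.continuousOn.mono hsub)
  refine ⟨max B 0, fun z hz => ?_⟩
  by_cases h0 : g z = 0
  · rw [h0, abs_zero]; exact le_max_right _ _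
  · obtain ⟨-, h1, h2⟩ := hs z hz h0
    obtain ⟨y, hy, hyz⟩ := exists_mem_Icc_proj_eq z.1
    have h3 := hB (y, z.2) ⟨hy, h1, by rw [hyz]; exact h2⟩
    simp only [hyz] at h3
    exact le_max_of_le_left h3

theorem exists_bound_partialBase_of_isC1 {g : Torus4 × ℝ → ℝ} {ζ : ℝ} (hζ : 0 < ζ)
    (hg : IsC1OnPhase φ g) (hs : SupportedInZeta φ ζ g) (j : Fin 4) :
    ∃ B, ∀ z ∈ phase φ, |partialBase j g z| ≤ B := by
  have hsub : {p : (Fin 4 → ℝ) × ℝ | p.1 ∈ Icc (0 : Fin 4 → ℝ) 1 ∧ 0 ≤ p.2 ∧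
      p.2 ≤ φ (proj p.1) - ζ} ⊆ {p | projProd p ∈ phase φ} :=
    fun p hp => ⟨hp.2.1, lt_of_le_of_lt hp.2.2 (by simp only [projProd]; linarith)⟩
  have hcont : ContinuousOn (fun p => fderivWithin ℝ (fun p => g (projProd p))
      {p | projProd p ∈ phase φ} p ((Pi.single j 1 : Fin 4 → ℝ), (0 : ℝ)))
      {p | projProd p ∈ phase φ} :=
    (hg.continuousOn_fderivWithin (uniqueDiffOn_phase h) le_rfl).clm_apply continuousOn_const
  obtain ⟨B, hB⟩ := (isCompact_zeta h ζ).exists_bound_of_continuousOn (hcont.mono hsub)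
  refine ⟨max B 0, fun z hz => ?_⟩
  by_cases h0 : z.2 ≤ φ z.1 - ζ
  · obtain ⟨y, hy, hyz⟩ := exists_mem_Icc_proj_eq z.1
    have hyz' : projProd (y, z.2) = z := by simp [projProd, hyz]
    have h3 := hB (y, z.2) ⟨hy, hz.1, by rw [hyz]; exact h0⟩
    rw [← partialBase_of_isC1 h hg j (by rw [hyz']; exact hz), hyz'] at h3
    exact le_max_of_le_left h3
  · have h1 : Continuous fun s : ℝ => φ (z.1 + dirShift j s) - ζ :=
      (h.cont.comp (continuous_const.add (continuous_dirShift j))).sub continuous_const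
    have h2 : ∀ᶠ s : ℝ in 𝓝 0, φ (z.1 + dirShift j s) - ζ < z.2 :=
      h1.continuousAt.eventually_lt_const (by simpa only [dirShift_zero, add_zero] using not_le.1 h0)
    have h3 : (fun s : ℝ => g (z.1 + dirShift j s, z.2)) =ᶠ[𝓝 0] fun _ => 0 := by
      filter_upwards [h2, eventually_mem_phase h hz j] with s hs1 hs2
      by_contra hne
      have := (hs _ hs2 hne).2.2
      simp only at this
      linarith
    have h4 : partialBase j g z = 0 := by
      have := h3.deriv_eq
      rw [deriv_const] at this
      exact this
    rw [h4, abs_zero]; exact le_max_right _ _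

/-- The horizontal slices of a `C¹` function supported in `M_ζ`, extended by `0`, are `C¹` functions
on the torus, and their partial derivatives are bounded by those of the function. -/
theorem exists_slice_deriv {g : Torus4 × ℝ → ℝ} {ζ : ℝ} (hζ : 0 < ζ) (hg : IsC1OnPhase φ g)
    (hs : SupportedInZeta φ ζ g) {s : ℝ} (hs0 : 0 ≤ s) :
    Continuous (fun x => (phase φ).indicator g (x, s)) ∧ ∃ G' : Fin 4 → Torus4 → ℝ,
      ∀ j, Continuous (G' j) ∧ HasDirDeriv j (fun x => (phase φ).indicator g (x, s)) (G' j) ∧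
        ∀ x, |G' j x| ≤ norm0 φ (partialBase j g) := by
  set H : Torus4 × ℝ → ℝ := fun z => (phase φ).indicator g (z.1, s) with hH
  have hφp : Continuous fun p : (Fin 4 → ℝ) × ℝ => φ (proj p.1) :=
    h.cont.comp (continuous_proj.comp continuous_fst)
  have hzero : ∀ x, φ x - ζ < s → (phase φ).indicator g (x, s) = 0 := fun x hx => by
    by_cases hmem : (x, s) ∈ phase φ
    · rw [indicator_of_mem hmem]
      by_contra hne
      have := (hs _ hmem hne).2.2
      simp only at this
      linarith
    · rw [indicator_of_notMem hmem]
  have hsmooth : ContDiff ℝ 1 fun p => H (projProd p) := by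
    rw [contDiff_iff_contDiffAt]
    intro p
    rcases lt_or_ge s (φ (proj p.1)) with hp | hp
    · have hU : ∀ᶠ q : (Fin 4 → ℝ) × ℝ in 𝓝 p, s < φ (proj q.1) :=
        hφp.continuousAt.eventually_const_lt hp
      have h1 : ContDiffWithinAt ℝ 1 (fun q : (Fin 4 → ℝ) × ℝ => g (projProd (q.1, s)))
          {q | s < φ (proj q.1)} p := by
        refine (hg (p.1, s) ⟨hs0, hp⟩).comp p
          (f := fun q : (Fin 4 → ℝ) × ℝ => (q.1, s)) ?_ fun q hq => ⟨hs0, hq⟩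
        exact (contDiff_fst.prodMk contDiff_const).contDiffWithinAt
      refine (h1.contDiffAt hU).congr_of_eventuallyEq ?_
      filter_upwards [hU] with q hq
      exact indicator_of_mem (show (proj q.1, s) ∈ phase φ from ⟨hs0, hq⟩) g
    · have hU : ∀ᶠ q : (Fin 4 → ℝ) × ℝ in 𝓝 p, φ (proj q.1) - ζ < s :=
        (hφp.sub continuous_const).continuousAt.eventually_lt_const (show φ (proj p.1) - ζ < s by linarith)
      refine (contDiffAt_const (c := (0 : ℝ))).congr_of_eventuallyEq ?_
      filter_upwards [hU] with q hq
      exact hzero _ hq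
  refine ⟨(continuous_of_lift hsmooth).comp (g := H) (f := fun x => (x, s)) (by fun_prop),
    fun j x => partialBase j H (x, s), fun j => ⟨?_, hasDirDeriv_lift hsmooth j s, fun x => ?_⟩⟩
  · exact (continuous_partialBase hsmooth j).comp (by fun_prop)
  · rcases lt_or_ge s (φ x) with hx | hx
    · have hmem : (x, s) ∈ phase φ := ⟨hs0, hx⟩
      have h1 : partialBase j H (x, s) = partialBase j g (x, s) := by
        refine EventuallyEq.deriv_eq ?_
        filter_upwards [eventually_mem_phase h hmem j] with r hr
        exact indicator_of_mem hr g
      refine (congrArg abs h1).trans_le ?_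
      exact abs_le_norm0 (exists_bound_partialBase_of_isC1 h hζ hg hs j) hmem
    · have h1 : Continuous fun r : ℝ => φ (x + dirShift j r) - ζ :=
        (h.cont.comp (continuous_const.add (continuous_dirShift j))).sub continuous_const
      have h2 : ∀ᶠ r : ℝ in 𝓝 0, φ (x + dirShift j r) - ζ < s :=
        h1.continuousAt.eventually_lt_const (by simp only [dirShift_zero, add_zero]; linarith)
      have h3 : (fun r : ℝ => H (x + dirShift j r, s)) =ᶠ[𝓝 0] fun _ => 0 := by
        filter_upwards [h2] with r hr
        exact hzero _ hr
      have h4 : partialBase j H (x, s) = 0 := by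
        have := h3.deriv_eq
        rw [deriv_const] at this
        exact this
      refine (congrArg abs h4).trans_le ?_
      rw [abs_zero]; exact norm0_nonneg _ _

theorem aestronglyMeasurable_of_isC1 {g : Torus4 × ℝ → ℝ} (hg : IsC1OnPhase φ g) :
    AEStronglyMeasurable g (phaseMeasure φ) := by
  refine ContinuousOn.aestronglyMeasurable (fun z hz => ?_) (measurableSet_phase h.cont)
  obtain ⟨p, rfl⟩ := isOpenQuotientMap_projProd.surjective z
  have h1 : map projProd (𝓝[{p | projProd p ∈ phase φ}] p) = 𝓝[phase φ] (projProd p) := by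
    rw [nhdsWithin, nhdsWithin, ← isOpenQuotientMap_projProd.map_nhds_eq,
      ← Filter.push_pull, Filter.comap_principal]
    rfl
  change Tendsto g (𝓝[phase φ] (projProd p)) _
  rw [← h1, tendsto_map'_iff]
  exact hg.continuousOn p hz

end

/-! ### Decay of correlations -/

instance : (volume : Measure UnitAddCircle).IsNegInvariant :=
  Measure.IsAddHaarMeasure.isNegInvariant_of_regular _

instance : (volume : Measure Torus4).IsNegInvariant :=
  inferInstanceAs ((Measure.pi fun _ : Fin 4 => (volume : Measure UnitAddCircle)).IsNegInvariant)

section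

variable {α : Fin 4 → ℝ} {φ : Torus4 → ℝ} {dφ : Fin 4 → UnitAddCircle → ℝ} {c Φ : ℝ}

theorem IsRoof.exists_deriv_bound (h : IsRoof φ dφ c Φ) : ∃ D, ∀ j y, |dφ j y| ≤ D := by
  have h1 (j : Fin 4) : ∃ D, ∀ y, |dφ j y| ≤ D := by
    obtain ⟨D, hD⟩ := isCompact_univ.exists_bound_of_continuousOn (h.dcont j).continuousOn
    exact ⟨D, fun y => hD y (mem_univ y)⟩
  choose D hD using h1
  refine ⟨∑ j, D j, fun j y => (hD j y).trans ?_⟩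
  exact Finset.single_le_sum (f := D) (fun i _ => (abs_nonneg _).trans (hD i 0)) (Finset.mem_univ j)

/-- An integral over the phase space is an iterated integral over horizontal slices. -/
theorem integral_phaseMeasure_eq (h : IsRoof φ dφ c Φ) {F g : Torus4 × ℝ → ℝ}
    (hint : Integrable (fun z => F z * g z) (phaseMeasure φ)) :
    ∫ z, F z * g z ∂phaseMeasure φ =
      ∫ s in Icc (0 : ℝ) Φ, ∫ x, F (x, s) * (phase φ).indicator g (x, s) := by
  have hM := measurableSet_phase h.cont
  have h1 : (fun z => F z * (phase φ).indicator g z) = (phase φ).indicator fun z => F z * g z := by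
    ext z; by_cases hz : z ∈ phase φ <;> simp [hz]
  have h2 : Integrable (fun z => F z * (phase φ).indicator g z)
      ((volume : Measure Torus4).prod (volume : Measure ℝ)) := by
    rw [h1, integrable_indicator_iff hM]
    exact hint
  rw [phaseMeasure, ← integral_indicator hM, ← h1, Measure.volume_eq_prod, integral_prod_symm _ h2,
    setIntegral_eq_integral_of_forall_compl_eq_zero]
  intro s hs
  have h3 : ∀ x : Torus4, (x, s) ∉ phase φ := fun x hx =>
    hs ⟨hx.1, hx.2.le.trans (h.ge x)⟩
  simp [h3]

theorem integrable_flow_mul (h : IsRoof φ dφ c Φ) {ζ : ℝ} (hζ : 0 < ζ) {f g : Torus4 × ℝ → ℝ}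
    (hf : SmoothOnPhase α φ f) (hg : IsC1OnPhase φ g) (hs : SupportedInZeta φ ζ g) (t : ℝ) :
    Integrable (fun z => f (flow α φ t z) * g z) (phaseMeasure φ) := by
  have := isFiniteMeasure_phaseMeasure h.ge
  obtain ⟨Bf, hBf⟩ := exists_bound_of_smoothOnPhase h hf
  obtain ⟨Bg, hBg⟩ := exists_bound_of_isC1 h hζ hg hs
  have hFc : Continuous fun z => f (cover α φ z) :=
    continuous_of_lift (hf.of_le (by exact_mod_cast le_top))
  have h1 : Continuous fun z : Torus4 × ℝ => f (flow α φ t z) := by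
    simp_rw [flow_eq_cover]
    exact hFc.comp (by fun_prop)
  refine Integrable.of_bound (h1.aestronglyMeasurable.mul (aestronglyMeasurable_of_isC1 h hg))
    (Bf * Bg) ?_
  refine (ae_restrict_iff' (measurableSet_phase h.cont)).2 (ae_of_all _ fun z hz => ?_)
  rw [norm_mul]
  have := hBf _ (flow_mem_phase (α := α) h.pos h.le t z)
  exact mul_le_mul this (hBg z hz) (norm_nonneg _) ((abs_nonneg _).trans this)

/-- Decay of correlations between smooth coboundaries and `C¹` functions. The slice of height `s`
is estimated at the time `t + s`; for small `|t|` the trivial bound suffices, and for negative `t`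
the reversal `isCoverPair_reverse` applies. -/
theorem exists_correlation_bound (h : IsRoof φ dφ c Φ) {Cr : ℝ} (hCr : 0 ≤ Cr)
    (hres : ∃ T₁ : ℝ, ∀ u ≥ T₁, ∃ a b : Fin 4, a ≠ b ∧ ∃ q q' : ℕ,
      (1 ≤ q ∧ Real.exp (24 * q) ≤ u ∧ IsResonant α dφ Cr (2 / c * u) a q) ∧
      (1 ≤ q' ∧ Real.exp (24 * q') ≤ u ∧ IsResonant α dφ Cr (2 / c * u) b q'))
    {ζ : ℝ} (hζ : 0 < ζ) :
    ∃ C : ℝ, 0 < C ∧ ∀ f ψ g : Torus4 × ℝ → ℝ, IsSmoothCoboundary α φ f ψ →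
      IsC1OnPhase φ g → SupportedInZeta φ ζ g → ∀ t : ℝ, t ≠ 0 →
        |∫ z, f (flow α φ t z) * g z ∂phaseMeasure φ| ≤
          C * normN1 φ f ψ g * |t| ^ (-5 / 8 : ℝ) := by
  obtain ⟨C₁, T₀, hC₁, hT₀, hcore⟩ := exists_abs_integral_le_rpow h hCr hres
  obtain ⟨D, hD⟩ := h.exists_deriv_bound
  have hD0 : 0 ≤ D := (abs_nonneg _).trans (hD 0 0)
  have hΦ := h.pos'
  -- for `|t| ≥ T` the time `t + s` of a slice is at least `|t| / 2` and `T₀` in absolute value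
  set T : ℝ := 2 * T₀ + 2 * Φ with hT
  have hT1 : 0 < T := by positivity
  set C : ℝ := C₁ * (1 + D) * (1 / 2) ^ (-5 / 8 : ℝ) + T ^ (5 / 8 : ℝ) with hC
  have hC0 : 0 < C := by positivity
  refine ⟨C * Φ, by positivity, fun f ψ g hfψ hg hs t ht => ?_⟩
  set M := normN1 φ f ψ g with hM
  set B₀ := norm0 φ f + norm0 φ ψ with hB₀
  set B₁ : Fin 4 → ℝ := fun j => norm0 φ (partialBase j ψ) with hB₁
  set g₀ := norm0 φ g with hg₀
  have hn := norm0_nonneg φ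
  have hB₀0 : 0 ≤ B₀ := add_nonneg (hn _) (hn _)
  have hMj : ∀ j, B₀ * (g₀ + norm0 φ (partialBase j g)) + B₁ j * g₀ ≤ M := by
    intro j
    refine le_trans ?_ (le_normN1 φ f ψ g j)
    simp only [norm1]
    have h1 := mul_nonneg (hn f) (hn g)
    have h2 := mul_nonneg (hn (partialBase j f)) (hn g)
    have h3 := mul_nonneg (hn ψ) (hn g)
    simp only [hB₀, hB₁, hg₀]
    linarith
  have hMB : B₀ * g₀ ≤ M := by
    refine le_trans ?_ (hMj 0)
    have h1 := mul_nonneg hB₀0 (hn (partialBase 0 g))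
    have h2 := mul_nonneg (hn (partialBase 0 ψ)) (hn g)
    simp only [hB₁]
    linarith
  have hM0 : 0 ≤ M := (mul_nonneg hB₀0 (hn g)).trans hMB
  set F : Torus4 × ℝ → ℝ := fun z => f (cover α φ z) with hF
  set Ψ : Torus4 × ℝ → ℝ := fun z => ψ (cover α φ z) with hΨ
  have hFc : Continuous F := continuous_of_lift (hfψ.1.of_le (by exact_mod_cast le_top))
  have hΨ1 : ContDiff ℝ 1 fun p => Ψ (projProd p) := hfψ.2.1.of_le (by exact_mod_cast le_top)
  have hd := hasDerivAt_cover_of_coboundary h hfψ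
  have hmem := cover_mem_phase (α := α) h.pos h.le
  have bF : ∀ z, |F z| ≤ B₀ := fun z =>
    (abs_le_norm0 (exists_bound_of_smoothOnPhase h hfψ.1) (hmem z)).trans
      (le_add_of_nonneg_right (hn _))
  have bΨ : ∀ z, |Ψ z| ≤ B₀ := fun z =>
    (abs_le_norm0 (exists_bound_of_smoothOnPhase h hfψ.2.1) (hmem z)).trans
      (le_add_of_nonneg_left (hn _))
  have bΨ' : ∀ j, ∀ z ∈ phase φ, |partialBase j Ψ z| ≤ B₁ j := fun j z hz => by
    rw [hΨ, partialBase_comp_cover h ψ j hz]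
    exact abs_le_norm0 (exists_bound_partialBase_of_smoothOnPhase h hfψ.2.1 j) hz
  have iF : ∀ z, F (deck α φ 1 z) = F z := fun z => by rw [hF]; simp only [cover_deck h.pos h.le]
  have iΨ : ∀ z, Ψ (deck α φ 1 z) = Ψ z := fun z => by rw [hΨ]; simp only [cover_deck h.pos h.le]
  have hP := isCoverPair_of_lift (B₁ := B₁) h hΨ1 hFc hd iF iΨ bF bΨ bΨ'
  have hP' := isCoverPair_reverse (B₁ := B₁) h hΨ1 hFc hd iF iΨ bF bΨ bΨ' hD
  have hgb : ∀ z, |(phase φ).indicator g z| ≤ g₀ := fun z => by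
    by_cases hz : z ∈ phase φ
    · rw [indicator_of_mem hz]
      exact abs_le_norm0 (exists_bound_of_isC1 h hζ hg hs) hz
    · rw [indicator_of_notMem hz, abs_zero]; exact hn g
  have ht0 : 0 < |t| := abs_pos.2 ht
  -- the integral over one slice
  have hslice : ∀ s ∈ Icc (0 : ℝ) Φ, ‖∫ x, F (x, t + s) * (phase φ).indicator g (x, s)‖ ≤
      C * M * |t| ^ (-5 / 8 : ℝ) := by
    intro s hs'
    obtain ⟨hGc, G', hG'⟩ := exists_slice_deriv h hζ hg hs hs'.1
    rw [Real.norm_eq_abs]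
    rcases lt_or_ge |t| T with htT | htT
    · have h1 : |∫ x, F (x, t + s) * (phase φ).indicator g (x, s)| ≤ M := by
        rw [← Real.norm_eq_abs]
        refine (norm_integral_le_of_norm_le_const (C := M) (ae_of_all _ fun x => ?_)).trans ?_
        · rw [norm_mul]
          exact (mul_le_mul (bF _) (hgb _) (abs_nonneg _) hB₀0).trans hMB
        · simp
      refine h1.trans ?_
      have h2 : 1 ≤ T ^ (5 / 8 : ℝ) * |t| ^ (-5 / 8 : ℝ) := by
        have : |t| ^ (-5 / 8 : ℝ) = (|t| ^ (5 / 8 : ℝ))⁻¹ := by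
          rw [← Real.rpow_neg ht0.le]; norm_num
        rw [this, ← div_eq_mul_inv, one_le_div (by positivity)]
        exact Real.rpow_le_rpow ht0.le htT.le (by norm_num)
      calc M = M * 1 := (mul_one _).symm
        _ ≤ M * (T ^ (5 / 8 : ℝ) * |t| ^ (-5 / 8 : ℝ)) := by gcongr
        _ = T ^ (5 / 8 : ℝ) * M * |t| ^ (-5 / 8 : ℝ) := by ring
        _ ≤ _ := by
          gcongr
          rw [hC]
          have : 0 ≤ C₁ * (1 + D) * (1 / 2) ^ (-5 / 8 : ℝ) := by positivity
          linarith
    · -- reduction to a positive large time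
      have hmain : ∃ u, |t| / 2 ≤ u ∧ |∫ x, F (x, t + s) * (phase φ).indicator g (x, s)| ≤
          C₁ * ((1 + D) * M) * u ^ (-5 / 8 : ℝ) := by
        rcases lt_or_gt_of_ne ht with htn | htp
        · rw [abs_of_neg htn] at htT ⊢
          refine ⟨-(t + s), by linarith [hs'.2], ?_⟩
          have hrefl : ∫ x, F (x, t + s) * (phase φ).indicator g (x, s) =
              ∫ x, (fun z : Torus4 × ℝ => F (proj α - z.1, -z.2)) (x, -(t + s)) *
                (phase φ).indicator g (proj α - x, s) := by
            rw [← integral_sub_left_eq_self (fun x => F (x, t + s) * (phase φ).indicator g (x, s))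
              volume (proj α)]
            simp only [neg_neg]
          rw [hrefl]
          refine hcore _ _ _ _ _ hP' (fun x => (phase φ).indicator g (proj α - x, s))
            (fun j x => -G' j (proj α - x)) g₀ (fun j => norm0 φ (partialBase j g)) ((1 + D) * M)
            (hGc.comp (f := fun x => proj α - x) (by fun_prop))
            (fun j => ((hG' j).1.comp (by fun_prop)).neg)
            (fun j => (hG' j).2.1.comp_sub_left _) (fun x => hgb _)
            (fun j x => by rw [abs_neg]; exact (hG' j).2.2 _) (fun j => ?_) _ (by linarith [hs'.2])
          have h1 := hMj j
          have h2 : D * (B₀ * g₀) ≤ D * M := by gcongr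
          linarith
        · rw [abs_of_pos htp] at htT ⊢
          refine ⟨t + s, by linarith [hs'.1], ?_⟩
          refine hcore _ _ _ _ _ hP (fun x => (phase φ).indicator g (x, s)) G' g₀
            (fun j => norm0 φ (partialBase j g)) ((1 + D) * M) hGc (fun j => (hG' j).1)
            (fun j => (hG' j).2.1) (fun x => hgb _) (fun j x => (hG' j).2.2 _) (fun j => ?_) _
            (by linarith [hs'.1])
          have h2 : 0 ≤ D * M := by positivity
          have := hMj j
          linarith
      obtain ⟨u, hu, hle⟩ := hmain
      refine hle.trans ?_
      have h1 : u ^ (-5 / 8 : ℝ) ≤ (1 / 2) ^ (-5 / 8 : ℝ) * |t| ^ (-5 / 8 : ℝ) := by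
        rw [← Real.mul_rpow (by norm_num) ht0.le]
        exact Real.rpow_le_rpow_of_nonpos (by positivity) (by linarith) (by norm_num)
      calc _ ≤ C₁ * ((1 + D) * M) * ((1 / 2) ^ (-5 / 8 : ℝ) * |t| ^ (-5 / 8 : ℝ)) := by gcongr
        _ = C₁ * (1 + D) * (1 / 2) ^ (-5 / 8 : ℝ) * M * |t| ^ (-5 / 8 : ℝ) := by ring
        _ ≤ _ := by
          gcongr
          rw [hC]
          have : 0 ≤ T ^ (5 / 8 : ℝ) := by positivity
          linarith
  have hint := integrable_flow_mul h hζ hfψ.1 hg hs t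
  simp_rw [flow_eq_cover] at hint ⊢
  rw [integral_phaseMeasure_eq h (F := fun z => f (cover α φ (z.1, t + z.2))) hint,
    ← Real.norm_eq_abs]
  refine (norm_setIntegral_le_of_norm_le_const (by simp) hslice).trans (le_of_eq ?_)
  rw [Real.volume_real_Icc_of_le hΦ.le]
  ring

end

/-! ### Coboundaries built from bump functions -/

theorem volume_torus4_eq :
    (volume : Measure Torus4) = Measure.pi fun _ : Fin 4 => AddCircle.haarAddCircle := by
  have h1 : (volume : Measure UnitAddCircle) = AddCircle.haarAddCircle := by
    rw [AddCircle.volume_eq_smul_haarAddCircle, ENNReal.ofReal_one, one_smul]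
  change Measure.pi (fun _ : Fin 4 => (volume : Measure UnitAddCircle)) = _
  rw [h1]

/-- A square integrable function on the torus whose Fourier coefficients vanish is zero. -/
theorem ae_eq_zero_of_mFourier {f : Torus4 → ℂ} (hf : MemLp f 2 volume)
    (h : ∀ k : Fin 4 → ℤ, ∫ x, f x * UnitAddTorus.mFourier k x = 0) : f =ᵐ[volume] 0 := by
  rw [volume_torus4_eq] at hf h ⊢
  have h1 := UnitAddTorus.hasSum_sq_mFourierCoeff (d := Fin 4) (hf.toLp f)
  have h2 : ∀ k, UnitAddTorus.mFourierCoeff (hf.toLp f : Torus4 → ℂ) k = 0 := fun k => by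
    rw [← h (-k)]
    refine integral_congr_ae ?_
    filter_upwards [hf.coeFn_toLp] with x hx
    rw [hx, smul_eq_mul, mul_comm]
  simp only [h2, norm_zero, ne_eq, OfNat.ofNat_ne_zero, not_false_eq_true, zero_pow] at h1
  have h3 := h1.unique hasSum_zero
  have h4 : ∫ x, ‖f x‖ ^ 2 ∂(Measure.pi fun _ : Fin 4 => AddCircle.haarAddCircle) = 0 := by
    refine Eq.trans (integral_congr_ae ?_) h3
    filter_upwards [hf.coeFn_toLp] with x hx
    rw [hx]
  rw [integral_eq_zero_iff_of_nonneg (fun x => by positivity)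
    ((memLp_two_iff_integrable_sq_norm hf.1).1 hf)] at h4
  filter_upwards [h4] with x hx
  simpa using hx

/-- A real trigonometric monomial on the torus. -/
def trig (k : Fin 4 → ℤ) (w : ℂ) (x : Torus4) : ℝ := (w * UnitAddTorus.mFourier k x).re

/-- The value `e(k · α)` of the character `k` at `α`. -/
def charValue (α : Fin 4 → ℝ) (k : Fin 4 → ℤ) : ℂ := UnitAddTorus.mFourier k (proj α)

theorem mFourier_add_apply (k : Fin 4 → ℤ) (x y : Torus4) :
    UnitAddTorus.mFourier k (x + y) = UnitAddTorus.mFourier k x * UnitAddTorus.mFourier k y := by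
  simp only [UnitAddTorus.mFourier, ContinuousMap.coe_mk, ← Finset.prod_mul_distrib]
  refine Finset.prod_congr rfl fun i _ => ?_
  simp only [fourier_apply, Pi.add_apply, smul_add, AddCircle.toCircle_add, Circle.coe_mul]

theorem mFourier_proj (k : Fin 4 → ℤ) (x : Fin 4 → ℝ) :
    UnitAddTorus.mFourier k (proj x) =
      Complex.exp (Complex.I * ((2 * Real.pi * ∑ i, k i * x i : ℝ) : ℂ)) := by
  simp only [UnitAddTorus.mFourier, ContinuousMap.coe_mk, proj]
  simp_rw [fourier_coe_apply]
  rw [← Complex.exp_sum]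
  congr 1
  push_cast
  rw [Finset.mul_sum, Finset.mul_sum]
  refine Finset.sum_congr rfl fun i _ => ?_
  ring

/-- The translation by `α` is ergodic: the nontrivial characters are not invariant. -/
theorem charValue_ne_one {α : Fin 4 → ℝ} (hα : α ∈ freqSet) {k : Fin 4 → ℤ} (hk : k ≠ 0) :
    charValue α k ≠ 1 := by
  intro h
  rw [charValue, mFourier_proj, Complex.exp_eq_one_iff] at h
  obtain ⟨n, hn⟩ := h
  refine sum_mul_ne_int hα hk n ?_
  have h1 : ((2 * Real.pi * ∑ i, k i * α i : ℝ) : ℂ) = ((n * (2 * Real.pi) : ℝ) : ℂ) := by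
    apply mul_left_cancel₀ Complex.I_ne_zero
    rw [hn]; push_cast; ring
  have h2 := Complex.ofReal_injective h1
  have := Real.pi_pos
  have h3 : 2 * Real.pi ≠ 0 := by positivity
  apply mul_left_cancel₀ h3
  linarith

theorem contDiff_trig (k : Fin 4 → ℤ) (w : ℂ) : ContDiff ℝ ∞ fun x => trig k w (proj x) := by
  simp only [trig, mFourier_proj]
  refine Complex.reCLM.contDiff.comp (contDiff_const.mul (ContDiff.cexp (contDiff_const.mul ?_)))
  refine Complex.ofRealCLM.contDiff.comp (contDiff_const.mul (ContDiff.sum fun i _ => ?_))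
  exact contDiff_const.mul (contDiff_apply ℝ ℝ i)

theorem continuous_trig (k : Fin 4 → ℤ) (w : ℂ) : Continuous (trig k w) :=
  Complex.continuous_re.comp (continuous_const.mul (UnitAddTorus.mFourier k).continuous)

theorem trig_add_apply (k : Fin 4 → ℤ) (w : ℂ) (α : Fin 4 → ℝ) (x : Torus4) :
    trig k w (x + proj α) = trig k (w * charValue α k) x := by
  simp only [trig, mFourier_add_apply, charValue]
  congr 1; ring

theorem trig_sub (k : Fin 4 → ℤ) (w w' : ℂ) (x : Torus4) :
    trig k (w - w') x = trig k w x - trig k w' x := by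
  simp only [trig, sub_mul, Complex.sub_re]

/-- `χ` is a smooth function on the line, supported in a compact subset of `(0, c)`. -/
structure IsBump (c : ℝ) (χ : ℝ → ℝ) : Prop where
  smooth : ContDiff ℝ ∞ χ
  supp : ∃ δ > 0, δ ≤ c ∧ ∀ s, s ∉ Icc δ (c - δ) → χ s = 0

theorem isBump_of_tsupport {c : ℝ} (hc : 0 < c) {χ : ℝ → ℝ} (h1 : ContDiff ℝ ∞ χ)
    (h2 : HasCompactSupport χ) (h3 : tsupport χ ⊆ Ioo 0 c) : IsBump c χ := by
  refine ⟨h1, ?_⟩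
  rcases (tsupport χ).eq_empty_or_nonempty with h0 | hne
  · refine ⟨c, hc, le_rfl, fun s _ => ?_⟩
    by_contra hs
    have : s ∈ tsupport χ := subset_tsupport χ hs
    rw [h0] at this
    exact this
  · obtain ⟨a, ha, hamin⟩ := h2.isCompact.exists_isLeast hne
    obtain ⟨b, hb, hbmax⟩ := h2.isCompact.exists_isGreatest hne
    have ha' := h3 ha
    have hb' := h3 hb
    refine ⟨min a (c - b), lt_min ha'.1 (by linarith [hb'.2]), (min_le_left _ _).trans ha'.2.le,
      fun s hs => ?_⟩
    by_contra hne'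
    have hs' : s ∈ tsupport χ := subset_tsupport χ hne'
    refine hs ⟨(min_le_left _ _).trans (hamin hs'), ?_⟩
    have := hbmax hs'
    linarith [min_le_right a (c - b)]

section Local

variable {α : Fin 4 → ℝ} {φ : Torus4 → ℝ} {dφ : Fin 4 → UnitAddCircle → ℝ} {c Φ : ℝ}
  (h : IsRoof φ dφ c Φ)
include h

theorem contDiff_birkhoff (n : ℤ) : ContDiff ℝ ∞ fun x => birkhoff α φ n (proj x) := by
  have hs (m : Fin 4 → ℝ) : ContDiff ℝ ∞ fun x => φ (proj (x + m)) :=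
    h.smooth.comp (g := fun x => φ (proj x)) (contDiff_id.add contDiff_const)
  rcases n with n | n
  · change ContDiff ℝ ∞ fun x => ∑ k ∈ Finset.range n, φ (proj x + k • proj α)
    refine ContDiff.sum fun k _ => ?_
    have : (fun x => φ (proj x + k • proj α)) = fun x => φ (proj (x + k • α)) := by
      ext x; congr 1
    rw [this]; exact hs _
  · change ContDiff ℝ ∞ fun x => -∑ k ∈ Finset.range (n + 1), φ (proj x - (k + 1) • proj α)
    refine ContDiff.neg (ContDiff.sum fun k _ => ?_)
    have : (fun x => φ (proj x - (k + 1) • proj α)) = fun x => φ (proj (x + -((k + 1) • α))) := by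
      ext x; congr 1
    rw [this]; exact hs _

/-- A neighbourhood of every point of `ℝ⁴ × ℝ` is mapped by a single deck transformation to a
neighbourhood of the fundamental domain. -/
theorem exists_deck_eventually {δ : ℝ} (hδ : 0 < δ) (p : (Fin 4 → ℝ) × ℝ) :
    ∃ n : ℤ, ∀ᶠ q in 𝓝 p, -δ < (deck α φ n (projProd q)).2 ∧
      (deck α φ n (projProd q)).2 < φ (deck α φ n (projProd q)).1 := by
  obtain ⟨n, hn, -⟩ := existsUnique_deck_mem (α := α) h.pos h.le (projProd p)
  have hcd : Continuous fun q => deck α φ n (projProd q) := by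
    have h1 := continuous_birkhoff (α := α) h.cont n
    have h2 := isOpenQuotientMap_projProd.continuous
    have h3 : Continuous (deck α φ n) := by unfold deck; fun_prop
    exact h3.comp h2
  refine ⟨n, ?_⟩
  have h1 : ∀ᶠ q in 𝓝 p, -δ < (deck α φ n (projProd q)).2 :=
    (continuous_snd.comp hcd).continuousAt.eventually_const_lt
      (show -δ < (deck α φ n (projProd p)).2 by linarith [hn.1])
  have h2 : ∀ᶠ q in 𝓝 p, (deck α φ n (projProd q)).2 < φ (deck α φ n (projProd q)).1 :=
    (continuous_snd.comp hcd).continuousAt.eventually_lt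
      (h.cont.comp (continuous_fst.comp hcd)).continuousAt hn.2
  exact h1.and h2

/-- Smoothness on the phase space is local: it suffices to have a smooth formula near the
fundamental domain. -/
theorem smoothOnPhase_of_local {f W : Torus4 × ℝ → ℝ} {δ : ℝ} (hδ : 0 < δ)
    (hW : ContDiff ℝ ∞ fun p => W (projProd p))
    (hf : ∀ x v, -δ < v → v < φ x → f (cover α φ (x, v)) = W (x, v)) : SmoothOnPhase α φ f := by
  change ContDiff ℝ ∞ fun p => f (cover α φ (projProd p))
  rw [contDiff_iff_contDiffAt]
  intro p
  obtain ⟨n, hn⟩ := exists_deck_eventually (α := α) h hδ p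
  have h1 : ContDiff ℝ ∞ fun q : (Fin 4 → ℝ) × ℝ => W (deck α φ n (projProd q)) := by
    have h2 : (fun q : (Fin 4 → ℝ) × ℝ => W (deck α φ n (projProd q))) =
        fun q => W (projProd (q.1 + n • α, q.2 - birkhoff α φ n (proj q.1))) := by
      ext q
      have : proj (q.1 + n • α) = proj q.1 + n • proj α := by ext i; simp [proj]
      simp only [deck, projProd, this]
    rw [h2]
    refine hW.comp (g := fun p => W (projProd p)) (ContDiff.prodMk ?_ ?_)
    · exact contDiff_fst.add contDiff_const
    · exact contDiff_snd.sub ((contDiff_birkhoff h n).comp contDiff_fst)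
  refine h1.contDiffAt.congr_of_eventuallyEq ?_
  filter_upwards [hn] with q hq
  rw [← cover_deck h.pos h.le n]
  exact hf _ _ hq.1 hq.2

/-- A pair of functions given near the fundamental domain by smooth formulas, one of which is the
vertical derivative of the other, is a coboundary with its transfer function. -/
theorem isSmoothCoboundary_of_local {f ψ W V : Torus4 × ℝ → ℝ} {δ : ℝ} (hδ : 0 < δ)
    (hW : ContDiff ℝ ∞ fun p => W (projProd p)) (hV : ContDiff ℝ ∞ fun p => V (projProd p))
    (hf : ∀ x v, -δ < v → v < φ x → f (cover α φ (x, v)) = W (x, v))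
    (hψ : ∀ x v, -δ < v → v < φ x → ψ (cover α φ (x, v)) = V (x, v))
    (hd : ∀ x v, HasDerivAt (fun v => V (x, v)) (W (x, v)) v) : IsSmoothCoboundary α φ f ψ := by
  have hfs := smoothOnPhase_of_local h hδ hW hf
  refine ⟨hfs, smoothOnPhase_of_local h hδ hV hψ, fun z hz a b _ => ?_⟩
  have hcont : Continuous fun z => f (cover α φ z) :=
    continuous_of_lift (hfs.of_le (by exact_mod_cast le_top))
  have hder : ∀ (x : Torus4) (u : ℝ),
      HasDerivAt (fun u => ψ (cover α φ (x, u))) (f (cover α φ (x, u))) u := by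
    intro x u
    obtain ⟨y, rfl⟩ := isOpenQuotientMap_proj.surjective x
    obtain ⟨n, hn⟩ := exists_deck_eventually (α := α) h hδ (y, u)
    have hn0 := hn.self_of_nhds
    have h1 := (hd (proj y + n • proj α) (u - birkhoff α φ n (proj y))).comp_sub_const u
      (birkhoff α φ n (proj y))
    have h2 : f (cover α φ (proj y, u)) =
        W (proj y + n • proj α, u - birkhoff α φ n (proj y)) := by
      rw [← cover_deck h.pos h.le n]
      exact hf _ _ hn0.1 hn0.2
    rw [h2]
    refine h1.congr_of_eventuallyEq ?_
    have h3 : Tendsto (fun v : ℝ => (y, v)) (𝓝 u) (𝓝 (y, u)) :=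
      (Continuous.prodMk_right y).tendsto u
    filter_upwards [h3.eventually hn] with v hv
    rw [← cover_deck h.pos h.le n]
    exact hψ _ _ hv.1 hv.2
  simp_rw [flow_eq_cover]
  rw [intervalIntegral.integral_eq_sub_of_hasDerivAt
    (f := fun t => ψ (cover α φ (z.1, t + z.2)))]
  · intro t _
    exact (hder z.1 (t + z.2)).comp_add_const t z.2
  · exact (hcont.comp (g := fun z => f (cover α φ z))
      (f := fun t => (z.1, t + z.2)) (by fun_prop)).intervalIntegrable _ _

omit h in
theorem continuous_cover_of_smoothOnPhase {f : Torus4 × ℝ → ℝ} (hf : SmoothOnPhase α φ f) :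
    Continuous fun z => f (cover α φ z) :=
  continuous_of_lift (hf.of_le (by exact_mod_cast le_top))

/-- The points just below the base belong to the top of the fundamental domain. -/
theorem cover_of_neg {x : Torus4} {v : ℝ} (h1 : -c < v) (h2 : v < 0) :
    cover α φ (x, v) = (x - proj α, v + φ (x - proj α)) := by
  have h3 : deck α φ (-1) (x, v) = (x - proj α, v + φ (x - proj α)) := by
    have h4 := birkhoff_add (α := α) (φ := φ) (-1) 1 x
    rw [neg_add_cancel, birkhoff_zero, birkhoff_one, neg_one_zsmul, ← sub_eq_add_neg] at h4
    simp only [deck, neg_one_zsmul, ← sub_eq_add_neg, Prod.mk.injEq, true_and]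
    linarith
  rw [cover_eq_deck h.pos h.le (n := -1), h3]
  rw [h3]
  exact ⟨by simp only; linarith [h.le (x - proj α)], by simp only; linarith⟩

/-- The points just above the ceiling belong to the bottom of the fundamental domain. -/
theorem cover_of_ge {x : Torus4} {v : ℝ} (h1 : φ x ≤ v) (h2 : v < φ x + c) :
    cover α φ (x, v) = (x + proj α, v - φ x) := by
  have h3 : deck α φ 1 (x, v) = (x + proj α, v - φ x) := by
    simp only [deck, one_zsmul, birkhoff_one]
  rw [cover_eq_deck h.pos h.le (n := 1), h3]
  rw [h3]
  exact ⟨by simp only; linarith, by simp only; linarith [h.le (x + proj α)]⟩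

theorem smoothOnPhase_bump {a : Torus4 → ℝ} (ha : ContDiff ℝ ∞ fun x => a (proj x)) {χ : ℝ → ℝ}
    (hχ : IsBump c χ) : SmoothOnPhase α φ fun z => a z.1 * χ z.2 := by
  obtain ⟨δ, hδ, hδc, hsupp⟩ := hχ.supp
  refine smoothOnPhase_of_local h hδ (W := fun z => a z.1 * χ z.2) ?_ fun x v h1 h2 => ?_
  · exact (ha.comp contDiff_fst).mul (hχ.smooth.comp contDiff_snd)
  · rcases lt_or_ge v 0 with hv | hv
    · rw [cover_of_neg h (by linarith) hv]
      simp only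
      rw [hsupp v (fun hm => by linarith [hm.1]), hsupp (v + φ (x - proj α))
        (fun hm => by linarith [hm.2, h.le (x - proj α)]), mul_zero, mul_zero]
    · rw [cover_of_mem h.pos h.le ⟨hv, h2⟩]

/-- The product of a function `a` on the torus and of a bump function in the fibre is a coboundary
as soon as its integrals over the fibres are a coboundary `b(x + α) - b(x)` of the translation. -/
theorem exists_isSmoothCoboundary_bump {a b : Torus4 → ℝ} (ha : ContDiff ℝ ∞ fun x => a (proj x))
    (hb : ContDiff ℝ ∞ fun x => b (proj x)) {χ : ℝ → ℝ} (hχ : IsBump c χ)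
    (hab : ∀ x, (b (x + proj α) - b x) * ∫ s, χ s = a x * ∫ s, χ s) :
    ∃ ψ, IsSmoothCoboundary α φ (fun z => a z.1 * χ z.2) ψ := by
  obtain ⟨δ, hδ, hδc, hsupp⟩ := hχ.supp
  set J := ∫ s, χ s with hJ
  set X : ℝ → ℝ := fun s => ∫ r in (0 : ℝ)..s, χ r with hX
  have hχc := hχ.smooth.continuous
  have hXd : ∀ s, HasDerivAt X (χ s) s := fun s => hχc.integral_hasStrictDerivAt 0 s |>.hasDerivAt
  have hXs : ContDiff ℝ ∞ X := by
    rw [contDiff_infty_iff_deriv]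
    refine ⟨fun s => (hXd s).differentiableAt, ?_⟩
    have : deriv X = χ := funext fun s => (hXd s).deriv
    rw [this]; exact hχ.smooth
  have hX0 : ∀ s, s < δ → X s = 0 := fun s hs => by
    refine intervalIntegral.integral_zero_ae (ae_of_all _ fun r hr => ?_)
    refine hsupp r fun hm => ?_
    rcases mem_uIoc.1 hr with h1 | h1 <;> linarith [h1.2, hm.1]
  have hX1 : ∀ s, c - δ < s → X s = J := fun s hs => by
    have hs0 : 0 ≤ s := by linarith
    rw [hX, hJ]
    simp only
    rw [intervalIntegral.integral_of_le hs0, setIntegral_eq_integral_of_forall_compl_eq_zero]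
    intro r hr
    refine hsupp r fun hm => hr ⟨by linarith [hm.1], by linarith [hm.2]⟩
  refine ⟨fun z => b z.1 * J + a z.1 * X z.2, isSmoothCoboundary_of_local h hδ
    (W := fun z => a z.1 * χ z.2) (V := fun z => b z.1 * J + a z.1 * X z.2) ?_ ?_ ?_ ?_ ?_⟩
  · exact (ha.comp contDiff_fst).mul (hχ.smooth.comp contDiff_snd)
  · exact ((hb.comp contDiff_fst).mul contDiff_const).add
      ((ha.comp contDiff_fst).mul (hXs.comp contDiff_snd))
  · intro x v h1 h2
    rcases lt_or_ge v 0 with hv | hv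
    · rw [cover_of_neg h (by linarith) hv]
      simp only
      rw [hsupp v (fun hm => by linarith [hm.1]), hsupp (v + φ (x - proj α))
        (fun hm => by linarith [hm.2, h.le (x - proj α)]), mul_zero, mul_zero]
    · rw [cover_of_mem h.pos h.le ⟨hv, h2⟩]
  · intro x v h1 h2
    rcases lt_or_ge v 0 with hv | hv
    · rw [cover_of_neg h (by linarith) hv]
      simp only
      have h3 := hab (x - proj α)
      rw [sub_add_cancel] at h3
      rw [hX0 v (by linarith), hX1 (v + φ (x - proj α)) (by linarith [h.le (x - proj α)])]
      linarith
    · rw [cover_of_mem h.pos h.le ⟨hv, h2⟩]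
  · intro x v
    change HasDerivAt (fun v => b x * J + a x * X v) (a x * χ v) v
    exact ((hXd v).const_mul (a x)).const_add _

end Local

/-! ### Square integrable correlations -/

theorem integrableOn_sq_rpow :
    IntegrableOn (fun t : ℝ => (|t| ^ (-5 / 8 : ℝ)) ^ 2) {t : ℝ | 1 ≤ |t|} := by
  have h1 : IntegrableOn (fun t : ℝ => (|t| ^ (-5 / 8 : ℝ)) ^ 2) (Ici 1) := by
    rw [integrableOn_Ici_iff_integrableOn_Ioi]
    refine (integrableOn_Ioi_rpow_of_lt (show (-5 / 4 : ℝ) < -1 by norm_num) one_pos).congr_fun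
      (fun t ht => ?_) measurableSet_Ioi
    have ht0 : 0 < t := one_pos.trans ht
    simp only [abs_of_pos ht0]
    rw [← Real.rpow_natCast, ← Real.rpow_mul ht0.le]
    norm_num
  have h2 : {t : ℝ | 1 ≤ |t|} = Iic (-1) ∪ Ici 1 := by
    ext t
    simp only [Set.mem_ofPred_eq, mem_union, mem_Iic, mem_Ici, le_abs']
  rw [h2]
  refine IntegrableOn.union ?_ h1
  have h3 := (MeasurePreserving.integrableOn_comp_preimage (Measure.measurePreserving_neg
    (volume : Measure ℝ)) (Homeomorph.neg ℝ).measurableEmbedding).2 h1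
  have h4 : (fun t : ℝ => -t) ⁻¹' Ici 1 = Iic (-1) := by
    ext t; simp only [mem_preimage, mem_Ici, mem_Iic]; constructor <;> intro <;> linarith
  change IntegrableOn _ ((fun t : ℝ => -t) ⁻¹' Ici 1) at h3
  rw [h4] at h3
  simpa only [Function.comp_def, abs_neg] using h3

theorem memLp_two_of_decay {r : ℝ → ℝ} (hr : Continuous r) {C : ℝ}
    (hC : ∀ t, t ≠ 0 → |r t| ≤ C * |t| ^ (-5 / 8 : ℝ)) : MemLp r 2 := by
  rw [memLp_two_iff_integrable_sq_norm hr.aestronglyMeasurable]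
  rw [← integrableOn_univ, ← union_compl_self {t : ℝ | 1 ≤ |t|}]
  have hm : MeasurableSet {t : ℝ | 1 ≤ |t|} := measurableSet_le measurable_const continuous_abs.measurable
  refine IntegrableOn.union ?_ ?_
  · refine Integrable.mono' (integrableOn_sq_rpow.const_mul (C ^ 2))
      (hr.norm.pow 2).aestronglyMeasurable ?_
    refine (ae_restrict_iff' hm).2 (ae_of_all _ fun t ht => ?_)
    have ht0 : t ≠ 0 := fun h0 => by
      rw [h0, Set.mem_ofPred_eq, abs_zero] at ht; linarith
    rw [Real.norm_of_nonneg (by positivity), ← mul_pow]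
    exact pow_le_pow_left₀ (norm_nonneg _) (hC t ht0) 2
  · have h1 : {t : ℝ | 1 ≤ |t|}ᶜ ⊆ Icc (-1) 1 := fun t ht => by
      rw [mem_compl_iff, Set.mem_ofPred_eq, not_le] at ht
      exact abs_le.1 ht.le
    exact ((hr.norm.pow 2).continuousOn.integrableOn_compact isCompact_Icc).mono_set h1

theorem integral_comp_measurePreserving {X : Type*} [MeasurableSpace X] {μ : Measure X}
    {T : X → X} (hT : MeasurePreserving T μ μ) {f : X → ℂ} (hf : AEStronglyMeasurable f μ) :
    ∫ z, f (T z) ∂μ = ∫ z, f z ∂μ := by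
  rw [← integral_map hT.measurable.aemeasurable (by rwa [hT.map_eq]), hT.map_eq]

section Regularity

variable {α : Fin 4 → ℝ} {φ : Torus4 → ℝ} {dφ : Fin 4 → UnitAddCircle → ℝ} {c Φ : ℝ}
  (h : IsRoof φ dφ c Φ)
include h

theorem ae_mem_phase : ∀ᵐ z ∂phaseMeasure φ, z ∈ phase φ :=
  ae_restrict_mem (measurableSet_phase h.cont)

theorem aestronglyMeasurable_of_smoothOnPhase {f : Torus4 × ℝ → ℝ} (hf : SmoothOnPhase α φ f) :
    AEStronglyMeasurable f (phaseMeasure φ) := by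
  refine (continuous_cover_of_smoothOnPhase hf).aestronglyMeasurable.congr ?_
  filter_upwards [ae_mem_phase h] with z hz
  rw [cover_of_mem h.pos h.le hz]

theorem memLp_of_smoothOnPhase {f : Torus4 × ℝ → ℝ} (hf : SmoothOnPhase α φ f) {p : ENNReal} :
    MemLp (fun z => (f z : ℂ)) p (phaseMeasure φ) := by
  have := isFiniteMeasure_phaseMeasure h.ge
  obtain ⟨B, hB⟩ := exists_bound_of_smoothOnPhase h hf
  refine MemLp.of_bound (Complex.continuous_ofReal.comp_aestronglyMeasurable
    (aestronglyMeasurable_of_smoothOnPhase h hf)) B ?_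
  filter_upwards [ae_mem_phase h] with z hz
  rw [Complex.norm_real]
  exact hB z hz

theorem smoothOnPhase_flow {f : Torus4 × ℝ → ℝ} (hf : SmoothOnPhase α φ f) (a : ℝ) :
    SmoothOnPhase α φ fun z => f (flow α φ a z) := by
  have h1 : (fun p : (Fin 4 → ℝ) × ℝ => f (flow α φ a (cover α φ (projProd p)))) =
      fun p => f (cover α φ (projProd (p.1, a + p.2))) := by
    ext p; simp only [projProd, flow_cover h.pos h.le]
  change ContDiff ℝ ∞ fun p : (Fin 4 → ℝ) × ℝ => f (flow α φ a (cover α φ (projProd p)))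
  rw [h1]
  have h2 : ContDiff ℝ ∞ fun p => f (cover α φ (projProd p)) := hf
  exact h2.comp (g := fun p => f (cover α φ (projProd p)))
    (contDiff_fst.prodMk (contDiff_const.add contDiff_snd))

theorem isSmoothCoboundary_flow {f ψ : Torus4 × ℝ → ℝ} (hf : IsSmoothCoboundary α φ f ψ) (a : ℝ) :
    IsSmoothCoboundary α φ (fun z => f (flow α φ a z)) fun z => ψ (flow α φ a z) := by
  refine ⟨smoothOnPhase_flow h hf.1 a, smoothOnPhase_flow h hf.2.1 a, fun z _ r s hrs => ?_⟩
  have h1 (t : ℝ) : flow α φ a (flow α φ t z) = flow α φ t (flow α φ a z) := by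
    rw [← flow_add h.pos h.le, ← flow_add h.pos h.le, add_comm]
  simp only [h1]
  exact hf.2.2 _ (flow_mem_phase h.pos h.le a z) r s hrs

omit h in
theorem continuous_flow_of_smoothOnPhase {f : Torus4 × ℝ → ℝ} (hf : SmoothOnPhase α φ f)
    (z : Torus4 × ℝ) : Continuous fun t => f (flow α φ t z) := by
  simp_rw [flow_eq_cover]
  exact (continuous_cover_of_smoothOnPhase hf).comp (g := fun z => f (cover α φ z))
    (f := fun t => (z.1, t + z.2)) (by fun_prop)

/-- The correlations of `f` with `g ∘ T^b` are those of `f` with `g` at the times shifted by `b`,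
hence square integrable if the latter decay like `|t| ^ (-5/8)`. -/
theorem memLp_correlation {f g : Torus4 × ℝ → ℝ} (hf : SmoothOnPhase α φ f)
    (hg : SmoothOnPhase α φ g) {C : ℝ}
    (hC : ∀ t : ℝ, t ≠ 0 → |∫ z, f (flow α φ t z) * g z ∂phaseMeasure φ| ≤
      C * |t| ^ (-5 / 8 : ℝ)) (b : ℝ) :
    MemLp (fun t => ∫ z, ((f (flow α φ t z) : ℝ) : ℂ) *
      conj ((g (flow α φ b z) : ℝ) : ℂ) ∂phaseMeasure φ) 2 := by
  have := isFiniteMeasure_phaseMeasure h.ge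
  obtain ⟨Bf, hBf⟩ := exists_bound_of_smoothOnPhase h hf
  obtain ⟨Bg, hBg⟩ := exists_bound_of_smoothOnPhase h hg
  set r : ℝ → ℝ := fun t => ∫ z, f (flow α φ t z) * g z ∂phaseMeasure φ with hr
  have hmeas (t : ℝ) : AEStronglyMeasurable (fun z => f (flow α φ t z) * g z) (phaseMeasure φ) :=
    (aestronglyMeasurable_of_smoothOnPhase h (smoothOnPhase_flow h hf t)).mul
      (aestronglyMeasurable_of_smoothOnPhase h hg)
  have hbd (t : ℝ) : ∀ᵐ z ∂phaseMeasure φ, ‖f (flow α φ t z) * g z‖ ≤ Bf * Bg := by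
    filter_upwards [ae_mem_phase h] with z hz
    have h1 := hBf _ (flow_mem_phase (α := α) h.pos h.le t z)
    rw [norm_mul]
    exact mul_le_mul h1 (hBg z hz) (norm_nonneg _) ((abs_nonneg _).trans h1)
  have hcont : Continuous r := by
    refine continuous_of_dominated hmeas hbd (integrable_const _) (ae_of_all _ fun z => ?_)
    exact (continuous_flow_of_smoothOnPhase hf z).mul continuous_const
  have hmem : MemLp r 2 := memLp_two_of_decay hcont hC
  have hshift : MemLp (fun t => r (t - b)) 2 :=
    hmem.comp_measurePreserving (measurePreserving_sub_right volume b)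
  have hshift' : MemLp (fun t => ((r (t - b) : ℝ) : ℂ)) 2 := hshift.ofReal
  have heq : (fun t => ∫ z, ((f (flow α φ t z) : ℝ) : ℂ) *
      conj ((g (flow α φ b z) : ℝ) : ℂ) ∂phaseMeasure φ) = fun t => ((r (t - b) : ℝ) : ℂ) := by
    funext t
    have h1 := integral_comp_measurePreserving
      (measurePreserving_flow (α := α) h.cont h.pos h.le b)
      (Complex.continuous_ofReal.comp_aestronglyMeasurable (hmeas (t - b)))
    refine Eq.trans (integral_congr_ae (ae_of_all _ fun z => ?_)) (h1.trans integral_ofReal)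
    simp only [Complex.conj_ofReal, ← Complex.ofReal_mul, ← flow_add h.pos h.le,
      sub_add_cancel]
  rw [heq]
  exact hshift'

end Regularity

/-! ### Totality and absolutely continuous spectrum -/

theorem IsBump.eq_zero {c : ℝ} {χ : ℝ → ℝ} (hχ : IsBump c χ) {s : ℝ} (hs : s ∉ Ioo 0 c) :
    χ s = 0 := by
  obtain ⟨δ, hδ, -, hsupp⟩ := hχ.supp
  exact hsupp s fun hm => hs ⟨by linarith [hm.1], by linarith [hm.2]⟩

theorem IsBump.linear {c : ℝ} {χ χ' : ℝ → ℝ} (hχ : IsBump c χ) (hχ' : IsBump c χ') (p q : ℝ) :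
    IsBump c fun s => p * χ s - q * χ' s := by
  obtain ⟨δ, hδ, hδc, hsupp⟩ := hχ.supp
  obtain ⟨δ', hδ', hδc', hsupp'⟩ := hχ'.supp
  refine ⟨(contDiff_const.mul hχ.smooth).sub (contDiff_const.mul hχ'.smooth), min δ δ',
    lt_min hδ hδ', (min_le_left _ _).trans hδc, fun s hs => ?_⟩
  have h1 := min_le_left δ δ'
  have h2 := min_le_right δ δ'
  rw [hsupp s fun hm => hs ⟨by linarith [hm.1], by linarith [hm.2]⟩,
    hsupp' s fun hm => hs ⟨by linarith [hm.1], by linarith [hm.2]⟩, mul_zero, mul_zero, sub_zero]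

theorem IsBump.integrable {c : ℝ} {χ : ℝ → ℝ} (hχ : IsBump c χ) : Integrable χ := by
  obtain ⟨δ, hδ, -, hsupp⟩ := hχ.supp
  exact hχ.smooth.continuous.integrable_of_hasCompactSupport
    (HasCompactSupport.intro isCompact_Icc hsupp)

theorem exists_isBump_integral_eq_one {c : ℝ} (hc : 0 < c) : ∃ χ : ℝ → ℝ, ContDiff ℝ ∞ χ ∧
    (∀ s, s ∉ Icc (c / 4) (3 * c / 4) → χ s = 0) ∧ ∫ s, χ s = 1 := by
  let B : ContDiffBump (c / 2) := ⟨c / 8, c / 4, by positivity, by linarith⟩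
  refine ⟨B.normed volume, B.contDiff_normed, fun s hs => ?_, B.integral_normed⟩
  by_contra h0
  have h1 : s ∈ Function.support (B.normed volume) := h0
  rw [B.support_normed_eq, Metric.mem_ball, Real.dist_eq] at h1
  have h2 := abs_lt.1 (show |s - c / 2| < c / 4 from h1)
  exact hs ⟨by linarith [h2.1], by linarith [h2.2]⟩

/-- A nontrivial trigonometric monomial is a coboundary of the translation by `α`, hence has zero
integral. -/
theorem exists_trig_add_sub_eq {α : Fin 4 → ℝ} (hα : α ∈ freqSet) {k : Fin 4 → ℤ} (hk : k ≠ 0)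
    (w : ℂ) : ∃ w', (∀ x, trig k w' (x + proj α) - trig k w' x = trig k w x) ∧
      ∫ x, trig k w x = 0 := by
  have h1 := sub_ne_zero.2 (charValue_ne_one hα hk)
  have h2 (x : Torus4) : trig k (w / (charValue α k - 1)) (x + proj α) -
      trig k (w / (charValue α k - 1)) x = trig k w x := by
    rw [trig_add_apply, ← trig_sub]
    congr 1
    field_simp
  refine ⟨_, h2, ?_⟩
  have h3 : Integrable (trig k (w / (charValue α k - 1))) :=
    continuous_integrable (continuous_trig _ _)
  simp_rw [← h2]
  rw [integral_sub (h3.comp_add_right (proj α)) h3, integral_add_right_eq_self, sub_self]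

section Totality

variable {α : Fin 4 → ℝ} {φ : Torus4 → ℝ} {dφ : Fin 4 → UnitAddCircle → ℝ} {c Φ : ℝ}
  (h : IsRoof φ dφ c Φ)

theorem isC1OnPhase_bump {k : Fin 4 → ℤ} {w : ℂ} {χ : ℝ → ℝ} (hχ : IsBump c χ) :
    IsC1OnPhase φ fun z => trig k w z.1 * χ z.2 := by
  have h1 : ContDiff ℝ ∞ fun p : (Fin 4 → ℝ) × ℝ => trig k w (proj p.1) * χ p.2 :=
    ((contDiff_trig k w).comp contDiff_fst).mul (hχ.smooth.comp contDiff_snd)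
  exact (h1.of_le (by exact_mod_cast le_top)).contDiffOn

include h

theorem exists_supportedInZeta_bump {a : Torus4 → ℝ} {χ : ℝ → ℝ} (hχ : IsBump c χ) :
    ∃ ζ > 0, SupportedInZeta φ ζ fun z => a z.1 * χ z.2 := by
  obtain ⟨δ, hδ, hδc, hsupp⟩ := hχ.supp
  refine ⟨δ, hδ, fun z hz hne => ⟨hz, hz.1, ?_⟩⟩
  by_contra hcon
  refine hne ?_
  simp only
  rw [hsupp z.2 fun hm => hcon (by linarith [hm.2, h.le z.1]), mul_zero]

theorem integrable_mul_of_smoothOnPhase {H : Torus4 × ℝ → ℂ} (hH : MemLp H 2 (phaseMeasure φ))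
    {f : Torus4 × ℝ → ℝ} (hf : SmoothOnPhase α φ f) :
    Integrable (fun z => H z * (f z : ℂ)) (phaseMeasure φ) :=
  MemLp.integrable_mul (p := 2) (q := 2) hH (memLp_of_smoothOnPhase h hf)

theorem integral_phaseMeasure_eq_prod {F : Torus4 × ℝ → ℂ} (hF : ∀ z, z.2 ∉ Ioo 0 c → F z = 0) :
    ∫ z, F z ∂phaseMeasure φ = ∫ z, F z ∂(volume.prod (volume.restrict (Ioo 0 c))) := by
  have h1 : (volume : Measure Torus4).prod ((volume : Measure ℝ).restrict (Ioo 0 c)) =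
      (volume : Measure (Torus4 × ℝ)).restrict (univ ×ˢ Ioo 0 c) := by
    rw [Measure.volume_eq_prod, ← Measure.prod_restrict, Measure.restrict_univ]
  rw [h1, phaseMeasure, setIntegral_eq_integral_of_forall_compl_eq_zero,
    setIntegral_eq_integral_of_forall_compl_eq_zero]
  · exact fun z hz => hF z fun hm => hz ⟨mem_univ _, hm⟩
  · exact fun z hz => hF z fun hm => hz ⟨hm.1.le, hm.2.trans_le (h.le _)⟩

theorem integral_bump (a : Torus4 → ℝ) {χ : ℝ → ℝ} (hχ : IsBump c χ) :
    ∫ z, ((a z.1 * χ z.2 : ℝ) : ℂ) ∂phaseMeasure φ = ((∫ x, a x) * ∫ s, χ s : ℝ) := by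
  have h1 : ∀ z : Torus4 × ℝ, z.2 ∉ Ioo 0 c → a z.1 * χ z.2 = 0 := fun z hz => by
    rw [hχ.eq_zero hz, mul_zero]
  rw [integral_complex_ofReal, phaseMeasure, setIntegral_eq_integral_of_forall_compl_eq_zero,
    Measure.volume_eq_prod, integral_prod_mul]
  exact fun z hz => h1 z fun hm => hz ⟨hm.1.le, hm.2.trans_le (h.le _)⟩

/-- The products of characters of the torus and bump functions in the fibre are total over the
part of the phase space below the minimum of the roof: the Fourier coefficients of almost every
horizontal slice vanish. -/
theorem ae_eq_zero_of_integral_trig_bump {H : Torus4 × ℝ → ℂ} (hH : MemLp H 2 (phaseMeasure φ))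
    (hint : ∀ k w χ, IsBump c χ →
      ∫ z, H z * ((trig k w z.1 * χ z.2 : ℝ) : ℂ) ∂phaseMeasure φ = 0) :
    ∀ᵐ z ∂phaseMeasure φ, z.2 ∈ Ioo 0 c → H z = 0 := by
  set ν : Measure ℝ := volume.restrict (Ioo 0 c) with hν
  have hprod : (volume : Measure Torus4).prod ν =
      (volume : Measure (Torus4 × ℝ)).restrict (univ ×ˢ Ioo 0 c) := by
    rw [Measure.volume_eq_prod, ← Measure.prod_restrict, Measure.restrict_univ]
  have hS : (univ ×ˢ Ioo 0 c : Set (Torus4 × ℝ)) ⊆ phase φ := fun z hz =>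
    ⟨hz.2.1.le, hz.2.2.trans_le (h.le _)⟩
  have hfin : IsFiniteMeasure ν := ⟨by rw [hν, Measure.restrict_apply_univ]; simp⟩
  have hH2 : MemLp H 2 ((volume : Measure Torus4).prod ν) := by
    rw [hprod]; exact hH.mono_measure (Measure.restrict_mono hS le_rfl)
  have hH1 : Integrable H ((volume : Measure Torus4).prod ν) := hH2.integrable (by norm_num)
  have hHsq := (memLp_two_iff_integrable_sq_norm hH2.1).1 hH2
  have hHk (k : Fin 4 → ℤ) : Integrable (fun z => H z * UnitAddTorus.mFourier k z.1)
      ((volume : Measure Torus4).prod ν) := by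
    refine hH1.mul_bdd (c := ‖UnitAddTorus.mFourier k‖)
      ((UnitAddTorus.mFourier k).continuous.comp continuous_fst).aestronglyMeasurable ?_
    exact ae_of_all _ fun z => (UnitAddTorus.mFourier k).norm_coe_le_norm _
  have hA (k : Fin 4 → ℤ) : ∀ᵐ s ∂ν, ∫ x, H (x, s) * UnitAddTorus.mFourier k x = 0 := by
    have h1 : Integrable (fun s => ∫ x, H (x, s) * UnitAddTorus.mFourier k x) ν :=
      (hHk k).integral_prod_right
    rw [hν, ae_restrict_iff' measurableSet_Ioo]
    refine isOpen_Ioo.ae_eq_zero_of_integral_contDiff_smul_eq_zero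
      (IntegrableOn.locallyIntegrableOn h1) fun χ hχ1 hχ2 hχ3 => ?_
    have hχ := isBump_of_tsupport h.pos hχ1 hχ2 hχ3
    obtain ⟨B, hB⟩ := hχ2.exists_bound_of_continuous hχ1.continuous
    have h2 : ∫ z, (χ z.2 : ℂ) * (H z * UnitAddTorus.mFourier k z.1)
        ∂((volume : Measure Torus4).prod ν) = 0 := by
      rw [hν, ← integral_phaseMeasure_eq_prod h fun z hz => by
        rw [hχ.eq_zero hz, Complex.ofReal_zero, zero_mul]]
      have h3 (z : Torus4 × ℝ) : (χ z.2 : ℂ) * (H z * UnitAddTorus.mFourier k z.1) =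
          H z * ((trig k 1 z.1 * χ z.2 : ℝ) : ℂ) +
            Complex.I * (H z * ((trig k (-Complex.I) z.1 * χ z.2 : ℝ) : ℂ)) := by
        have h4 : UnitAddTorus.mFourier k z.1 =
            ((trig k 1 z.1 : ℝ) : ℂ) + ((trig k (-Complex.I) z.1 : ℝ) : ℂ) * Complex.I := by
          simp [trig]
        rw [h4]; push_cast; ring
      have h5 (w : ℂ) := integrable_mul_of_smoothOnPhase h hH
        (smoothOnPhase_bump (α := 0) h (contDiff_trig k w) hχ)
      simp_rw [h3]
      rw [integral_add (h5 _) ((h5 _).const_mul _), integral_const_mul, hint _ _ _ hχ,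
        hint _ _ _ hχ, mul_zero, add_zero]
    rw [integral_prod_symm] at h2
    · simp only [integral_const_mul] at h2
      rw [hν, setIntegral_eq_integral_of_forall_compl_eq_zero] at h2
      · exact h2
      · intro s hs
        rw [hχ.eq_zero hs, Complex.ofReal_zero, zero_mul]
    · refine (hHk k).bdd_mul (c := B) ?_ (ae_of_all _ fun z => ?_)
      · exact (Complex.continuous_ofReal.comp
          (hχ1.continuous.comp continuous_snd)).aestronglyMeasurable
      · rw [Complex.norm_real]; exact hB _
  have hslice : ∀ᵐ s ∂ν, (fun x => H (x, s)) =ᵐ[volume] 0 := by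
    filter_upwards [ae_all_iff.2 hA, hH1.prod_left_ae, hHsq.prod_left_ae] with s h1 h2 h3
    exact ae_eq_zero_of_mFourier ((memLp_two_iff_integrable_sq_norm h2.1).2 h3) h1
  have hzero : ∫ z, ‖H z‖ ∂((volume : Measure Torus4).prod ν) = 0 := by
    rw [integral_prod_symm _ hH1.norm]
    refine integral_eq_zero_of_ae ?_
    filter_upwards [hslice] with s hs
    refine integral_eq_zero_of_ae ?_
    filter_upwards [hs] with x hx
    rw [hx, Pi.zero_apply, norm_zero]; rfl
  rw [integral_eq_zero_iff_of_nonneg (fun z => norm_nonneg _) hH1.norm, hprod] at hzero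
  have h1 := (ae_restrict_iff' (MeasurableSet.univ.prod measurableSet_Ioo)).1 hzero
  refine ae_restrict_of_ae ?_
  filter_upwards [h1] with z hz hz2
  simpa using hz ⟨mem_univ _, hz2⟩

/-- The translates under the flow of the products of characters and bump functions are total:
every point of the phase space is brought below the minimum of the roof by some rational time. -/
theorem ae_eq_zero_of_integral_flow_trig_bump {H : Torus4 × ℝ → ℂ}
    (hH : MemLp H 2 (phaseMeasure φ))
    (hint : ∀ k w χ b, IsBump c χ → ∫ z, H z *
      ((trig k w (flow α φ b z).1 * χ (flow α φ b z).2 : ℝ) : ℂ) ∂phaseMeasure φ = 0) :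
    H =ᵐ[phaseMeasure φ] 0 := by
  have hmp (b : ℝ) := measurePreserving_flow (α := α) h.cont h.pos h.le b
  have h1 (b : ℝ) : ∀ᵐ z ∂phaseMeasure φ, z.2 ∈ Ioo 0 c → H (flow α φ (-b) z) = 0 := by
    refine ae_eq_zero_of_integral_trig_bump h (hH.comp_measurePreserving (hmp (-b)))
      fun k w χ hχ => ?_
    have h2 := memLp_of_smoothOnPhase (α := α) (p := 2) h
      (smoothOnPhase_bump h (contDiff_trig k w) hχ)
    rw [← hint k w χ b hχ]
    refine (integral_comp_measurePreserving (hmp b)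
      ((hH.comp_measurePreserving (hmp (-b))).1.mul h2.1)).symm.trans ?_
    refine integral_congr_ae ?_
    filter_upwards [ae_mem_phase h] with z hz
    simp only [Pi.mul_apply, Function.comp_apply, ← flow_add h.pos h.le, neg_add_cancel,
      flow_zero h.pos h.le hz]
  have h2 : ∀ᵐ z ∂phaseMeasure φ, ∀ b : ℚ, (flow α φ b z).2 ∈ Ioo 0 c →
      H (flow α φ (-b) (flow α φ b z)) = 0 :=
    ae_all_iff.2 fun b => (hmp b).quasiMeasurePreserving.ae (h1 b)
  filter_upwards [ae_mem_phase h, h2] with z hz h3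
  obtain ⟨b, hb1, hb2⟩ := exists_rat_btwn (show -z.2 < c - z.2 by linarith [h.pos])
  have h4 : flow α φ b z = (z.1, b + z.2) := by
    rw [flow_eq_cover]
    exact cover_of_mem h.pos h.le ⟨by simp only; linarith, by simp only; linarith [h.le z.1]⟩
  have h5 := h3 b (by rw [h4]; exact ⟨by simp only; linarith, by simp only; linarith⟩)
  rwa [← flow_add h.pos h.le, neg_add_cancel, flow_zero h.pos h.le hz] at h5

/-- A function which is orthogonal to every smooth coboundary is constant. Bump functions of
integral zero are coboundaries, so its integral against a bump function in the fibre depends only on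
the integral of the bump function, hence does not change when the bump function is moved by the
flow; the nontrivial characters times bump functions are coboundaries themselves. -/
theorem exists_ae_eq_const_of_orthogonal (hα : α ∈ freqSet) {H : Torus4 × ℝ → ℂ}
    (hH : MemLp H 2 (phaseMeasure φ))
    (hint : ∀ f ψ, IsSmoothCoboundary α φ f ψ → ∫ z, H z * (f z : ℂ) ∂phaseMeasure φ = 0) :
    ∃ κ : ℂ, H =ᵐ[phaseMeasure φ] fun _ => κ := by
  have hfin := isFiniteMeasure_phaseMeasure h.ge
  have hcob {a b : Torus4 → ℝ} (ha : ContDiff ℝ ∞ fun x => a (proj x))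
      (hb : ContDiff ℝ ∞ fun x => b (proj x)) {χ : ℝ → ℝ} (hχ : IsBump c χ)
      (hab : ∀ x, (b (x + proj α) - b x) * ∫ s, χ s = a x * ∫ s, χ s) (r : ℝ) :
      ∫ z, H z * ((a (flow α φ r z).1 * χ (flow α φ r z).2 : ℝ) : ℂ) ∂phaseMeasure φ = 0 := by
    obtain ⟨ψ, hψ⟩ := exists_isSmoothCoboundary_bump h ha hb hχ hab
    exact hint _ _ (isSmoothCoboundary_flow h hψ r)
  set J : ℝ → (ℝ → ℝ) → ℂ := fun r χ =>
    ∫ z, H z * ((χ (flow α φ r z).2 : ℝ) : ℂ) ∂phaseMeasure φ with hJ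
  have hsm {χ : ℝ → ℝ} (hχ : IsBump c χ) (r : ℝ) :
      SmoothOnPhase α φ fun z => χ (flow α φ r z).2 := by
    have := smoothOnPhase_flow h (smoothOnPhase_bump (α := α) h
      (a := fun _ => 1) contDiff_const hχ) r
    simpa only [one_mul] using this
  have hlin {χ χ' : ℝ → ℝ} (hχ : IsBump c χ) (hχ' : IsBump c χ') (r : ℝ) :
      J r χ * ((∫ s, χ' s : ℝ) : ℂ) = J r χ' * ((∫ s, χ s : ℝ) : ℂ) := by
    have h1 : ∫ s, ((∫ s, χ' s) * χ s - (∫ s, χ s) * χ' s) = 0 := by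
      rw [integral_sub (hχ.integrable.const_mul _) (hχ'.integrable.const_mul _),
        integral_const_mul, integral_const_mul]
      ring
    have h2 := hcob (a := fun _ => 1) (b := fun _ => 0) contDiff_const contDiff_const
      (hχ.linear hχ' (∫ s, χ' s) (∫ s, χ s)) (fun x => by rw [h1, mul_zero, mul_zero]) r
    have h3 := integrable_mul_of_smoothOnPhase h hH (hsm hχ r)
    have h4 := integrable_mul_of_smoothOnPhase h hH (hsm hχ' r)
    have h5 : J r χ * ((∫ s, χ' s : ℝ) : ℂ) - J r χ' * ((∫ s, χ s : ℝ) : ℂ) = 0 := by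
      rw [← h2, hJ]
      simp only
      rw [← integral_mul_const, ← integral_mul_const, ← integral_sub (h3.mul_const _)
        (h4.mul_const _)]
      refine integral_congr_ae (ae_of_all _ fun z => ?_)
      push_cast
      ring
    exact sub_eq_zero.1 h5
  have hc := h.pos
  obtain ⟨χ₁, hχs, hsupp, hχ1⟩ := exists_isBump_integral_eq_one hc
  have hbump (τ : ℝ) (hτ : |τ| ≤ c / 8) : IsBump c fun s => χ₁ (τ + s) := by
    have := abs_le.1 hτ
    exact ⟨hχs.comp (contDiff_const.add contDiff_id), c / 8, by positivity, by linarith,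
      fun s hs => hsupp _ fun hm => hs ⟨by linarith [hm.1], by linarith [hm.2]⟩⟩
  have hb1 : IsBump c χ₁ := by
    simpa using hbump 0 (by rw [abs_zero]; positivity)
  -- for small `τ` the flow moves `χ₁` vertically inside the same fibres
  have hstep (r τ : ℝ) (hτ : |τ| ≤ c / 8) : J (τ + r) χ₁ = J r χ₁ := by
    have h1 : J (τ + r) χ₁ = J r fun s => χ₁ (τ + s) := by
      refine integral_congr_ae ?_
      filter_upwards with z
      have h2 := flow_mem_phase (α := α) h.pos h.le r z
      rw [flow_add h.pos h.le, flow_eq_cover τ]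
      set y := flow α φ r z
      have h3 := abs_le.1 hτ
      congr 2
      rcases lt_or_ge (τ + y.2) 0 with hneg | hnn
      · rw [cover_of_neg h (by linarith [h2.1]) hneg, hsupp, hsupp]
        · exact fun hm => by linarith [hm.1]
        · exact fun hm => by
            have := hm.2
            simp only at this
            linarith [h2.1, h.le (y.1 - proj α)]
      · rcases lt_or_ge (τ + y.2) (φ y.1) with hlt | hge
        · rw [cover_of_mem h.pos h.le ⟨hnn, hlt⟩]
        · rw [cover_of_ge h hge (by linarith [h2.2]), hsupp, hsupp]
          · exact fun hm => by linarith [hm.2, h.le y.1]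
          · exact fun hm => by
              have := hm.1
              simp only at this
              linarith [h2.2]
    have h2 := hlin (hbump τ hτ) hb1 r
    rw [integral_add_left_eq_self χ₁ τ, hχ1, Complex.ofReal_one, mul_one, mul_one] at h2
    rw [h1, h2]
  have hconst (r : ℝ) : J r χ₁ = J 0 χ₁ := by
    obtain ⟨n, hn⟩ := exists_nat_gt (|r| / (c / 8))
    have hn0 : (0 : ℝ) < n := lt_of_le_of_lt (by positivity) hn
    have h1 : |r / n| ≤ c / 8 := by
      rw [abs_div, abs_of_pos hn0, div_le_iff₀ hn0]
      rw [div_lt_iff₀ (by positivity)] at hn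
      linarith
    have h2 (m : ℕ) : J (m * (r / n)) χ₁ = J 0 χ₁ := by
      induction m with
      | zero => simp
      | succ m ih =>
        rw [← ih, ← hstep (m * (r / n)) _ h1]
        congr 1; push_cast; ring
    rw [← h2 n, mul_div_cancel₀ r hn0.ne']
  refine ⟨J 0 χ₁, ?_⟩
  have hκ : MemLp (fun _ : Torus4 × ℝ => J 0 χ₁) 2 (phaseMeasure φ) := memLp_const _
  have hzero := ae_eq_zero_of_integral_flow_trig_bump (α := α) h (hH.sub hκ)
    fun k w χ b hχ => ?_
  · filter_upwards [hzero] with z hz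
    exact sub_eq_zero.1 hz
  have hS : SmoothOnPhase α φ fun z => trig k w (flow α φ b z).1 * χ (flow α φ b z).2 :=
    smoothOnPhase_flow h (smoothOnPhase_bump h (contDiff_trig k w) hχ) b
  have h1 : ∫ z, ((trig k w (flow α φ b z).1 * χ (flow α φ b z).2 : ℝ) : ℂ) ∂phaseMeasure φ =
      ((∫ x, trig k w x) * ∫ s, χ s : ℝ) := by
    rw [← integral_bump h (trig k w) hχ]
    exact integral_comp_measurePreserving (measurePreserving_flow (α := α) h.cont h.pos h.le b)
      (memLp_of_smoothOnPhase (α := α) (p := 2) h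
        (smoothOnPhase_bump h (contDiff_trig k w) hχ)).1
  have h2 : ∫ z, H z * ((trig k w (flow α φ b z).1 * χ (flow α φ b z).2 : ℝ) : ℂ)
      ∂phaseMeasure φ = J 0 χ₁ * ((∫ x, trig k w x) * ∫ s, χ s : ℝ) := by
    by_cases hk : k = 0
    · have h3 (x : Torus4) : trig k w x = w.re := by
        simp [trig, hk, UnitAddTorus.mFourier_zero]
      have h4 := hlin hχ hb1 b
      rw [hχ1, Complex.ofReal_one, mul_one, hconst] at h4
      simp only [h3, integral_const, probReal_univ, one_smul]
      rw [Complex.ofReal_mul, mul_left_comm, ← h4, hJ]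
      simp only
      rw [← integral_const_mul]
      refine integral_congr_ae (ae_of_all _ fun z => ?_)
      push_cast
      ring
    · obtain ⟨w', hw', h0⟩ := exists_trig_add_sub_eq hα hk w
      rw [h0, zero_mul, Complex.ofReal_zero, mul_zero]
      exact hcob (contDiff_trig k w) (contDiff_trig k w') hχ (fun x => by rw [hw']) b
  simp only [Pi.sub_apply, sub_mul]
  rw [integral_sub (integrable_mul_of_smoothOnPhase h hH hS)
    (integrable_mul_of_smoothOnPhase h hκ hS), h2, integral_const_mul, h1, sub_self]

/-- If correlations of smooth coboundaries with compactly supported functions decay like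
`|t|^(-5/8)`, the spectrum is absolutely continuous. -/
theorem hasACMaximalSpectralType_flow (hα : α ∈ freqSet)
    (hdecay : ∀ ζ > 0, ∃ C, ∀ f ψ g : Torus4 × ℝ → ℝ, IsSmoothCoboundary α φ f ψ →
      IsC1OnPhase φ g → SupportedInZeta φ ζ g → ∀ t : ℝ, t ≠ 0 →
        |∫ z, f (flow α φ t z) * g z ∂phaseMeasure φ| ≤
          C * normN1 φ f ψ g * |t| ^ (-5 / 8 : ℝ)) :
    HasACMaximalSpectralType (flow α φ) (phaseMeasure φ) := by
  have hfin := isFiniteMeasure_phaseMeasure h.ge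
  have hS {k : Fin 4 → ℤ} {w : ℂ} {χ : ℝ → ℝ} (hχ : IsBump c χ) :
      SmoothOnPhase α φ fun z => trig k w z.1 * χ z.2 :=
    smoothOnPhase_bump h (contDiff_trig k w) hχ
  refine hasACMaximalSpectralType_of_memLp
    (D := {F | ∃ k w χ b, IsBump c χ ∧
      F = fun z => ((trig k w (flow α φ b z).1 * χ (flow α φ b z).2 : ℝ) : ℂ)})
    (W := {F | ∃ f ψ, IsSmoothCoboundary α φ f ψ ∧ F = fun z => ((f z : ℝ) : ℂ)})
    (measurePreserving_flow h.cont h.pos h.le) ?_ ?_ ?_ ?_ ?_ ?_ ?_ ?_ ?_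
  · filter_upwards [ae_mem_phase h] with z hz
    exact flow_zero h.pos h.le hz
  · intro s t
    exact ae_of_all _ fun z => by rw [add_comm, flow_add h.pos h.le]
  · rintro _ ⟨k, w, χ, b, hχ, rfl⟩
    exact memLp_of_smoothOnPhase h (smoothOnPhase_flow h (hS hχ) b)
  · rintro _ ⟨k, w, χ, b, hχ, rfl⟩
    obtain ⟨B, hB⟩ := exists_bound_of_smoothOnPhase h (smoothOnPhase_flow h (hS hχ) b)
    refine ⟨B, ?_⟩
    filter_upwards [ae_mem_phase h] with z hz
    rw [Complex.norm_real]
    exact hB z hz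
  · rintro _ ⟨k, w, χ, b, hχ, rfl⟩
    exact ae_of_all _ fun z => Complex.continuous_ofReal.comp
      (continuous_flow_of_smoothOnPhase (smoothOnPhase_flow h (hS hχ) b) z)
  · intro H hH hint
    refine ae_eq_zero_of_integral_flow_trig_bump (α := α) h hH fun k w χ b hχ => ?_
    simpa only [Complex.conj_ofReal] using hint _ ⟨k, w, χ, b, hχ, rfl⟩
  · rintro _ ⟨f, ψ, hf, rfl⟩
    exact memLp_of_smoothOnPhase h hf.1
  · intro H hH hint
    refine exists_ae_eq_const_of_orthogonal h hα hH fun f ψ hf => ?_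
    simpa only [Complex.conj_ofReal] using hint _ ⟨f, ψ, hf, rfl⟩
  · rintro _ ⟨f, ψ, hf, rfl⟩ _ ⟨k, w, χ, b, hχ, rfl⟩
    obtain ⟨ζ, hζ, hsupp⟩ := exists_supportedInZeta_bump h (a := trig k w) hχ
    obtain ⟨C, hC⟩ := hdecay ζ hζ
    exact memLp_correlation h hf.1 (hS hχ)
      (hC f ψ _ hf (isC1OnPhase_bump hχ) hsupp) b

end Totality

end SpecialFlow

end

theorem mainTheorem4 :
    ∃ ε : ℝ, 0 < ε ∧
      IntegrableOn (fun t : ℝ => (|t| ^ (-1 / 2 - ε : ℝ)) ^ 2) {t : ℝ | 1 ≤ |t|} ∧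
      ∀ α ∈ SpecialFlow.freqSet, ∀ n₀ : ℕ,
        (∀ x : SpecialFlow.Torus4, 0 < SpecialFlow.ceiling α n₀ x) →
        (∀ ζ : ℝ, 0 < ζ → ∃ C : ℝ, 0 < C ∧
          ∀ f ψ g : SpecialFlow.Torus4 × ℝ → ℝ,
            SpecialFlow.IsSmoothCoboundary α (SpecialFlow.ceiling α n₀) f ψ →
            SpecialFlow.IsC1OnPhase (SpecialFlow.ceiling α n₀) g →
            SpecialFlow.SupportedInZeta (SpecialFlow.ceiling α n₀) ζ g →
            ∀ t : ℝ, t ≠ 0 →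
              Integrable (fun z => f (SpecialFlow.flow α (SpecialFlow.ceiling α n₀) t z) * g z)
                (SpecialFlow.phaseMeasure (SpecialFlow.ceiling α n₀)) ∧
              |∫ z, f (SpecialFlow.flow α (SpecialFlow.ceiling α n₀) t z) * g z
                  ∂(SpecialFlow.phaseMeasure (SpecialFlow.ceiling α n₀))|
                ≤ C * SpecialFlow.normN1 (SpecialFlow.ceiling α n₀) f ψ g
                  * |t| ^ (-1 / 2 - ε : ℝ)) ∧
        SpecialFlow.HasACMaximalSpectralType
          (SpecialFlow.flow α (SpecialFlow.ceiling α n₀))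
          (SpecialFlow.phaseMeasure (SpecialFlow.ceiling α n₀)) := by
  refine ⟨1 / 8, by norm_num, ?_⟩
  rw [show (-1 / 2 - 1 / 8 : ℝ) = -5 / 8 by norm_num]
  refine ⟨SpecialFlow.integrableOn_sq_rpow, fun α hα n₀ hpos => ?_⟩
  obtain ⟨c, Φ, h⟩ := SpecialFlow.exists_isRoof_ceiling hα n₀ hpos
  obtain ⟨Cr, hCr, hres⟩ := SpecialFlow.exists_isResonant_pair hα n₀ c
  refine ⟨fun ζ hζ => ?_, SpecialFlow.hasACMaximalSpectralType_flow h hα fun ζ hζ => ?_⟩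
  · obtain ⟨C, hC, hbound⟩ := SpecialFlow.exists_correlation_bound h hCr hres hζ
    exact ⟨C, hC, fun f ψ g hf hg hs t ht =>
      ⟨SpecialFlow.integrable_flow_mul h hζ hf.1 hg hs t, hbound f ψ g hf hg hs t ht⟩⟩
  · obtain ⟨C, -, hbound⟩ := SpecialFlow.exists_correlation_bound h hCr hres hζ
    exact ⟨C, hbound⟩
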